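/- Let $\mathcal E$ be a category with finite limits. *Polynomials.* A morphism $f\colon A\to B$ of $\mathcal E$ is *exponentiable* if pullback along it, $\Delta_f\colon\mathcal E/B\to\mathcal E/A$, has a right adjoint $\Pi_f$. A *polynomial* in $\mathcal E$ is an exponentiable morphism $p\colon P_*\to P$. A morphism $\phi\colon p\to q$ consists of $\phi_1\colon P\to Q$ and $\phi^\sharp\colon P\times_Q Q_*\to P_*$ over $P$ (up to isomorphism of the chosen pullback); it is *cartesian* if $\phi^\sharp$ is invertible. The composite of $\phi\colon p\to q$ and $\psi\colon q\to r$ is $\psi_1\phi_1$ on $P$ and $(x,e)\mapsto\phi^\sharp(x,\psi^\sharp(\phi_1x,e))$ on $P\times_R R_*$. This gives a category $\mathrm{Poly}_{\mathcal E}$. A polynomial $p$ induces the endofunctor $\mathbf P(p)$ of $\mathcal E$ sending $A$ to the domain of $\Pi_p(A\times P_*\to P_*)$, whose generalized elements are pairs $(x,g)$ with $x$ in $P$ and $g$ a map from the fibre of $p$ over $x$ to $A$; a morphism $\phi\colon p\to q$ induces the natural transformation $\mathbf P(\phi)\colon(x,g)\mapsto(\phi_1x,\,g\circ\phi^\sharp(x,-))$.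 The composition product $p\triangleleft q$ is the composite $$(\mathbf P(p)(Q)\times_P P_*)\times_Q Q_*\to \mathbf P(p)(Q)\times_P P_*\to\mathbf P(p)(Q),$$ the first pullback being along the evaluation map $\mathbf P(p)(Q)\times_P P_*\to Q$. With $\triangleleft$ and $y=\mathrm{id}_1$, $\mathrm{Poly}_{\mathcal E}$ is a monoidal category, and $\mathbf P(p\triangleleft q)\cong\mathbf P(p)\circ\mathbf P(q)$, $\mathbf P(y)\cong\mathrm{id}$ naturally. *Comonoids and coalgebras.* Let $c\colon C_*\to C$, with $\epsilon\colon c\to y$ and $\delta\colon c\to c\triangleleft c$, be a comonoid in $(\mathrm{Poly}_{\mathcal E},y,\triangleleft)$. Then $\mathbf P(c)$ is a comonad on $\mathcal E$ with counit $\mathbf P(c)\to\mathbf P(y)\cong\mathrm{id}$ and comultiplication $\mathbf P(c)\to\mathbf P(c\triangleleft c)\cong\mathbf P(c)\circ\mathbf P(c)$. A $c$-coalgebra is a coalgebra of this comonad, that is, a map $\kappa\colon S\to\mathbf P(c)(S)$ satisfying the counit and comultiplication equations; a homomorphism is a morphism of $\mathcal E$ commuting with the maps $\kappa$. *Internal categories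 and copresheaves.* The comonoid $c$ is regarded as the category internal to $\mathcal E$ with objects $C$, morphisms $C_*$ and source $c$; its identities are given by $\epsilon^\sharp$; the target of a morphism $f$ out of $x$ is the value of $\delta_1(x)\in\mathbf P(c)(C)$ at $f$; and the composite of $f$ out of $x$ with $g$ out of the target of $f$ is $\delta^\sharp(x,(f,g))$. For categories $\mathcal D,\mathcal C$ internal to $\mathcal E$, an *internal cofunctor* $\phi\colon\mathcal D\to\mathcal C$ consists of $\phi_1\colon D_0\to C_0$ and $\phi^\sharp\colon D_0\times_{C_0}C_1\to D_1$ over $D_0$ (the pullback being formed with the source map of $\mathcal C$) such that $\phi^\sharp(x,\mathrm{id}_{\phi_1x})=\mathrm{id}_x$; $\phi_1(t\,\phi^\sharp(x,e))=t(e)$; and, whenever $t(e)=s(e')$, the morphism $\phi^\sharp(x,e'\circ e)$ is $\phi^\sharp(t\,\phi^\sharp(x,e),e')\circ\phi^\sharp(x,e)$. Cofunctors are composed by the formula for morphisms of polynomials. An *internal copresheaf* (internal discrete opfibration) on $\mathcal C$ is an internal cofunctor $\phi\colon\mathcal D\to\mathcal C$ from an internal category $\mathcal D$ with $\phi^\sharp$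 invertible; a morphism of internal copresheaves on $\mathcal C$ is an internal cofunctor $\mathcal D\to\mathcal D'$ commuting with the cofunctors to $\mathcal C$. **Theorem.** Let $\mathcal E$ be a category with finite limits and let $c$ be a comonoid in $(\mathrm{Poly}_{\mathcal E},y,\triangleleft)$. Then the category of $c$-coalgebras is equivalent to the category of internal copresheaves on the category internal to $\mathcal E$ given by $c$. -/

import Mathlib

open CategoryTheory Limits MonoidalCategory MonoidalOpposite

universe v u

namespace InternalPoly

attribute [local simp] pullback.lift_fst pullback.lift_snd pullback.lift_fst_assoc
  pullback.lift_snd_assoc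

section Exponentiable

variable {E : Type u} [Category.{v} E] [HasFiniteLimits E]

/-- A morphism is exponentiable if pulling back along it has a right adjoint. -/
def Exponentiable {B A : E} (f : B ⟶ A) : Prop := (Over.pullback f).IsLeftAdjoint

theorem Exponentiable.id (A : E) : Exponentiable (𝟙 A) :=
  (Adjunction.id.ofNatIsoLeft Over.pullbackId.symm).isLeftAdjoint

theorem Exponentiable.comp {C B A : E} {g : C ⟶ B} {f : B ⟶ A}
    (hg : Exponentiable g) (hf : Exponentiable f) : Exponentiable (g ≫ f) := by
  have : (Over.pullback g).IsLeftAdjoint := hg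
  have : (Over.pullback f).IsLeftAdjoint := hf
  exact ((Adjunction.ofIsLeftAdjoint (Over.pullback f ⋙ Over.pullback g)).ofNatIsoLeft
    (Over.pullbackComp g f).symm).isLeftAdjoint

/-- The unit of `Σ_f ⊣ Δ_f` is a regular monomorphism. -/
noncomputable def regularMonoUnit {B A : E} (f : B ⟶ A) (X : Over B) :
    RegularMono ((Over.mapPullbackAdj f).unit.app X) := by
  let a : pullback (X.hom ≫ f) f ⟶ X.left := pullback.fst (X.hom ≫ f) f
  let b : pullback (X.hom ≫ f) f ⟶ B := pullback.snd (X.hom ≫ f) f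
  have hab : (a ≫ X.hom) ≫ f = b ≫ f := (Category.assoc _ _ _).trans pullback.condition
  let l : pullback (X.hom ≫ f) f ⟶ pullback f f := pullback.lift (a ≫ X.hom) b hab
  let r : pullback (X.hom ≫ f) f ⟶ pullback f f := pullback.lift b b rfl
  let n : X.left ⟶ pullback (X.hom ≫ f) f :=
    pullback.lift (𝟙 _) X.hom (Category.id_comp _)
  have na : n ≫ a = 𝟙 _ := pullback.lift_fst _ _ _
  have nb : n ≫ b = X.hom := pullback.lift_snd _ _ _
  have la : l ≫ pullback.fst f f = a ≫ X.hom := pullback.lift_fst _ _ _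
  have lb : l ≫ pullback.snd f f = b := pullback.lift_snd _ _ _
  have ra : r ≫ pullback.fst f f = b := pullback.lift_fst _ _ _
  have rb : r ≫ pullback.snd f f = b := pullback.lift_snd _ _ _
  have ext' : ∀ {T : E} (s t : T ⟶ pullback (X.hom ≫ f) f), s ≫ a = t ≫ a → s ≫ b = t ≫ b →
    s = t := fun s t h h' => pullback.hom_ext h h'
  have key : n ≫ l = n ≫ r := by
    apply pullback.hom_ext
    · rw [Category.assoc, Category.assoc, la, ra, nb, reassoc_of% na]
    · rw [Category.assoc, Category.assoc, lb, rb]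
  let L : Over.mk b ⟶ Over.mk (pullback.snd f f) := Over.homMk l lb
  let R : Over.mk b ⟶ Over.mk (pullback.snd f f) := Over.homMk r rb
  let N : X ⟶ Over.mk b := Over.homMk n nb
  have hNLR : N ≫ L = N ≫ R := Over.OverMorphism.ext key
  have lim : IsLimit (Fork.ofι N hNLR) := Fork.IsLimit.mk' _ fun s => by
    let i : s.pt.left ⟶ pullback (X.hom ≫ f) f := s.ι.left
    have hs : i ≫ l = i ≫ r := congrArg CommaMorphism.left s.condition
    have h1 : i ≫ a ≫ X.hom = i ≫ b := by
      have := congrArg (· ≫ pullback.fst f f) hs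
      simpa only [Category.assoc, la, ra] using this
    have hw : i ≫ b = s.pt.hom := Over.w s.ι
    have hw' : (i ≫ a) ≫ X.hom = s.pt.hom := (Category.assoc _ _ _).trans (h1.trans hw)
    refine ⟨Over.homMk (i ≫ a) hw', ?_, ?_⟩
    · apply Over.OverMorphism.ext
      change (i ≫ a) ≫ n = i
      apply ext'
      · rw [Category.assoc, Category.assoc, na, Category.comp_id]
      · rw [Category.assoc, Category.assoc, nb, h1]
    · intro m hm
      apply Over.OverMorphism.ext
      let m' : s.pt.left ⟶ X.left := m.left
      change m' = i ≫ a
      have : m' ≫ n = i := congrArg CommaMorphism.left hm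
      rw [← this, Category.assoc, na, Category.comp_id]
  have hN : (Over.mapPullbackAdj f).unit.app X = N :=
    Over.OverMorphism.ext (by simp [N, n])
  rw [hN]
  exact
    { Z := Over.mk (pullback.snd f f)
      left := L
      right := R
      w := hNLR
      isLimit := lim }

/-- Exponentiable morphisms are stable under pullback. -/
theorem Exponentiable.of_isPullback {B' B A' A : E} {g : B' ⟶ B} {f' : B' ⟶ A'} {f : B ⟶ A}
    {h : A' ⟶ A} (sq : IsPullback g f' f h) (hf : Exponentiable f) : Exponentiable f' := by
  have : (Over.pullback f).IsLeftAdjoint := hf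
  let F : ∀ {X : E} (x : X ⟶ A'), pullback (x ≫ h) f ⟶ pullback x f' := fun x =>
    pullback.lift (pullback.fst (x ≫ h) f)
      (sq.lift (pullback.snd (x ≫ h) f) (pullback.fst (x ≫ h) f ≫ x)
        (by simp [pullback.condition])) (by simp)
  let G : ∀ {X : E} (x : X ⟶ A'), pullback x f' ⟶ pullback (x ≫ h) f := fun x =>
    pullback.lift (pullback.fst x f') (pullback.snd x f' ≫ g)
      (by simp [pullback.condition_assoc, sq.w])
  have FG : ∀ {X : E} (x : X ⟶ A'), F x ≫ G x = 𝟙 _ := fun x => by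
    apply pullback.hom_ext <;> simp [F, G]
  have GF : ∀ {X : E} (x : X ⟶ A'), G x ≫ F x = 𝟙 _ := fun x => by
    apply pullback.hom_ext
    · simp [F, G]
    · apply sq.hom_ext <;> simp [F, G, pullback.condition]
  have hF : ∀ {X : E} (x : X ⟶ A'), (F x ≫ pullback.snd x f') ≫ g = pullback.snd (x ≫ h) f :=
    fun x => by simp [F]
  have nat : ∀ {X Y : E} (x : X ⟶ A') (y : Y ⟶ A') (k : X ⟶ Y) (w : k ≫ y = x),
      pullback.lift (pullback.fst (x ≫ h) f ≫ k) (pullback.snd (x ≫ h) f)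
        (by rw [Category.assoc, reassoc_of% w, pullback.condition]) ≫ F y =
      F x ≫ pullback.lift (pullback.fst x f' ≫ k) (pullback.snd x f')
        (by rw [Category.assoc, w, pullback.condition]) := fun x y k w => by
    subst w
    apply pullback.hom_ext
    · simp [F]
    · apply sq.hom_ext <;> simp [F]
  let comm : Over.map h ⋙ Over.pullback f ≅ Over.pullback f' ⋙ Over.map g :=
    NatIso.ofComponents (fun X => Over.isoMk
      { hom := F X.hom
        inv := G X.hom
        hom_inv_id := FG X.hom
        inv_hom_id := GF X.hom }
      ((Category.assoc _ _ _).symm.trans (hF X.hom)))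
      (fun {X Y} k => Over.OverMorphism.ext (nat X.hom Y.hom k.left (Over.w k)))
  have := ((Adjunction.ofIsLeftAdjoint (Over.map h ⋙ Over.pullback f)).ofNatIsoLeft
    comm).isLeftAdjoint
  exact isLeftAdjoint_triangle_lift (Over.pullback f') (Over.mapPullbackAdj g)
    (fun X => regularMonoUnit g X)

end Exponentiable

section Polynomials

variable {E : Type u} [Category.{v} E] [HasFiniteLimits E]

/-- Morphisms between arrows `p : A ⟶ B` and `q : A' ⟶ B'`, going forwards on codomains
("positions") and backwards on domains ("directions"):
```
A <-- B ×_{B'} A' --> A'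
|p        |           |q
B ======= B --------> B'
```
The choice of the pullback `B ×_{B'} A'` is fixed to be `pullback onPos q`, which picks out exactly
one representative of each isomorphism class of such diagrams. -/
structure ArrowLens {A B A' B' : E} (p : A ⟶ B) (q : A' ⟶ B') where
  onPos : B ⟶ B'
  onDir : pullback onPos q ⟶ A
  onDir_comp : onDir ≫ p = pullback.fst onPos q

namespace ArrowLens

variable {A B A' B' A'' B'' : E} {p : A ⟶ B} {q : A' ⟶ B'} {r : A'' ⟶ B''}

/-- The action of `φ.onDir` on generalized elements: for `x` in `B` and `e` in `A'` over the image
of `x`, this is the element of `A` over `x` assigned to `(x, e)`. -/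
noncomputable def app (φ : ArrowLens p q) {T : E} (x : T ⟶ B) (e : T ⟶ A')
    (h : x ≫ φ.onPos = e ≫ q) : T ⟶ A :=
  pullback.lift x e h ≫ φ.onDir

@[simp]
theorem app_comp (φ : ArrowLens p q) {T : E} (x : T ⟶ B) (e : T ⟶ A')
    (h : x ≫ φ.onPos = e ≫ q) : φ.app x e h ≫ p = x := by
  simp [app, φ.onDir_comp]

@[simp]
theorem app_comp_assoc (φ : ArrowLens p q) {T : E} (x : T ⟶ B) (e : T ⟶ A')
    (h : x ≫ φ.onPos = e ≫ q) {Z : E} (k : B ⟶ Z) : φ.app x e h ≫ p ≫ k = x ≫ k := by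
  rw [← Category.assoc, φ.app_comp]

theorem comp_app (φ : ArrowLens p q) {S T : E} (s : S ⟶ T) (x : T ⟶ B) (e : T ⟶ A')
    (h : x ≫ φ.onPos = e ≫ q) :
    s ≫ φ.app x e h = φ.app (s ≫ x) (s ≫ e) (by simp [h]) := by
  rw [app, app, ← Category.assoc]
  congr 1
  apply pullback.hom_ext <;> simp

theorem app_congr {φ ψ : ArrowLens p q} (hφ : φ = ψ) {T : E} {x x' : T ⟶ B} {e e' : T ⟶ A'}
    (hx : x = x') (he : e = e') (h : x ≫ φ.onPos = e ≫ q) (h' : x' ≫ ψ.onPos = e' ≫ q) :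
    φ.app x e h = ψ.app x' e' h' := by
  subst hφ hx he; rfl

theorem app_fst_snd (φ : ArrowLens p q) :
    φ.app (pullback.fst φ.onPos q) (pullback.snd φ.onPos q) pullback.condition = φ.onDir := by
  rw [app, pullback.lift_fst_snd, Category.id_comp]

theorem ext {φ ψ : ArrowLens p q} (hpos : φ.onPos = ψ.onPos)
    (hdir : ∀ {T : E} (x : T ⟶ B) (e : T ⟶ A') (h : x ≫ φ.onPos = e ≫ q)
      (h' : x ≫ ψ.onPos = e ≫ q), φ.app x e h = ψ.app x e h') : φ = ψ := by
  obtain ⟨f, d, hd⟩ := φ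
  obtain ⟨f', d', hd'⟩ := ψ
  obtain rfl : f = f' := hpos
  obtain rfl : d = d' := by
    have := hdir (pullback.fst f q) (pullback.snd f q) pullback.condition pullback.condition
    simpa [app] using this
  rfl

/-- Build a morphism from its action on generalized elements. -/
@[simps onPos]
noncomputable def ofElements (f : B ⟶ B')
    (d : ∀ {T : E} (x : T ⟶ B) (e : T ⟶ A'), x ≫ f = e ≫ q → (T ⟶ A))
    (hd : ∀ {T : E} (x : T ⟶ B) (e : T ⟶ A') (h : x ≫ f = e ≫ q), d x e h ≫ p = x) :
    ArrowLens p q where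
  onPos := f
  onDir := d (pullback.fst f q) (pullback.snd f q) pullback.condition
  onDir_comp := hd _ _ _

theorem ofElements_app (f : B ⟶ B')
    (d : ∀ {T : E} (x : T ⟶ B) (e : T ⟶ A'), x ≫ f = e ≫ q → (T ⟶ A))
    (hd : ∀ {T : E} (x : T ⟶ B) (e : T ⟶ A') (h : x ≫ f = e ≫ q), d x e h ≫ p = x)
    (nat : ∀ {S T : E} (s : S ⟶ T) (x : T ⟶ B) (e : T ⟶ A') (h : x ≫ f = e ≫ q),
      s ≫ d x e h = d (s ≫ x) (s ≫ e) (by simp [h]))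
    {T : E} (x : T ⟶ B) (e : T ⟶ A') (h : x ≫ f = e ≫ q) :
    (ofElements f d hd).app x e h = d x e h := by
  refine (nat _ _ _ _).trans ?_
  have h1 := pullback.lift_fst x e h
  have h2 := pullback.lift_snd x e h
  congr 1

/-- The identity morphism. -/
@[simps onPos]
noncomputable def id (p : A ⟶ B) : ArrowLens p p where
  onPos := 𝟙 B
  onDir := pullback.snd (𝟙 B) p
  onDir_comp := by rw [← pullback.condition, Category.comp_id]

@[simp]
theorem id_app {T : E} (x : T ⟶ B) (e : T ⟶ A) (h : x ≫ (ArrowLens.id p).onPos = e ≫ p) :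
    (ArrowLens.id p).app x e h = e :=
  pullback.lift_snd _ _ _

/-- Composition, `(x, e) ↦ φ♯ (x, ψ♯ (φ x, e))` on directions. -/
@[simps onPos]
noncomputable def comp (φ : ArrowLens p q) (ψ : ArrowLens q r) : ArrowLens p r where
  onPos := φ.onPos ≫ ψ.onPos
  onDir := φ.app (pullback.fst (φ.onPos ≫ ψ.onPos) r)
    (ψ.app (pullback.fst (φ.onPos ≫ ψ.onPos) r ≫ φ.onPos) (pullback.snd (φ.onPos ≫ ψ.onPos) r)
      (by rw [Category.assoc, pullback.condition]))
    (by rw [app_comp])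
  onDir_comp := by rw [app_comp]

@[simp]
theorem comp_app' (φ : ArrowLens p q) (ψ : ArrowLens q r) {T : E} (x : T ⟶ B) (e : T ⟶ A'')
    (h : x ≫ (φ.comp ψ).onPos = e ≫ r) :
    (φ.comp ψ).app x e h =
      φ.app x (ψ.app (x ≫ φ.onPos) e (by rw [Category.assoc, ← h, comp_onPos]))
        (by rw [app_comp]) := by
  refine (comp_app φ (pullback.lift x e h) _ _ _).trans (app_congr rfl ?_ ?_ _ _)
  · exact pullback.lift_fst _ _ _
  · refine (comp_app ψ (pullback.lift x e h) _ _ _).trans (app_congr rfl ?_ ?_ _ _)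
    · exact (Category.assoc _ _ _).symm.trans
        (congrArg (· ≫ φ.onPos) (pullback.lift_fst _ _ _))
    · exact pullback.lift_snd _ _ _

theorem id_comp (φ : ArrowLens p q) : (ArrowLens.id p).comp φ = φ := by
  refine ArrowLens.ext (by simp) fun x e h h' => ?_
  rw [ArrowLens.comp_app', ArrowLens.id_app]
  exact ArrowLens.app_congr rfl (by simp) rfl _ _

theorem comp_id (φ : ArrowLens p q) : φ.comp (ArrowLens.id q) = φ := by
  refine ArrowLens.ext (by simp) fun x e h h' => ?_
  rw [ArrowLens.comp_app']
  exact ArrowLens.app_congr rfl rfl (by simp) _ _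

theorem assoc {X Y : E} {t : X ⟶ Y} (φ : ArrowLens p q) (ψ : ArrowLens q r)
    (χ : ArrowLens r t) : (φ.comp ψ).comp χ = φ.comp (ψ.comp χ) := by
  refine ArrowLens.ext (by simp) fun x e h h' => ?_
  simp only [ArrowLens.comp_app']
  refine ArrowLens.app_congr rfl rfl ?_ _ _
  refine ArrowLens.app_congr rfl rfl ?_ _ _
  exact ArrowLens.app_congr rfl (by simp) rfl _ _

/-- A morphism is cartesian when its component on directions is invertible. -/
def IsCartesian (φ : ArrowLens p q) : Prop := IsIso φ.onDir

end ArrowLens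

variable (E) in
/-- A polynomial in `E` is an exponentiable morphism `dir ⟶ pos`. -/
structure Poly where
  pos : E
  dir : E
  map : dir ⟶ pos
  exponentiable : Exponentiable map

noncomputable instance : Category (Poly E) where
  Hom p q := ArrowLens p.map q.map
  id p := ArrowLens.id p.map
  comp φ ψ := φ.comp ψ
  id_comp φ := φ.id_comp
  comp_id φ := φ.comp_id
  assoc φ ψ χ := φ.assoc ψ χ

namespace Poly

/-- The action of a morphism of polynomials on directions, on generalized elements. -/
noncomputable abbrev onDirApp {p q : Poly E} (φ : p ⟶ q) {T : E} (x : T ⟶ p.pos) (e : T ⟶ q.dir)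
    (h : x ≫ ArrowLens.onPos φ = e ≫ q.map) : T ⟶ p.dir := ArrowLens.app φ x e h

@[simp] theorem id_onPos (p : Poly E) : ArrowLens.onPos (𝟙 p) = 𝟙 p.pos := rfl

@[simp] theorem comp_onPos {p q r : Poly E} (φ : p ⟶ q) (ψ : q ⟶ r) :
    ArrowLens.onPos (φ ≫ ψ) = ArrowLens.onPos φ ≫ ArrowLens.onPos ψ := rfl

/-- The functor `Π_p`, right adjoint to pullback along `p`. -/
noncomputable def Pi (p : Poly E) : Over p.dir ⥤ Over p.pos :=
  haveI : (Over.pullback p.map).IsLeftAdjoint := p.exponentiable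
  Functor.rightAdjoint (Over.pullback p.map)

/-- The adjunction `Δ_p ⊣ Π_p`. -/
noncomputable def piAdj (p : Poly E) : Over.pullback p.map ⊣ p.Pi :=
  haveI : (Over.pullback p.map).IsLeftAdjoint := p.exponentiable
  Adjunction.ofIsLeftAdjoint (Over.pullback p.map)

/-- The polynomial endofunctor of `p`: the composite of `- × p.dir : E ⥤ E/p.dir`, of
`Π_p : E/p.dir ⥤ E/p.pos` and of the forgetful functor `E/p.pos ⥤ E`. -/
noncomputable def functor (p : Poly E) : E ⥤ E :=
  Over.star p.dir ⋙ p.Pi ⋙ Over.forget p.pos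

/-- The projection `P(p)(A) ⟶ p.pos`. -/
noncomputable def proj (p : Poly E) (A : E) : p.functor.obj A ⟶ p.pos :=
  (p.Pi.obj ((Over.star p.dir).obj A)).hom

/-- The adjunction defining `P(p)(A)`. -/
noncomputable def starPiAdj (p : Poly E) :
    Over.pullback p.map ⋙ Over.forget p.dir ⊣ Over.star p.dir ⋙ p.Pi :=
  p.piAdj.comp (Over.forgetAdjStar p.dir)

/-- The universal evaluation `P(p)(A) ×_{p.pos} p.dir ⟶ A`. -/
noncomputable def ev (p : Poly E) (A : E) : pullback (p.proj A) p.map ⟶ A :=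
  p.starPiAdj.counit.app A

/-- Evaluate an element `u` of `P(p)(A)` at a direction `e` of its position. -/
noncomputable def eval (p : Poly E) {A T : E} (u : T ⟶ p.functor.obj A) (e : T ⟶ p.dir)
    (h : u ≫ p.proj A = e ≫ p.map) : T ⟶ A :=
  pullback.lift u e h ≫ p.ev A

/-- The universal property of `P(p)(A)`: a morphism `T ⟶ P(p)(A)` amounts to a morphism
`x : T ⟶ p.pos` and a morphism `T ×_{p.pos} p.dir ⟶ A`. -/
noncomputable def curry (p : Poly E) {A T : E} (x : T ⟶ p.pos) (g : pullback x p.map ⟶ A) :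
    T ⟶ p.functor.obj A :=
  (p.starPiAdj.homEquiv (Over.mk x) A g).left

@[simp]
theorem curry_proj (p : Poly E) {A T : E} (x : T ⟶ p.pos) (g : pullback x p.map ⟶ A) :
    p.curry x g ≫ p.proj A = x :=
  Over.w (p.starPiAdj.homEquiv (Over.mk x) A g)

@[simp]
theorem curry_proj_assoc (p : Poly E) {A T : E} (x : T ⟶ p.pos) (g : pullback x p.map ⟶ A)
    {Z : E} (k : p.pos ⟶ Z) : p.curry x g ≫ p.proj A ≫ k = x ≫ k := by
  rw [← Category.assoc, curry_proj]

theorem comp_eval (p : Poly E) {A S T : E} (s : S ⟶ T) (u : T ⟶ p.functor.obj A) (e : T ⟶ p.dir)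
    (h : u ≫ p.proj A = e ≫ p.map) :
    s ≫ p.eval u e h = p.eval (s ≫ u) (s ≫ e) (by simp [h]) := by
  rw [eval, eval, ← Category.assoc]
  congr 1
  apply pullback.hom_ext <;> simp

theorem eval_congr (p : Poly E) {A T : E} {u u' : T ⟶ p.functor.obj A} {e e' : T ⟶ p.dir}
    (hu : u = u') (he : e = e') (h : u ≫ p.proj A = e ≫ p.map) (h' : u' ≫ p.proj A = e' ≫ p.map) :
    p.eval u e h = p.eval u' e' h' := by
  subst hu he; rfl

theorem counit_eq (p : Poly E) {A : E} {T : Over p.pos}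
    (w : T ⟶ (Over.star p.dir ⋙ p.Pi).obj A) :
    (p.starPiAdj.homEquiv T A).symm w =
      pullback.lift (pullback.fst T.hom p.map ≫ w.left) (pullback.snd T.hom p.map)
        ((Category.assoc _ _ _).trans ((congrArg (pullback.fst T.hom p.map ≫ ·) (Over.w w)).trans
          pullback.condition)) ≫ p.ev A := by
  rw [Adjunction.homEquiv_counit]
  rfl

theorem eval_comp_curry (p : Poly E) {A S T : E} (s : S ⟶ T) (x : T ⟶ p.pos)
    (g : pullback x p.map ⟶ A) (e : S ⟶ p.dir) (h : (s ≫ p.curry x g) ≫ p.proj A = e ≫ p.map) :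
    p.eval (s ≫ p.curry x g) e h = pullback.lift s e (by rw [← h]; simp) ≫ g := by
  have : g = pullback.lift (pullback.fst x p.map ≫ p.curry x g) (pullback.snd x p.map)
      (by rw [Category.assoc, curry_proj, pullback.condition]) ≫ p.ev A :=
    ((p.starPiAdj.homEquiv (Over.mk x) A).symm_apply_apply g).symm.trans
      (p.counit_eq (p.starPiAdj.homEquiv (Over.mk x) A g))
  refine Eq.trans ?_ (congrArg (pullback.lift s e (by rw [← h]; simp) ≫ ·) this.symm)
  rw [eval, ← Category.assoc]
  congr 1
  apply pullback.hom_ext <;> simp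

theorem eval_curry (p : Poly E) {A T : E} (x : T ⟶ p.pos) (g : pullback x p.map ⟶ A)
    (e : T ⟶ p.dir) (h : p.curry x g ≫ p.proj A = e ≫ p.map) :
    p.eval (p.curry x g) e h = pullback.lift (𝟙 T) e (by rw [← h]; simp) ≫ g := by
  rw [← eval_comp_curry p (𝟙 T) x g e (by simpa using h)]
  exact eval_congr p (by simp) rfl _ _

theorem hom_ext (p : Poly E) {A T : E} {u v : T ⟶ p.functor.obj A}
    (h : u ≫ p.proj A = v ≫ p.proj A)
    (h' : ∀ {S : E} (s : S ⟶ T) (e : S ⟶ p.dir) (hu : (s ≫ u) ≫ p.proj A = e ≫ p.map)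
      (hv : (s ≫ v) ≫ p.proj A = e ≫ p.map), p.eval (s ≫ u) e hu = p.eval (s ≫ v) e hv) :
    u = v := by
  let U : Over.mk (u ≫ p.proj A) ⟶ (Over.star p.dir ⋙ p.Pi).obj A := Over.homMk u rfl
  let V : Over.mk (u ≫ p.proj A) ⟶ (Over.star p.dir ⋙ p.Pi).obj A := Over.homMk v h.symm
  suffices U = V from congrArg CommaMorphism.left this
  apply (p.starPiAdj.homEquiv _ A).symm.injective
  rw [counit_eq, counit_eq]
  exact h' (pullback.fst (u ≫ p.proj A) p.map) (pullback.snd (u ≫ p.proj A) p.map)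
    (by rw [Category.assoc, pullback.condition])
    (by rw [Category.assoc, ← h, pullback.condition])

@[simp]
theorem map_proj (p : Poly E) {A A' : E} (f : A ⟶ A') :
    p.functor.map f ≫ p.proj A' = p.proj A :=
  Over.w (p.Pi.map ((Over.star p.dir).map f))

@[simp]
theorem map_proj_assoc (p : Poly E) {A A' : E} (f : A ⟶ A') {Z : E} (k : p.pos ⟶ Z) :
    p.functor.map f ≫ p.proj A' ≫ k = p.proj A ≫ k := by
  rw [← Category.assoc, map_proj]

theorem map_ev (p : Poly E) {A A' : E} (f : A ⟶ A') :
    pullback.lift (pullback.fst (p.proj A) p.map ≫ p.functor.map f)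
      (pullback.snd (p.proj A) p.map) (by rw [Category.assoc, map_proj, pullback.condition]) ≫
      p.ev A' = p.ev A ≫ f :=
  p.starPiAdj.counit.naturality f

theorem eval_map (p : Poly E) {A A' T : E} (f : A ⟶ A') (u : T ⟶ p.functor.obj A) (e : T ⟶ p.dir)
    (h : (u ≫ p.functor.map f) ≫ p.proj A' = e ≫ p.map) :
    p.eval (u ≫ p.functor.map f) e h = p.eval u e (by simpa using h) ≫ f := by
  rw [eval, eval, Category.assoc, ← map_ev, ← Category.assoc]
  congr 1
  apply pullback.hom_ext <;> simp

/-- The natural transformation `P(p) ⟶ P(q)` of a morphism of polynomials `φ : p ⟶ q`, given on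
generalized elements by `(x, g) ↦ (φ x, g ∘ φ♯)`. -/
noncomputable def natApp {p q : Poly E} (φ : p ⟶ q) (A : E) : p.functor.obj A ⟶ q.functor.obj A :=
  q.curry (p.proj A ≫ ArrowLens.onPos φ)
    (p.eval (pullback.fst (p.proj A ≫ ArrowLens.onPos φ) q.map)
      (ArrowLens.app φ (pullback.fst (p.proj A ≫ ArrowLens.onPos φ) q.map ≫ p.proj A)
        (pullback.snd (p.proj A ≫ ArrowLens.onPos φ) q.map)
        (by rw [Category.assoc, pullback.condition]))
      (by rw [ArrowLens.app_comp]))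

@[simp]
theorem natApp_proj {p q : Poly E} (φ : p ⟶ q) (A : E) :
    natApp φ A ≫ q.proj A = p.proj A ≫ ArrowLens.onPos φ := by
  simp [natApp]

@[simp]
theorem natApp_proj_assoc {p q : Poly E} (φ : p ⟶ q) (A : E) {Z : E} (k : q.pos ⟶ Z) :
    natApp φ A ≫ q.proj A ≫ k = p.proj A ≫ ArrowLens.onPos φ ≫ k := by
  rw [← Category.assoc, natApp_proj, Category.assoc]

theorem eval_natApp {p q : Poly E} (φ : p ⟶ q) {A T : E} (u : T ⟶ p.functor.obj A)
    (e : T ⟶ q.dir) (h : (u ≫ natApp φ A) ≫ q.proj A = e ≫ q.map) :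
    q.eval (u ≫ natApp φ A) e h =
      p.eval u (ArrowLens.app φ (u ≫ p.proj A) e (by rw [← h]; simp))
        (by rw [ArrowLens.app_comp]) := by
  refine (q.eval_comp_curry _ _ _ _ _).trans ?_
  rw [comp_eval]
  refine eval_congr p (by simp) ?_ _ _
  rw [ArrowLens.comp_app]
  exact ArrowLens.app_congr rfl (by simp) (by simp) _ _

/-- The natural transformation induced by a morphism of polynomials. -/
@[simps]
noncomputable def natTrans {p q : Poly E} (φ : p ⟶ q) : p.functor ⟶ q.functor where
  app A := natApp φ A
  naturality A A' f := by
    refine q.hom_ext (by simp) fun s e hu hv => ?_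
    have hu' := hu
    have hv' := hv
    rw [← Category.assoc] at hu' hv'
    refine (q.eval_congr (Category.assoc _ _ _).symm rfl _ hu').trans ?_
    refine Eq.trans ?_ (q.eval_congr (Category.assoc _ _ _).symm rfl _ hv').symm
    rw [eval_natApp, eval_map, eval_map, eval_natApp]
    congr 1
    refine p.eval_congr rfl ?_ _ _
    exact ArrowLens.app_congr rfl (by simp) rfl _ _

variable (E) in
/-- The functor from polynomials to endofunctors of `E`. -/
@[simps]
noncomputable def toEndofunctor : Poly E ⥤ (E ⥤ E) where
  obj p := p.functor
  map φ := natTrans φ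
  map_id p := by
    ext A
    refine p.hom_ext (by simp) fun s e hu hv => ?_
    simp only [natTrans_app] at hu hv ⊢
    rw [eval_natApp]
    exact p.eval_congr (by simp) (ArrowLens.id_app _ _ _) _ _
  map_comp {p q r} φ ψ := by
    ext A
    refine r.hom_ext (by simp) fun s e hu hv => ?_
    simp only [natTrans_app, NatTrans.comp_app] at hu hv ⊢
    have hv' := hv
    rw [← Category.assoc s] at hv'
    refine Eq.trans ?_ (r.eval_congr (Category.assoc _ _ _).symm rfl _ hv').symm
    rw [eval_natApp, eval_natApp, eval_natApp]
    refine p.eval_congr rfl ?_ _ _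
    refine (ArrowLens.comp_app' φ ψ _ _ _).trans ?_
    refine ArrowLens.app_congr rfl rfl ?_ _ _
    exact ArrowLens.app_congr rfl (by simp) rfl _ _

instance : (toEndofunctor E).Faithful where
  map_injective {p q} φ ψ h := by
    let gen : p.pos ⟶ p.functor.obj p.dir := p.curry (𝟙 _) (pullback.snd (𝟙 _) p.map)
    have hgen : gen ≫ p.proj _ = 𝟙 _ := curry_proj _ _ _
    have key : gen ≫ natApp φ p.dir = gen ≫ natApp ψ p.dir :=
      congrArg (gen ≫ NatTrans.app · p.dir) h
    have pos : ∀ χ : p ⟶ q, (gen ≫ natApp χ p.dir) ≫ q.proj p.dir = ArrowLens.onPos χ := by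
      intro χ
      rw [Category.assoc, natApp_proj, reassoc_of% hgen]
    have dir : ∀ (χ : p ⟶ q) {T : E} (x : T ⟶ p.pos) (e : T ⟶ q.dir)
        (h : x ≫ ArrowLens.onPos χ = e ≫ q.map)
        (h' : (x ≫ gen ≫ natApp χ p.dir) ≫ q.proj p.dir = e ≫ q.map),
        ArrowLens.app χ x e h = q.eval (x ≫ gen ≫ natApp χ p.dir) e h' := by
      intro χ T x e h h'
      have h'' := h'
      rw [← Category.assoc x] at h''
      refine Eq.trans ?_ (q.eval_congr (Category.assoc _ _ _).symm rfl _ h'').symm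
      rw [eval_natApp]
      refine Eq.trans ?_ (p.eval_comp_curry x _ _ _ _).symm
      rw [pullback.lift_snd]
      exact ArrowLens.app_congr rfl (by rw [Category.assoc, hgen, Category.comp_id]) rfl _ _
    refine ArrowLens.ext (by rw [← pos φ, ← pos ψ, key]) fun x e h h' => ?_
    rw [dir φ x e h (by rw [Category.assoc, pos, h]), dir ψ x e h' (by rw [Category.assoc, pos, h'])]
    exact q.eval_congr (by rw [key]) rfl _ _

variable (E) in
/-- The identity polynomial `y`, the identity of the terminal object. -/
noncomputable abbrev y : Poly E := ⟨⊤_ E, ⊤_ E, 𝟙 _, Exponentiable.id _⟩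

/-- The directions `(P(p)(q.pos) ×_{p.pos} p.dir) ×_{q.pos} q.dir` of the composition product. -/
noncomputable def triDir (p q : Poly E) : E := pullback (p.ev q.pos) q.map

/-- The underlying morphism of the composition product: the composite of the top row of
```
triDir ---> P(p)(q.pos) ×_{p.pos} p.dir ------> P(p)(q.pos)
 |                  |            |                   |
 |               ev |            |                   |
 v                  v            v                   v
q.dir -----------> q.pos       p.dir ------------> p.pos
```
in which both squares are pullbacks and the right-hand one, together with `ev`, is the
distributivity pullback. -/
noncomputable def triMap (p q : Poly E) : triDir p q ⟶ p.functor.obj q.pos :=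
  pullback.fst (p.ev q.pos) q.map ≫ pullback.fst (p.proj q.pos) p.map

theorem triMap_exponentiable (p q : Poly E) : Exponentiable (triMap p q) :=
  (q.exponentiable.of_isPullback (IsPullback.of_hasPullback _ _).flip).comp
    (p.exponentiable.of_isPullback (IsPullback.of_hasPullback _ _).flip)

/-- The composition product `p ◁ q` of polynomials. -/
noncomputable abbrev tri (p q : Poly E) : Poly E :=
  ⟨p.functor.obj q.pos, triDir p q, triMap p q, triMap_exponentiable p q⟩

/-- A direction of `p ◁ q` at `u` is a direction `a` of `p` at the position of `u` together with a
direction `b` of `q` at the value of `u` at `a`. -/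
noncomputable def triMk (p q : Poly E) {T : E} (u : T ⟶ p.functor.obj q.pos) (a : T ⟶ p.dir)
    (b : T ⟶ q.dir) (h : u ≫ p.proj q.pos = a ≫ p.map) (h' : p.eval u a h = b ≫ q.map) :
    T ⟶ triDir p q :=
  pullback.lift (pullback.lift u a h) b h'

/-- The component of a direction of `p ◁ q` in `p`. -/
noncomputable def triFst (p q : Poly E) : triDir p q ⟶ p.dir :=
  pullback.fst (p.ev q.pos) q.map ≫ pullback.snd (p.proj q.pos) p.map

/-- The component of a direction of `p ◁ q` in `q`. -/
noncomputable def triSnd (p q : Poly E) : triDir p q ⟶ q.dir :=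
  pullback.snd (p.ev q.pos) q.map

section

variable (p q : Poly E) {T : E} (u : T ⟶ p.functor.obj q.pos) (a : T ⟶ p.dir)
    (b : T ⟶ q.dir) (h : u ≫ p.proj q.pos = a ≫ p.map) (h' : p.eval u a h = b ≫ q.map)

@[simp]
theorem triMk_map : triMk p q u a b h h' ≫ triMap p q = u :=
  (pullback.lift_fst_assoc _ _ _ _).trans (pullback.lift_fst _ _ _)

@[simp]
theorem triMk_map_assoc {Z : E} (k : p.functor.obj q.pos ⟶ Z) :
    triMk p q u a b h h' ≫ triMap p q ≫ k = u ≫ k := by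
  rw [← Category.assoc, triMk_map]

@[simp]
theorem triMk_fst : triMk p q u a b h h' ≫ triFst p q = a :=
  (pullback.lift_fst_assoc _ _ _ _).trans (pullback.lift_snd _ _ _)

@[simp]
theorem triMk_fst_assoc {Z : E} (k : p.dir ⟶ Z) :
    triMk p q u a b h h' ≫ triFst p q ≫ k = a ≫ k := by
  rw [← Category.assoc, triMk_fst]

@[simp]
theorem triMk_snd : triMk p q u a b h h' ≫ triSnd p q = b :=
  pullback.lift_snd _ _ _

@[simp]
theorem triMk_snd_assoc {Z : E} (k : q.dir ⟶ Z) :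
    triMk p q u a b h h' ≫ triSnd p q ≫ k = b ≫ k := by
  rw [← Category.assoc, triMk_snd]

theorem triFst_map : triFst p q ≫ p.map = triMap p q ≫ p.proj q.pos := by
  refine (Category.assoc _ _ _).trans (Eq.trans ?_ (Category.assoc _ _ _).symm)
  rw [pullback.condition]

theorem triSnd_map' :
    triSnd p q ≫ q.map = pullback.fst (p.ev q.pos) q.map ≫ p.ev q.pos :=
  pullback.condition.symm

theorem triSnd_map {d : T ⟶ triDir p q} {u : T ⟶ p.functor.obj q.pos} {a : T ⟶ p.dir}
    (hu : u = d ≫ triMap p q) (ha : a = d ≫ triFst p q) (h : u ≫ p.proj q.pos = a ≫ p.map) :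
    p.eval u a h = (d ≫ triSnd p q) ≫ q.map := by
  subst hu ha
  rw [Category.assoc, triSnd_map']
  refine Eq.trans ?_ (Category.assoc _ _ _)
  refine congrArg (· ≫ p.ev q.pos) ?_
  apply pullback.hom_ext
  · exact (pullback.lift_fst _ _ _).trans (Category.assoc _ _ _).symm
  · exact (pullback.lift_snd _ _ _).trans (Category.assoc _ _ _).symm

variable {p q} in
theorem tri_hom_ext {s t : T ⟶ triDir p q} (h0 : s ≫ triMap p q = t ≫ triMap p q)
    (h1 : s ≫ triFst p q = t ≫ triFst p q) (h2 : s ≫ triSnd p q = t ≫ triSnd p q) : s = t := by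
  apply pullback.hom_ext
  · apply pullback.hom_ext
    · exact (Category.assoc _ _ _).trans (h0.trans (Category.assoc _ _ _).symm)
    · exact (Category.assoc _ _ _).trans (h1.trans (Category.assoc _ _ _).symm)
  · exact h2

variable {p q u a b} in
theorem triMk_congr {u' : T ⟶ p.functor.obj q.pos} {a' : T ⟶ p.dir} {b' : T ⟶ q.dir}
    (hu : u = u') (ha : a = a') (hb : b = b') (h₁ : u' ≫ p.proj q.pos = a' ≫ p.map)
    (h₂ : p.eval u' a' h₁ = b' ≫ q.map) : triMk p q u a b h h' = triMk p q u' a' b' h₁ h₂ := by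
  subst hu ha hb; rfl

theorem comp_triMk {S : E} (s : S ⟶ T) : s ≫ triMk p q u a b h h' =
    triMk p q (s ≫ u) (s ≫ a) (s ≫ b) (by simp [h]) (by rw [← comp_eval _ _ _ _ h, h',
      Category.assoc]) := by
  apply tri_hom_ext <;> simp

end

/-- For `u` in `P(p ◁ q)(A)` and a direction `a` of `p` at its position, the value in `q.pos`. -/
noncomputable def alphaPos (p q : Poly E) (A : E) :
    pullback ((tri p q).proj A ≫ p.proj q.pos) p.map ⟶ q.pos :=
  p.eval (pullback.fst ((tri p q).proj A ≫ p.proj q.pos) p.map ≫ (tri p q).proj A)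
    (pullback.snd ((tri p q).proj A ≫ p.proj q.pos) p.map)
    (by rw [Category.assoc, pullback.condition])

/-- For `u` in `P(p ◁ q)(A)`, a direction `a` of `p` at its position, and a direction `b` of `q` at
the value of `u` at `a`, the direction `(a, b)` of `p ◁ q`. -/
noncomputable def alphaDir (p q : Poly E) (A : E) :
    pullback (alphaPos p q A) q.map ⟶ triDir p q :=
  triMk p q
    (pullback.fst (alphaPos p q A) q.map ≫
      pullback.fst ((tri p q).proj A ≫ p.proj q.pos) p.map ≫ (tri p q).proj A)
    (pullback.fst (alphaPos p q A) q.map ≫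
      pullback.snd ((tri p q).proj A ≫ p.proj q.pos) p.map)
    (pullback.snd (alphaPos p q A) q.map)
    (by simp only [Category.assoc, pullback.condition])
    ((p.comp_eval _ _ _ _).symm.trans pullback.condition)

/-- For `u` in `P(p ◁ q)(A)` and a direction `a` of `p` at its position, the element
`b ↦ u (a, b)` of `P(q)(A)`. -/
noncomputable def alphaVal (p q : Poly E) (A : E) :
    pullback ((tri p q).proj A ≫ p.proj q.pos) p.map ⟶ q.functor.obj A :=
  q.curry (alphaPos p q A)
    ((tri p q).eval (pullback.fst (alphaPos p q A) q.map ≫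
        pullback.fst ((tri p q).proj A ≫ p.proj q.pos) p.map)
      (alphaDir p q A)
      (by rw [alphaDir, triMk_map, Category.assoc]))

/-- The comparison `P(p ◁ q)(A) ⟶ P(p)(P(q)(A))`, `u ↦ (a ↦ (b ↦ u (a, b)))`. -/
noncomputable def alpha (p q : Poly E) (A : E) :
    (tri p q).functor.obj A ⟶ p.functor.obj (q.functor.obj A) :=
  p.curry ((tri p q).proj A ≫ p.proj q.pos) (alphaVal p q A)

@[simp]
theorem alpha_proj (p q : Poly E) (A : E) :
    alpha p q A ≫ p.proj _ = (tri p q).proj A ≫ p.proj q.pos := by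
  simp [alpha]

@[simp]
theorem alpha_proj_assoc (p q : Poly E) (A : E) {Z : E} (k : p.pos ⟶ Z) :
    alpha p q A ≫ p.proj _ ≫ k = (tri p q).proj A ≫ p.proj q.pos ≫ k := by
  rw [← Category.assoc, alpha_proj, Category.assoc]

theorem eval_alpha_proj (p q : Poly E) {A T : E} (u : T ⟶ (tri p q).functor.obj A)
    (a : T ⟶ p.dir) (h : (u ≫ alpha p q A) ≫ p.proj _ = a ≫ p.map) :
    p.eval (u ≫ alpha p q A) a h ≫ q.proj A =
      p.eval (u ≫ (tri p q).proj A) a (by rw [← h]; simp) := by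
  refine (congrArg (· ≫ q.proj A) (p.eval_comp_curry _ _ _ _ _)).trans ?_
  refine (Category.assoc _ _ _).trans ((_ ≫= q.curry_proj _ _).trans ?_)
  refine (p.comp_eval _ _ _ _).trans ?_
  exact p.eval_congr (by simp) (by simp) _ _

theorem eval_eval_alpha (p q : Poly E) {A T S : E} (s : S ⟶ T) (u : T ⟶ (tri p q).functor.obj A)
    (a : T ⟶ p.dir) (b : S ⟶ q.dir) (h : (u ≫ alpha p q A) ≫ p.proj _ = a ≫ p.map)
    (h' : (s ≫ p.eval (u ≫ alpha p q A) a h) ≫ q.proj A = b ≫ q.map) :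
    q.eval (s ≫ p.eval (u ≫ alpha p q A) a h) b h' =
      (tri p q).eval (s ≫ u) (triMk p q (s ≫ u ≫ (tri p q).proj A) (s ≫ a) b
        (by have := s ≫= h; simpa using this)
        (((p.comp_eval s (u ≫ (tri p q).proj A) a (by rw [← h]; simp)).symm.trans
          (s ≫= (eval_alpha_proj p q u a h).symm)).trans ((Category.assoc _ _ _).symm.trans h')))
        (by rw [triMk_map]; simp) := by
  have e1 : p.eval (u ≫ alpha p q A) a h = _ := p.eval_comp_curry _ _ _ _ _
  have e2 : s ≫ p.eval (u ≫ alpha p q A) a h = _ := (s ≫= e1).trans (Category.assoc _ _ _).symm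
  have h'' := h'
  rw [e2] at h''
  refine (q.eval_congr e2 rfl _ h'').trans ?_
  refine (q.eval_comp_curry _ _ _ _ _).trans ?_
  rw [comp_eval]
  refine (tri p q).eval_congr (by simp) ?_ _ _
  refine (comp_triMk _ _ _ _ _ _ _ _).trans ?_
  exact triMk_congr _ _ (by simp) (by simp) (by simp) _ _

/-- The inverse comparison `P(p)(P(q)(A)) ⟶ P(p ◁ q)(A)`. -/
noncomputable def alphaInv (p q : Poly E) (A : E) :
    p.functor.obj (q.functor.obj A) ⟶ (tri p q).functor.obj A :=
  (tri p q).curry (p.functor.map (q.proj A))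
    (q.eval (p.eval (pullback.fst (p.functor.map (q.proj A)) (triMap p q))
        (pullback.snd (p.functor.map (q.proj A)) (triMap p q) ≫ triFst p q)
        (by rw [Category.assoc, triFst_map, ← pullback.condition_assoc, map_proj]))
      (pullback.snd (p.functor.map (q.proj A)) (triMap p q) ≫ triSnd p q)
      (by
        rw [← triSnd_map p q (pullback.condition) rfl
          (by rw [Category.assoc, Category.assoc, triFst_map, ← pullback.condition_assoc]),
          ← eval_map]))

@[simp]
theorem alphaInv_proj (p q : Poly E) (A : E) :
    alphaInv p q A ≫ (tri p q).proj A = p.functor.map (q.proj A) := by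
  simp [alphaInv]

@[simp]
theorem alphaInv_proj_assoc (p q : Poly E) (A : E) {Z : E} (k : p.functor.obj q.pos ⟶ Z) :
    alphaInv p q A ≫ (tri p q).proj A ≫ k = p.functor.map (q.proj A) ≫ k := by
  rw [← Category.assoc, alphaInv_proj]

theorem eval_alphaInv_cond (p q : Poly E) {A T : E} (w : T ⟶ p.functor.obj (q.functor.obj A))
    (d : T ⟶ triDir p q) (h : (w ≫ alphaInv p q A) ≫ (tri p q).proj A = d ≫ triMap p q) :
    ∃ (h₁ : w ≫ p.proj _ = (d ≫ triFst p q) ≫ p.map),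
      p.eval w (d ≫ triFst p q) h₁ ≫ q.proj A = (d ≫ triSnd p q) ≫ q.map := by
  rw [Category.assoc, alphaInv_proj] at h
  have h₁ : w ≫ p.proj _ = (d ≫ triFst p q) ≫ p.map := by
    rw [Category.assoc, triFst_map, ← reassoc_of% h, map_proj]
  refine ⟨h₁, ?_⟩
  rw [← eval_map _ _ _ _ (by rw [Category.assoc, map_proj, h₁])]
  exact triSnd_map p q h rfl _

theorem eval_alphaInv (p q : Poly E) {A T : E} (w : T ⟶ p.functor.obj (q.functor.obj A))
    (d : T ⟶ triDir p q) (h : (w ≫ alphaInv p q A) ≫ (tri p q).proj A = d ≫ triMap p q) :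
    (tri p q).eval (w ≫ alphaInv p q A) d h =
      q.eval (p.eval w (d ≫ triFst p q) (eval_alphaInv_cond p q w d h).fst) (d ≫ triSnd p q)
        (eval_alphaInv_cond p q w d h).snd := by
  refine ((tri p q).eval_comp_curry _ _ _ _ _).trans ?_
  rw [comp_eval]
  refine q.eval_congr ?_ (by simp) _ _
  rw [comp_eval]
  exact p.eval_congr (by simp) (by simp) _ _

theorem alpha_alphaInv (p q : Poly E) (A : E) : alpha p q A ≫ alphaInv p q A = 𝟙 _ := by
  refine (tri p q).hom_ext ?_ fun s d hu hv => ?_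
  · rw [Category.assoc, alphaInv_proj, Category.id_comp]
    refine p.hom_ext (by simp) fun s e hu hv => ?_
    have hu' := hu
    rw [← Category.assoc s] at hu'
    refine (p.eval_congr (Category.assoc _ _ _).symm rfl _ hu').trans ?_
    rw [eval_map, eval_alpha_proj]
  · have hu' := hu
    rw [← Category.assoc s] at hu'
    refine ((tri p q).eval_congr (Category.assoc _ _ _).symm rfl _ hu').trans ?_
    obtain ⟨h₁, h₂⟩ := eval_alphaInv_cond p q _ _ hu'
    rw [eval_alphaInv p q _ _ _]
    have h₂' := h₂
    rw [← Category.id_comp (p.eval _ _ _)] at h₂'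
    refine (q.eval_congr (Category.id_comp _).symm rfl _ h₂').trans ?_
    rw [eval_eval_alpha]
    refine (tri p q).eval_congr (by simp) ?_ _ _
    apply tri_hom_ext
    · rw [triMk_map, ← hv]; simp
    · simp
    · simp

theorem alphaInv_alpha (p q : Poly E) (A : E) : alphaInv p q A ≫ alpha p q A = 𝟙 _ := by
  refine p.hom_ext (by simp) fun s a hu hv => ?_
  have hu' := hu
  rw [← Category.assoc s] at hu'
  refine (p.eval_congr (Category.assoc _ _ _).symm rfl _ hu').trans ?_
  have hs : s ≫ p.proj _ = a ≫ p.map := by rw [← hv, Category.comp_id]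
  refine q.hom_ext ?_ fun t b hu₁ hv₁ => ?_
  · rw [eval_alpha_proj]
    refine (p.eval_congr (by simp) rfl _ (by simpa using hs)).trans
      ((eval_map p (q.proj A) s a (by simpa using hs)).trans ?_)
    congr 1
    exact p.eval_congr (by simp) rfl _ _
  · rw [eval_eval_alpha]
    refine ((tri p q).eval_congr (Category.assoc t s _).symm rfl _
      (by rw [triMk_map]; simp)).trans ?_
    refine (eval_alphaInv p q (t ≫ s) _ _).trans ?_
    · refine q.eval_congr ?_ (by simp) _ _
      refine Eq.trans ?_ (p.comp_eval _ _ _ _).symm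
      exact p.eval_congr (by simp) (by simp) _ _


/-- The comparison `P(p ◁ q) ≅ P(p) ∘ P(q)`. -/
@[simps!]
noncomputable def alphaIso (p q : Poly E) : q.functor ⋙ p.functor ≅ (tri p q).functor :=
  NatIso.ofComponents (fun A => ⟨alphaInv p q A, alpha p q A, alphaInv_alpha p q A,
    alpha_alphaInv p q A⟩) fun {A A'} f => by
      refine (tri p q).hom_ext (by simp [← Functor.map_comp]) fun s d hu hv => ?_
      have hu' := hu
      have hv' := hv
      rw [← Category.assoc s] at hu' hv'
      refine ((tri p q).eval_congr (Category.assoc _ _ _).symm rfl _ hu').trans ?_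
      refine Eq.trans ?_ ((tri p q).eval_congr (Category.assoc _ _ _).symm rfl _ hv').symm
      dsimp only
      rw [eval_map, eval_alphaInv, eval_alphaInv]
      have := p.eval_map (q.functor.map f) s (d ≫ triFst p q) (eval_alphaInv_cond p q _ d hu').fst
      have h2 := (eval_alphaInv_cond p q _ d hu').snd
      refine (q.eval_congr this rfl _ (this ▸ h2)).trans ?_
      rw [eval_map]

/-- The comparison `P(y)(A) ⟶ A`, evaluation at the only direction. -/
noncomputable def beta (A : E) : (y E).functor.obj A ⟶ A :=
  (y E).eval (𝟙 _) (terminal.from _) (Subsingleton.elim _ _)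

/-- The inverse comparison `A ⟶ P(y)(A)`. -/
noncomputable def betaInv (A : E) : A ⟶ (y E).functor.obj A :=
  (y E).curry (terminal.from A) (pullback.fst _ _)

theorem comp_beta {A T : E} (u : T ⟶ (y E).functor.obj A) (e : T ⟶ ⊤_ E)
    (h : u ≫ (y E).proj A = e ≫ (y E).map) : u ≫ beta A = (y E).eval u e h :=
  ((y E).comp_eval _ _ _ _).trans ((y E).eval_congr (Category.comp_id _)
    (Subsingleton.elim _ _) _ _)

theorem eval_betaInv {A T : E} (u : T ⟶ A) (e : T ⟶ ⊤_ E)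
    (h : (u ≫ betaInv A) ≫ (y E).proj A = e ≫ (y E).map) :
    (y E).eval (u ≫ betaInv A) e h = u :=
  ((y E).eval_comp_curry _ _ _ _ _).trans (pullback.lift_fst _ _ _)

theorem betaInv_beta (A : E) : betaInv A ≫ beta A = 𝟙 A := by
  rw [comp_beta _ (terminal.from A) (Subsingleton.elim _ _)]
  refine ((y E).eval_congr (Category.id_comp _).symm rfl _ (Subsingleton.elim _ _)).trans ?_
  exact eval_betaInv (𝟙 A) _ _

theorem beta_betaInv (A : E) : beta A ≫ betaInv A = 𝟙 ((y E).functor.obj A) := by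
  refine (y E).hom_ext (Subsingleton.elim _ _) fun s e hu hv => ?_
  refine ((y E).eval_congr (Category.assoc _ _ _).symm rfl _ (Subsingleton.elim _ _)).trans ?_
  rw [eval_betaInv, comp_beta s e (Subsingleton.elim _ _)]
  exact (y E).eval_congr (Category.comp_id _).symm rfl _ _

/-- The comparison `P(y) ≅ id`. -/
@[simps!]
noncomputable def betaIso : 𝟭 E ≅ (y E).functor :=
  NatIso.ofComponents (fun A => ⟨betaInv A, beta A, betaInv_beta A, beta_betaInv A⟩)
    fun {A A'} f => by
      refine (y E).hom_ext (Subsingleton.elim _ _) fun s e hu hv => ?_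
      refine ((y E).eval_congr (Category.assoc _ _ _).symm rfl _ (Subsingleton.elim _ _)).trans ?_
      refine Eq.trans ?_ ((y E).eval_congr (Category.assoc _ _ _).symm rfl _
        (Subsingleton.elim _ _)).symm
      dsimp only
      rw [eval_map, eval_betaInv, eval_betaInv]
      rfl

section Monoidal

variable {p p' q q' r : Poly E}

theorem eval_of_eq (p q : Poly E) {T : E} {v : T ⟶ (tri p q).pos} {d : T ⟶ (tri p q).dir}
    (h : v = d ≫ (tri p q).map) :
    ∃ h' : v ≫ p.proj q.pos = (d ≫ triFst p q) ≫ p.map,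
      p.eval v (d ≫ triFst p q) h' = (d ≫ triSnd p q) ≫ q.map :=
  ⟨by subst h; rw [Category.assoc, Category.assoc, triFst_map], triSnd_map p q h rfl _⟩

/-- Composition of a morphism `f` of polynomials with `q` on the right, given on directions by
`(v, (a, b)) ↦ (f♯ (v, a), b)`. -/
noncomputable def tensorRight (f : p ⟶ p') (q : Poly E) : tri p q ⟶ tri p' q :=
  have cond : ∀ {T : E} (v : T ⟶ (tri p q).pos) (d : T ⟶ (tri p' q).dir)
      (h : v ≫ natApp f q.pos = d ≫ (tri p' q).map),
      (v ≫ p.proj q.pos) ≫ ArrowLens.onPos f = (d ≫ triFst p' q) ≫ p'.map := fun v d h => by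
    rw [← (eval_of_eq p' q h).fst, Category.assoc, Category.assoc, natApp_proj]
  ArrowLens.ofElements (natApp f q.pos)
    (fun v d h => triMk p q v (onDirApp f (v ≫ p.proj q.pos) (d ≫ triFst p' q) (cond v d h))
      (d ≫ triSnd p' q) (by rw [ArrowLens.app_comp]) (by
        rw [← (eval_of_eq p' q h).snd, eval_natApp]))
    (fun _ _ _ => triMk_map p q _ _ _ _ _)

theorem tensorRight_app (f : p ⟶ p') (q : Poly E) {T : E} (v : T ⟶ (tri p q).pos)
    (d : T ⟶ (tri p' q).dir) (h : v ≫ ArrowLens.onPos (tensorRight f q) = d ≫ (tri p' q).map)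
    (h₁ : (v ≫ p.proj q.pos) ≫ ArrowLens.onPos f = (d ≫ triFst p' q) ≫ p'.map)
    (h₂ : p.eval v (onDirApp f (v ≫ p.proj q.pos) (d ≫ triFst p' q) h₁)
      (by rw [ArrowLens.app_comp]) = (d ≫ triSnd p' q) ≫ q.map) :
    ArrowLens.app (tensorRight f q) v d h =
      triMk p q v (onDirApp f (v ≫ p.proj q.pos) (d ≫ triFst p' q) h₁) (d ≫ triSnd p' q)
        (by rw [ArrowLens.app_comp]) h₂ := by
  refine ArrowLens.ofElements_app _ _ (by intros; exact triMk_map p q _ _ _ _ _)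
    (fun s v d h => ?_)
    v d h
  rw [comp_triMk p q]
  refine triMk_congr (p := p) (q := q) _ _ rfl ?_ (Category.assoc _ _ _).symm _ _
  rw [ArrowLens.comp_app]
  exact ArrowLens.app_congr rfl (Category.assoc _ _ _).symm (Category.assoc _ _ _).symm _ _

/-- Composition of a morphism `g` of polynomials with `p` on the left, given on directions by
`(v, (a, b)) ↦ (a, g♯ (v a, b))`. -/
noncomputable def tensorLeft (p : Poly E) (g : q ⟶ q') : tri p q ⟶ tri p q' :=
  have cond₁ : ∀ {T : E} (v : T ⟶ (tri p q).pos) (d : T ⟶ (tri p q').dir)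
      (h : v ≫ p.functor.map (ArrowLens.onPos g) = d ≫ (tri p q').map),
      v ≫ p.proj q.pos = (d ≫ triFst p q') ≫ p.map := fun v d h => by
    rw [← (eval_of_eq p q' h).fst, Category.assoc, map_proj]
  have cond₂ : ∀ {T : E} (v : T ⟶ (tri p q).pos) (d : T ⟶ (tri p q').dir)
      (h : v ≫ p.functor.map (ArrowLens.onPos g) = d ≫ (tri p q').map),
      p.eval v (d ≫ triFst p q') (cond₁ v d h) ≫ ArrowLens.onPos g =
        (d ≫ triSnd p q') ≫ q'.map := fun v d h => by
    rw [← (eval_of_eq p q' h).snd, eval_map]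
  ArrowLens.ofElements (p.functor.map (ArrowLens.onPos g))
    (fun v d h => triMk p q v (d ≫ triFst p q')
      (onDirApp g (p.eval v (d ≫ triFst p q') (cond₁ v d h)) (d ≫ triSnd p q') (cond₂ v d h))
      (cond₁ v d h) (by rw [ArrowLens.app_comp]))
    (fun _ _ _ => triMk_map p q _ _ _ _ _)

theorem tensorLeft_app (p : Poly E) (g : q ⟶ q') {T : E} (v : T ⟶ (tri p q).pos)
    (d : T ⟶ (tri p q').dir) (h : v ≫ ArrowLens.onPos (tensorLeft p g) = d ≫ (tri p q').map)
    (h₁ : v ≫ p.proj q.pos = (d ≫ triFst p q') ≫ p.map)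
    (h₂ : p.eval v (d ≫ triFst p q') h₁ ≫ ArrowLens.onPos g = (d ≫ triSnd p q') ≫ q'.map) :
    ArrowLens.app (tensorLeft p g) v d h =
      triMk p q v (d ≫ triFst p q')
        (onDirApp g (p.eval v (d ≫ triFst p q') h₁) (d ≫ triSnd p q') h₂)
        h₁ (by rw [ArrowLens.app_comp]) := by
  refine ArrowLens.ofElements_app _ _ (by intros; exact triMk_map p q _ _ _ _ _)
    (fun s v d h => ?_)
    v d h
  rw [comp_triMk p q]
  refine triMk_congr (p := p) (q := q) _ _ rfl (Category.assoc _ _ _).symm ?_ _ _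
  rw [ArrowLens.comp_app]
  refine ArrowLens.app_congr rfl ?_ (Category.assoc _ _ _).symm _ _
  rw [comp_eval]
  exact p.eval_congr rfl (Category.assoc _ _ _).symm _ _

variable (p q r)

variable {p q r} in
theorem assocHom_cond {T : E} {u : T ⟶ (tri (tri p q) r).pos} {d : T ⟶ (tri p (tri q r)).dir}
    (h : u ≫ alpha p q r.pos = d ≫ (tri p (tri q r)).map) :
    ∃ (h₁ : (u ≫ (tri p q).proj r.pos) ≫ p.proj q.pos = (d ≫ triFst p (tri q r)) ≫ p.map)
      (h₂ : p.eval (u ≫ (tri p q).proj r.pos) (d ≫ triFst p (tri q r)) h₁ =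
        (d ≫ triSnd p (tri q r) ≫ triFst q r) ≫ q.map),
      (tri p q).eval u (triMk p q (u ≫ (tri p q).proj r.pos) (d ≫ triFst p (tri q r))
        (d ≫ triSnd p (tri q r) ≫ triFst q r) h₁ h₂) (triMk_map _ _ _ _ _ _ _).symm =
        (d ≫ triSnd p (tri q r) ≫ triSnd q r) ≫ r.map := by
  obtain ⟨h₁, h₂⟩ := eval_of_eq p (tri q r) h
  obtain ⟨h₃, h₄⟩ := eval_of_eq q r h₂
  have e₁ : (d ≫ triSnd p (tri q r)) ≫ triFst q r = d ≫ triSnd p (tri q r) ≫ triFst q r :=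
    Category.assoc _ _ _
  have e₂ : (d ≫ triSnd p (tri q r)) ≫ triSnd q r = d ≫ triSnd p (tri q r) ≫ triSnd q r :=
    Category.assoc _ _ _
  have c₁ : (u ≫ (tri p q).proj r.pos) ≫ p.proj q.pos = (d ≫ triFst p (tri q r)) ≫ p.map :=
    Eq.trans (by simp) h₁
  have c₂ : p.eval (u ≫ (tri p q).proj r.pos) (d ≫ triFst p (tri q r)) c₁ =
      (d ≫ triSnd p (tri q r) ≫ triFst q r) ≫ q.map :=
    (eval_alpha_proj p q u _ h₁).symm.trans (h₃.trans (congrArg (· ≫ q.map) e₁))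
  refine ⟨c₁, c₂, ?_⟩
  have h₅ : (𝟙 _ ≫ p.eval (u ≫ alpha p q r.pos) (d ≫ triFst p (tri q r)) h₁) ≫ q.proj r.pos =
      (d ≫ triSnd p (tri q r) ≫ triFst q r) ≫ q.map := by
    rw [Category.id_comp]; exact h₃.trans (congrArg (· ≫ q.map) e₁)
  refine Eq.trans ?_ ((eval_eval_alpha p q (𝟙 _) u _ _ h₁ h₅).symm.trans
    ((q.eval_congr (Category.id_comp _) e₁.symm _ h₃).trans (h₄.trans (congrArg (· ≫ r.map) e₂))))
  refine (tri p q).eval_congr (Category.id_comp _).symm ?_ _ _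
  exact triMk_congr (p := p) (q := q) _ _ (Category.id_comp _).symm (Category.id_comp _).symm
    rfl _ _

/-- The associator, given on directions by `(u, (a, (b, e))) ↦ ((a, b), e)`. -/
noncomputable def assocHom : tri (tri p q) r ⟶ tri p (tri q r) :=
  ArrowLens.ofElements (alpha p q r.pos)
    (fun u d h => triMk (tri p q) r u
      (triMk p q (u ≫ (tri p q).proj r.pos) (d ≫ triFst p (tri q r))
        (d ≫ triSnd p (tri q r) ≫ triFst q r) (assocHom_cond h).fst (assocHom_cond h).snd.fst)
      (d ≫ triSnd p (tri q r) ≫ triSnd q r)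
      (triMk_map p q _ _ _ _ _).symm
      (assocHom_cond h).snd.snd)
    (fun _ _ _ => triMk_map (tri p q) r _ _ _ _ _)

theorem assocHom_app {T : E} (u : T ⟶ (tri (tri p q) r).pos) (d : T ⟶ (tri p (tri q r)).dir)
    (h : u ≫ ArrowLens.onPos (assocHom p q r) = d ≫ (tri p (tri q r)).map) :
    ∃ h₁ h₂ h₃ h₄, ArrowLens.app (assocHom p q r) u d h = triMk (tri p q) r u
      (triMk p q (u ≫ (tri p q).proj r.pos) (d ≫ triFst p (tri q r))
        (d ≫ triSnd p (tri q r) ≫ triFst q r) h₁ h₂)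
      (d ≫ triSnd p (tri q r) ≫ triSnd q r) h₃ h₄ := by
  refine ⟨_, _, _, _, ArrowLens.ofElements_app _ _ (by intros; exact triMk_map (tri p q) r _ _ _ _ _)
    (fun s v d h => ?_)
    u d h⟩
  rw [comp_triMk (tri p q) r]
  refine triMk_congr (p := (tri p q)) (q := r) _ _ rfl ?_ (Category.assoc _ _ _).symm _ _
  rw [comp_triMk]
  exact triMk_congr _ _ (Category.assoc _ _ _).symm (Category.assoc _ _ _).symm
    (Category.assoc _ _ _).symm _ _

/-- The inverse of the associator, given on directions by `(w, ((a, b), e)) ↦ (a, (b, e))`. -/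
noncomputable def assocInv : tri p (tri q r) ⟶ tri (tri p q) r :=
  have c₀ : ∀ {T : E} (w : T ⟶ (tri p (tri q r)).pos) (d : T ⟶ (tri (tri p q) r).dir)
      (h : w ≫ alphaInv p q r.pos = d ≫ (tri (tri p q) r).map),
      ∃ (h₁ : w ≫ p.proj _ = (d ≫ triFst (tri p q) r ≫ triFst p q) ≫ p.map)
        (h₂ : p.eval w (d ≫ triFst (tri p q) r ≫ triFst p q) h₁ ≫ q.proj r.pos =
          (d ≫ triFst (tri p q) r ≫ triSnd p q) ≫ q.map),
        q.eval (p.eval w (d ≫ triFst (tri p q) r ≫ triFst p q) h₁)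
          (d ≫ triFst (tri p q) r ≫ triSnd p q) h₂ =
          (d ≫ triSnd (tri p q) r) ≫ r.map := fun w d h => by
    have h₁ := (eval_of_eq (tri p q) r h).fst
    have h₂ := (eval_of_eq (tri p q) r h).snd
    obtain ⟨h₃, h₄⟩ := eval_alphaInv_cond p q w _ h₁
    rw [eval_alphaInv] at h₂
    simp only [Category.assoc] at h₂ h₃ h₄ ⊢
    exact ⟨h₃, h₄, h₂⟩
  ArrowLens.ofElements (alphaInv p q r.pos)
    (fun w d h => triMk p (tri q r) w (d ≫ triFst (tri p q) r ≫ triFst p q)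
      (triMk q r (p.eval w (d ≫ triFst (tri p q) r ≫ triFst p q) (c₀ w d h).fst)
        (d ≫ triFst (tri p q) r ≫ triSnd p q) (d ≫ triSnd (tri p q) r) (c₀ w d h).snd.fst
        (c₀ w d h).snd.snd)
      (c₀ w d h).fst
      (triMk_map q r _ _ _ _ _).symm)
    (fun _ _ _ => triMk_map p (tri q r) _ _ _ _ _)

theorem assocInv_app {T : E} (w : T ⟶ (tri p (tri q r)).pos) (d : T ⟶ (tri (tri p q) r).dir)
    (h : w ≫ ArrowLens.onPos (assocInv p q r) = d ≫ (tri (tri p q) r).map) :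
    ∃ h₁ h₂ h₃ h₄, ArrowLens.app (assocInv p q r) w d h =
      triMk p (tri q r) w (d ≫ triFst (tri p q) r ≫ triFst p q)
      (triMk q r (p.eval w (d ≫ triFst (tri p q) r ≫ triFst p q) h₁)
        (d ≫ triFst (tri p q) r ≫ triSnd p q) (d ≫ triSnd (tri p q) r) h₂ h₃)
      h₁ h₄ := by
  refine ⟨_, _, _, _, ArrowLens.ofElements_app _ _ (by intros; exact triMk_map p (tri q r) _ _ _ _ _)
    (fun s v d h => ?_)
    w d h⟩
  rw [comp_triMk p (tri q r)]
  refine triMk_congr (p := p) (q := (tri q r)) _ _ rfl (Category.assoc _ _ _).symm ?_ _ _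
  rw [comp_triMk]
  refine triMk_congr _ _ ?_ (Category.assoc _ _ _).symm (Category.assoc _ _ _).symm _ _
  rw [comp_eval]
  exact p.eval_congr rfl (Category.assoc _ _ _).symm _ _

/-- The left unitor, given on directions by `(u, a) ↦ (*, a)`. -/
noncomputable def leftHom : tri (y E) p ⟶ p :=
  ArrowLens.ofElements (beta p.pos)
    (fun u a h => triMk (y E) p u (terminal.from _) a (Subsingleton.elim _ _)
      (by rw [← h, comp_beta]))
    (fun _ _ _ => triMk_map (y E) p _ _ _ _ _)

theorem leftHom_app {T : E} (u : T ⟶ (tri (y E) p).pos) (a : T ⟶ p.dir)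
    (h : u ≫ ArrowLens.onPos (leftHom p) = a ≫ p.map) :
    ∃ h₁, ArrowLens.app (leftHom p) u a h =
      triMk (y E) p u (terminal.from _) a (Subsingleton.elim _ _) h₁ := by
  refine ⟨_, ArrowLens.ofElements_app _ _ (by intros; exact triMk_map (y E) p _ _ _ _ _)
    (fun s v d h => ?_)
    u a h⟩
  rw [comp_triMk (y E) p]
  exact triMk_congr (p := (y E)) (q := p) _ _ rfl (Subsingleton.elim _ _) rfl _ _

/-- The inverse of the left unitor, given on directions by `(x, (*, a)) ↦ a`. -/
noncomputable def leftInv : p ⟶ tri (y E) p :=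
  ArrowLens.ofElements (betaInv p.pos) (fun _ d _ => d ≫ triSnd (y E) p)
    (fun x d h => by rw [← (eval_of_eq (y E) p h).snd, eval_betaInv])

theorem leftInv_app {T : E} (x : T ⟶ p.pos) (d : T ⟶ (tri (y E) p).dir)
    (h : x ≫ ArrowLens.onPos (leftInv p) = d ≫ (tri (y E) p).map) :
    ArrowLens.app (leftInv p) x d h = d ≫ triSnd (y E) p :=
  ArrowLens.ofElements_app _ _
    (fun x d h => by rw [← (eval_of_eq (y E) p h).snd, eval_betaInv])
    (fun s v d h => (Category.assoc _ _ _).symm) _ _ _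

/-- The right unitor, given on directions by `(u, a) ↦ (a, *)`. -/
noncomputable def rightHom : tri p (y E) ⟶ p :=
  ArrowLens.ofElements (p.proj (⊤_ E))
    (fun u a h => triMk p (y E) u a (terminal.from _) h (Subsingleton.elim _ _))
    (fun _ _ _ => triMk_map p (y E) _ _ _ _ _)

theorem rightHom_app {T : E} (u : T ⟶ (tri p (y E)).pos) (a : T ⟶ p.dir)
    (h : u ≫ ArrowLens.onPos (rightHom p) = a ≫ p.map) :
    ArrowLens.app (rightHom p) u a h =
      triMk p (y E) u a (terminal.from _) h (Subsingleton.elim _ _) := by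
  refine ArrowLens.ofElements_app _ _ (by intros; exact triMk_map p (y E) _ _ _ _ _)
    (fun s v d h => ?_)
    u a h
  refine (comp_triMk p (y E) _ _ _ _ _ _).trans ?_
  exact triMk_congr (p := p) (q := (y E)) _ _ rfl rfl (Subsingleton.elim _ _) _ _

/-- The inverse of the right unitor, given on directions by `(x, (a, *)) ↦ a`. -/
noncomputable def rightInv : p ⟶ tri p (y E) :=
  ArrowLens.ofElements (p.curry (𝟙 _) (terminal.from _)) (fun _ d _ => d ≫ triFst p (y E))
    (fun x d h => by
      rw [← (eval_of_eq p (y E) h).fst, Category.assoc, curry_proj, Category.comp_id])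

theorem rightInv_app {T : E} (x : T ⟶ p.pos) (d : T ⟶ (tri p (y E)).dir)
    (h : x ≫ ArrowLens.onPos (rightInv p) = d ≫ (tri p (y E)).map) :
    ArrowLens.app (rightInv p) x d h = d ≫ triFst p (y E) :=
  ArrowLens.ofElements_app _ _
    (fun x d h => by
      rw [← (eval_of_eq p (y E) h).fst, Category.assoc, curry_proj, Category.comp_id])
    (fun s v d h => (Category.assoc _ _ _).symm) _ _ _

variable {p q} in
theorem eval_alphaInv_triMk {A T : E} (w : T ⟶ p.functor.obj (q.functor.obj A))
    {v : T ⟶ p.functor.obj q.pos} {a : T ⟶ p.dir} {b : T ⟶ q.dir}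
    (h : v ≫ p.proj q.pos = a ≫ p.map) (h' : p.eval v a h = b ≫ q.map)
    (h'' : (w ≫ alphaInv p q A) ≫ (tri p q).proj A = triMk p q v a b h h' ≫ triMap p q)
    {u : T ⟶ q.functor.obj A}
    (k : w ≫ p.proj _ = a ≫ p.map) (hu : p.eval w a k = u) (k' : u ≫ q.proj A = b ≫ q.map) :
    (tri p q).eval (w ≫ alphaInv p q A) (triMk p q v a b h h') h'' = q.eval u b k' := by
  rw [eval_alphaInv]
  refine q.eval_congr (Eq.trans ?_ hu) (triMk_snd p q _ _ _ _ _) _ _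
  exact p.eval_congr rfl (triMk_fst p q _ _ _ _ _) _ _

variable {p q} in
theorem eval_alphaInv_proj {A T : E} (w : T ⟶ p.functor.obj (q.functor.obj A)) (a : T ⟶ p.dir)
    (h : w ≫ p.proj _ = a ≫ p.map)
    (h' : ((w ≫ alphaInv p q A) ≫ (tri p q).proj A) ≫ p.proj q.pos = a ≫ p.map) :
    p.eval ((w ≫ alphaInv p q A) ≫ (tri p q).proj A) a h' = p.eval w a h ≫ q.proj A := by
  rw [← p.eval_map (q.proj A) w _ (by simpa using h)]
  exact p.eval_congr (by simp) rfl _ _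

theorem natApp_tensorLeft {q q' : Poly E} (g : q ⟶ q') (A : E) :
    alphaInv p q A ≫ natApp (tensorLeft p g) A =
      p.functor.map (natApp g A) ≫ alphaInv p q' A := by
  refine (tri p q').hom_ext ?_ fun s d hu hv => ?_
  · rw [Category.assoc, Category.assoc, natApp_proj, alphaInv_proj, alphaInv_proj_assoc]
    exact ((p.functor.map_comp _ _).symm.trans
      (congrArg p.functor.map (natApp_proj g A).symm)).trans (p.functor.map_comp _ _)
  have hu' := hu
  have hv' := hv
  rw [← Category.assoc s] at hu' hv'
  refine ((tri p q').eval_congr (Category.assoc _ _ _).symm rfl _ hu').trans ?_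
  refine Eq.trans ?_ ((tri p q').eval_congr (Category.assoc _ _ _).symm rfl _ hv').symm
  obtain ⟨h₁, h₂⟩ := eval_alphaInv_cond p q' _ d hv'
  have h₁' : s ≫ p.proj _ = (d ≫ triFst p q') ≫ p.map := by rw [← h₁]; simp
  have e := p.eval_map (natApp g A) s (d ≫ triFst p q') h₁
  have h₂' := h₂
  rw [e] at h₂'
  rw [eval_alphaInv]
  refine Eq.trans ?_ (q'.eval_congr e rfl _ h₂').symm
  rw [eval_natApp, eval_natApp]
  have h₃ : ((s ≫ alphaInv p q A) ≫ (tri p q).proj A) ≫ p.proj q.pos =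
      (d ≫ triFst p q') ≫ p.map := by
    rw [← h₁', Category.assoc, Category.assoc, alphaInv_proj_assoc, map_proj]
  have e' := eval_alphaInv_proj s _ h₁' h₃
  have h₄ : p.eval ((s ≫ alphaInv p q A) ≫ (tri p q).proj A) (d ≫ triFst p q') h₃ ≫
      ArrowLens.onPos g = (d ≫ triSnd p q') ≫ q'.map := by
    rw [e', ← h₂', Category.assoc, Category.assoc, natApp_proj]
  refine ((tri p q).eval_congr rfl (tensorLeft_app p g _ d _ h₃ h₄) _
    (triMk_map p q _ _ _ _ _).symm).trans ?_
  rw [eval_alphaInv_triMk s _ _ _ h₁' rfl]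
  · exact q.eval_congr rfl (ArrowLens.app_congr rfl e' rfl _ _) _ _
  · rw [ArrowLens.app_comp, e']

theorem natApp_tensorRight {p p' : Poly E} (f : p ⟶ p') (q : Poly E) (A : E) :
    alphaInv p q A ≫ natApp (tensorRight f q) A =
      natApp f (q.functor.obj A) ≫ alphaInv p' q A := by
  refine (tri p' q).hom_ext ?_ fun s d hu hv => ?_
  · rw [Category.assoc, Category.assoc, natApp_proj, alphaInv_proj, alphaInv_proj_assoc]
    exact (natTrans f).naturality (q.proj A)
  have hu' := hu
  have hv' := hv
  rw [← Category.assoc s] at hu' hv'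
  refine ((tri p' q).eval_congr (Category.assoc _ _ _).symm rfl _ hu').trans ?_
  refine Eq.trans ?_ ((tri p' q).eval_congr (Category.assoc _ _ _).symm rfl _ hv').symm
  obtain ⟨h₁, h₂⟩ := eval_alphaInv_cond p' q _ d hv'
  have h₁' : (s ≫ p.proj _) ≫ ArrowLens.onPos f = (d ≫ triFst p' q) ≫ p'.map := by
    rw [← h₁]; simp
  have e := eval_natApp f s (d ≫ triFst p' q) h₁
  have h₂' := h₂
  rw [e] at h₂'
  rw [eval_alphaInv]
  refine Eq.trans ?_ (q.eval_congr e rfl _ h₂').symm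
  rw [eval_natApp]
  have h₃ : (((s ≫ alphaInv p q A) ≫ (tri p q).proj A) ≫ p.proj q.pos) ≫ ArrowLens.onPos f =
      (d ≫ triFst p' q) ≫ p'.map := by
    rw [← h₁']; simp
  have ea : ArrowLens.app f (((s ≫ alphaInv p q A) ≫ (tri p q).proj A) ≫ p.proj q.pos)
      (d ≫ triFst p' q) h₃ = ArrowLens.app f (s ≫ p.proj _) (d ≫ triFst p' q) h₁' :=
    ArrowLens.app_congr rfl (by simp) rfl _ _
  have k : s ≫ p.proj _ = ArrowLens.app f (((s ≫ alphaInv p q A) ≫ (tri p q).proj A) ≫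
      p.proj q.pos) (d ≫ triFst p' q) h₃ ≫ p.map := by rw [ea, ArrowLens.app_comp]
  have e' := eval_alphaInv_proj s _ k (by rw [ArrowLens.app_comp])
  have e'' : p.eval s _ k =
      p.eval s (onDirApp f (s ≫ p.proj _) (d ≫ triFst p' q) h₁') (by rw [ArrowLens.app_comp]) := p.eval_congr rfl ea _ _
  refine ((tri p q).eval_congr rfl (tensorRight_app f q _ d _ h₃ ?_) _
    (triMk_map p q _ _ _ _ _).symm).trans ?_
  · rw [e', e'']; exact h₂'
  exact eval_alphaInv_triMk s _ _ _ k e'' _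

theorem natApp_leftHom (A : E) :
    alphaInv (y E) p A ≫ natApp (leftHom p) A = beta (p.functor.obj A) := by
  refine p.hom_ext ?_ fun s d hu hv => ?_
  · rw [Category.assoc, natApp_proj, alphaInv_proj_assoc]
    exact (betaIso (E := E)).inv.naturality (p.proj A)
  have hu' := hu
  rw [← Category.assoc s] at hu'
  refine (p.eval_congr (Category.assoc _ _ _).symm rfl _ hu').trans ?_
  rw [eval_natApp]
  obtain ⟨h₁, h₂⟩ := leftHom_app p ((s ≫ alphaInv (y E) p A) ≫ (tri (y E) p).proj A) d
    (by rw [← hu']; simp)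
  refine ((tri (y E) p).eval_congr rfl h₂ _ (triMk_map (y E) p _ _ _ _ _).symm).trans ?_
  exact eval_alphaInv_triMk s _ _ _ (Subsingleton.elim _ _) (comp_beta _ _ _).symm _

theorem natApp_rightHom (A : E) :
    alphaInv p (y E) A ≫ natApp (rightHom p) A = p.functor.map (beta A) := by
  refine p.hom_ext ?_ fun s d hu hv => ?_
  · rw [Category.assoc, natApp_proj, alphaInv_proj_assoc]
    exact (map_proj _ _).trans (map_proj _ _).symm
  have hu' := hu
  rw [← Category.assoc s] at hu'
  refine (p.eval_congr (Category.assoc _ _ _).symm rfl _ hu').trans ?_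
  rw [eval_natApp, eval_map]
  refine ((tri p (y E)).eval_congr rfl (rightHom_app p _ d _) _
    (triMk_map p (y E) _ _ _ _ _).symm).trans ?_
  refine (eval_alphaInv_triMk s _ _ _ (by simpa using hv) rfl (Subsingleton.elim _ _)).trans ?_
  exact (comp_beta _ _ _).symm

theorem natApp_assocHom (A : E) :
    alphaInv p q (r.functor.obj A) ≫ alphaInv (tri p q) r A ≫ natApp (assocHom p q r) A =
      p.functor.map (alphaInv q r A) ≫ alphaInv p (tri q r) A := by
  refine (tri p (tri q r)).hom_ext ?_ fun s d hu hv => ?_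
  · have nat : (tri p q).functor.map (r.proj A) ≫ alpha p q r.pos =
        alpha p q (r.functor.obj A) ≫ p.functor.map (q.functor.map (r.proj A)) :=
      (alphaIso p q).inv.naturality (r.proj A)
    have e₁ : alphaInv (tri p q) r A ≫ (tri (tri p q) r).proj A =
        (tri p q).functor.map (r.proj A) := alphaInv_proj _ _ _
    have e₂ : p.functor.map (alphaInv q r A) ≫ p.functor.map ((tri q r).proj A) =
        p.functor.map (q.functor.map (r.proj A)) :=
      (p.functor.map_comp _ _).symm.trans (congrArg p.functor.map (alphaInv_proj q r A))
    have e₃ : natApp (assocHom p q r) A ≫ (tri p (tri q r)).proj A =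
        (tri (tri p q) r).proj A ≫ alpha p q r.pos := natApp_proj _ _
    have e₄ := alphaInv_proj p (tri q r) A
    rw [Category.assoc, Category.assoc, Category.assoc, e₃, e₄, e₂, reassoc_of% e₁, nat,
      ← Category.assoc, alphaInv_alpha, Category.id_comp]
  have a₁ : s ≫ alphaInv p q (r.functor.obj A) ≫ alphaInv (tri p q) r A ≫
      natApp (assocHom p q r) A = ((s ≫ alphaInv p q (r.functor.obj A)) ≫
        alphaInv (tri p q) r A) ≫ natApp (assocHom p q r) A := by
    simp only [Category.assoc]
  have hu' := hu
  have hv' := hv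
  rw [a₁] at hu'
  rw [← Category.assoc s] at hv'
  refine ((tri p (tri q r)).eval_congr a₁ rfl _ hu').trans ?_
  refine Eq.trans ?_ ((tri p (tri q r)).eval_congr (Category.assoc _ _ _).symm rfl _ hv').symm
  have ha : (d ≫ triSnd p (tri q r)) ≫ triFst q r = d ≫ triSnd p (tri q r) ≫ triFst q r :=
    Category.assoc _ _ _
  have hb : (d ≫ triSnd p (tri q r)) ≫ triSnd q r = d ≫ triSnd p (tri q r) ≫ triSnd q r :=
    Category.assoc _ _ _
  obtain ⟨h₁, h₂⟩ := eval_alphaInv_cond p (tri q r) _ d hv'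
  have k₁ : s ≫ p.proj _ = (d ≫ triFst p (tri q r)) ≫ p.map := Eq.trans (by simp) h₁
  have e := p.eval_map (alphaInv q r A) s (d ≫ triFst p (tri q r)) h₁
  have h₂' := h₂
  rw [e] at h₂'
  obtain ⟨k₂, k₃⟩ := eval_alphaInv_cond q r _ _ h₂'
  have k₂' := k₂
  have k₃' := k₃
  simp only [ha, hb] at k₂' k₃'
  have rhs : (tri p (tri q r)).eval ((s ≫ p.functor.map (alphaInv q r A)) ≫
      alphaInv p (tri q r) A) d hv' = r.eval (q.eval (p.eval s (d ≫ triFst p (tri q r)) k₁)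
        (d ≫ triSnd p (tri q r) ≫ triFst q r) k₂')
        (d ≫ triSnd p (tri q r) ≫ triSnd q r) k₃' := by
    rw [eval_alphaInv]
    refine ((tri q r).eval_congr e rfl _ h₂').trans ?_
    rw [eval_alphaInv]
    exact r.eval_congr (q.eval_congr rfl ha _ _) hb _ _
  rw [rhs, eval_natApp]
  have h₀ : (((s ≫ alphaInv p q (r.functor.obj A)) ≫ alphaInv (tri p q) r A) ≫
      (tri (tri p q) r).proj A) ≫ ArrowLens.onPos (assocHom p q r) =
        d ≫ (tri p (tri q r)).map := by
    rw [← hu', Category.assoc _ (natApp _ _), natApp_proj, Category.assoc]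
  obtain ⟨l₁, l₂, l₃, l₄, hl⟩ := assocHom_app p q r _ d h₀
  refine ((tri (tri p q) r).eval_congr rfl hl _ (triMk_map (tri p q) r _ _ _ _ _).symm).trans ?_
  have m : (s ≫ alphaInv p q (r.functor.obj A)) ≫ (tri p q).proj _ =
      triMk p q ((((s ≫ alphaInv p q (r.functor.obj A)) ≫ alphaInv (tri p q) r A) ≫
        (tri (tri p q) r).proj A) ≫ (tri p q).proj r.pos) (d ≫ triFst p (tri q r))
        (d ≫ triSnd p (tri q r) ≫ triFst q r) l₁ l₂ ≫ triMap p q := by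
    have e₁ : alphaInv (tri p q) r A ≫ (tri (tri p q) r).proj A =
        (tri p q).functor.map (r.proj A) := alphaInv_proj _ _ _
    rw [triMk_map, Category.assoc _ (alphaInv (tri p q) r A), e₁, Category.assoc _ _
      ((tri p q).proj r.pos), map_proj]
  exact eval_alphaInv_triMk (p := tri p q) (q := r) _ _ _ _ m
    (eval_alphaInv_triMk (p := p) (q := q) s _ _ _ k₁ rfl k₂') k₃'

/-- The associator `(p ◁ q) ◁ r ≅ p ◁ (q ◁ r)`. -/
@[simps]
noncomputable def assocIso : tri (tri p q) r ≅ tri p (tri q r) where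
  hom := assocHom p q r
  inv := assocInv p q r
  hom_inv_id := by
    refine ArrowLens.ext (alpha_alphaInv p q r.pos) fun u d h h' => ?_
    refine (ArrowLens.comp_app' (assocHom p q r) (assocInv p q r) u d h).trans ?_
    refine Eq.trans ?_ (ArrowLens.id_app _ _ _).symm
    obtain ⟨h₁, h₂, h₃, h₄, e⟩ := assocInv_app p q r (u ≫ ArrowLens.onPos (assocHom p q r)) d
      ((Category.assoc _ _ _).trans h)
    refine (ArrowLens.app_congr rfl rfl e _ (triMk_map p (tri q r) _ _ _ _ _).symm).trans ?_
    obtain ⟨k₁, k₂, k₃, k₄, e'⟩ := assocHom_app p q r u _ (triMk_map p (tri q r) _ _ _ h₁ h₄).symm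
    refine e'.trans ?_
    have hu : u = d ≫ triMap (tri p q) r := (Category.comp_id u).symm.trans h'
    refine tri_hom_ext (p := tri p q) (q := r) ?_ ?_ ?_
    · rw [triMk_map]; exact hu
    · rw [triMk_fst]
      refine tri_hom_ext (p := p) (q := q) ?_ ?_ ?_
      · rw [triMk_map, hu, Category.assoc, Category.assoc]
        exact (d ≫= triFst_map (tri p q) r).symm
      · rw [triMk_fst, triMk_fst, Category.assoc]
      · rw [triMk_snd, triMk_snd_assoc, triMk_fst, Category.assoc]
    · rw [triMk_snd, triMk_snd_assoc, triMk_snd]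
  inv_hom_id := by
    refine ArrowLens.ext (alphaInv_alpha p q r.pos) fun w d h h' => ?_
    refine (ArrowLens.comp_app' (assocInv p q r) (assocHom p q r) w d h).trans ?_
    refine Eq.trans ?_ (ArrowLens.id_app _ _ _).symm
    obtain ⟨h₁, h₂, h₃, h₄, e⟩ := assocHom_app p q r (w ≫ ArrowLens.onPos (assocInv p q r)) d
      ((Category.assoc _ _ _).trans h)
    refine (ArrowLens.app_congr rfl rfl e _ (triMk_map (tri p q) r _ _ _ _ _).symm).trans ?_
    obtain ⟨k₁, k₂, k₃, k₄, e'⟩ := assocInv_app p q r w _ (triMk_map (tri p q) r _ _ _ h₃ h₄).symm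
    refine e'.trans ?_
    have hw : w = d ≫ triMap p (tri q r) := (Category.comp_id w).symm.trans h'
    refine tri_hom_ext (p := p) (q := tri q r) ?_ ?_ ?_
    · rw [triMk_map]; exact hw
    · rw [triMk_fst, triMk_fst_assoc, triMk_fst]
    · rw [triMk_snd]
      refine tri_hom_ext (p := q) (q := r) ?_ ?_ ?_
      · rw [triMk_map, ← (eval_of_eq p (tri q r) hw).snd]
        exact p.eval_congr rfl (by rw [triMk_fst_assoc, triMk_fst]) _ _
      · rw [triMk_fst, triMk_fst_assoc, triMk_snd, Category.assoc]
      · rw [triMk_snd, triMk_snd, Category.assoc]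

/-- The left unitor `y ◁ p ≅ p`. -/
@[simps]
noncomputable def leftIso : tri (y E) p ≅ p where
  hom := leftHom p
  inv := leftInv p
  hom_inv_id := by
    refine ArrowLens.ext (beta_betaInv p.pos) fun u d h h' => ?_
    refine (ArrowLens.comp_app' (leftHom p) (leftInv p) u d h).trans ?_
    refine Eq.trans ?_ (ArrowLens.id_app _ _ _).symm
    have hu : u = d ≫ triMap (y E) p := (Category.comp_id u).symm.trans h'
    have e := leftInv_app p (u ≫ ArrowLens.onPos (leftHom p)) d ((Category.assoc _ _ _).trans h)
    refine (ArrowLens.app_congr rfl rfl e _ ?_).trans ?_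
    · rw [← (eval_of_eq (y E) p hu).snd]
      exact comp_beta _ _ _
    obtain ⟨k, e'⟩ := leftHom_app p u (d ≫ triSnd (y E) p) (by
      rw [← (eval_of_eq (y E) p hu).snd]; exact comp_beta _ _ _)
    refine e'.trans (tri_hom_ext (p := y E) (q := p) ?_ (Subsingleton.elim _ _) ?_)
    · rw [triMk_map]; exact hu
    · rw [triMk_snd]
  inv_hom_id := by
    refine ArrowLens.ext (betaInv_beta p.pos) fun x a h h' => ?_
    refine (ArrowLens.comp_app' (leftInv p) (leftHom p) x a h).trans ?_
    refine Eq.trans ?_ (ArrowLens.id_app _ _ _).symm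
    refine (leftInv_app p _ _ _).trans ?_
    obtain ⟨k, e'⟩ := leftHom_app p (x ≫ ArrowLens.onPos (leftInv p)) a
      ((Category.assoc _ _ _).trans h)
    exact (congrArg (· ≫ triSnd (y E) p) e').trans (triMk_snd (y E) p _ _ _ _ _)

/-- The right unitor `p ◁ y ≅ p`. -/
@[simps]
noncomputable def rightIso : tri p (y E) ≅ p where
  hom := rightHom p
  inv := rightInv p
  hom_inv_id := by
    refine ArrowLens.ext ?_ fun u d h h' => ?_
    · refine p.hom_ext ?_ fun _ _ _ _ => Subsingleton.elim _ _
      change (p.proj (⊤_ E) ≫ p.curry (𝟙 _) (terminal.from _)) ≫ _ = 𝟙 _ ≫ _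
      rw [Category.assoc, curry_proj, Category.comp_id, Category.id_comp]
    refine (ArrowLens.comp_app' (rightHom p) (rightInv p) u d h).trans ?_
    refine Eq.trans ?_ (ArrowLens.id_app _ _ _).symm
    have hu : u = d ≫ triMap p (y E) := (Category.comp_id u).symm.trans h'
    have e := rightInv_app p (u ≫ ArrowLens.onPos (rightHom p)) d ((Category.assoc _ _ _).trans h)
    refine (ArrowLens.app_congr rfl rfl e _ (eval_of_eq p (y E) hu).fst).trans ?_
    refine (rightHom_app p u _ _).trans
      (tri_hom_ext (p := p) (q := y E) ?_ ?_ (Subsingleton.elim _ _))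
    · rw [triMk_map]; exact hu
    · rw [triMk_fst]
  inv_hom_id := by
    refine ArrowLens.ext (curry_proj _ _ _) fun x a h h' => ?_
    refine (ArrowLens.comp_app' (rightInv p) (rightHom p) x a h).trans ?_
    refine Eq.trans ?_ (ArrowLens.id_app _ _ _).symm
    refine (rightInv_app p _ _ _).trans ?_
    exact (congrArg (· ≫ triFst p (y E)) (rightHom_app p _ _ _)).trans
      (triMk_fst p (y E) _ _ _ _ _)

/-- The composition product, as the data of a monoidal structure. -/
noncomputable instance monoidalStruct : MonoidalCategoryStruct (Poly E) where
  tensorObj p q := tri p q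
  whiskerLeft p _ _ g := tensorLeft p g
  whiskerRight f q := tensorRight f q
  tensorHom {_ p' q _} f g := tensorRight f q ≫ tensorLeft p' g
  tensorUnit := y E
  associator p q r := assocIso p q r
  leftUnitor p := leftIso p
  rightUnitor p := rightIso p

attribute [local instance] endofunctorMonoidalCategory

variable (E) in
/-- The functor to endofunctors, whose tensor product is written in the reversed order. -/
noncomputable def toEndofunctorMop : Poly E ⥤ (E ⥤ E)ᴹᵒᵖ := toEndofunctor E ⋙ mopFunctor (E ⥤ E)

instance : (toEndofunctorMop E).Faithful where
  map_injective h := (toEndofunctor E).map_injective (congrArg Quiver.Hom.unmop h)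

theorem map_tensorLeft {q q' : Poly E} (g : q ⟶ q') :
    natTrans (tensorLeft p g) =
      (alphaIso p q).inv ≫ Functor.whiskerRight (natTrans g) p.functor ≫ (alphaIso p q').hom := by
  rw [Iso.eq_inv_comp]
  ext A
  exact natApp_tensorLeft p g A

theorem map_tensorRight {p p' : Poly E} (f : p ⟶ p') (q : Poly E) :
    natTrans (tensorRight f q) =
      (alphaIso p q).inv ≫ Functor.whiskerLeft q.functor (natTrans f) ≫ (alphaIso p' q).hom := by
  rw [Iso.eq_inv_comp]
  ext A
  exact natApp_tensorRight f q A

theorem map_leftHom : natTrans (leftHom p) =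
    (alphaIso (y E) p).inv ≫ Functor.whiskerLeft p.functor (betaIso (E := E)).inv := by
  rw [Iso.eq_inv_comp]
  ext A
  exact natApp_leftHom p A

theorem map_rightHom : natTrans (rightHom p) =
    (alphaIso p (y E)).inv ≫ Functor.whiskerRight (betaIso (E := E)).inv p.functor := by
  rw [Iso.eq_inv_comp]
  ext A
  exact natApp_rightHom p A

theorem map_assocHom : natTrans (assocHom p q r) =
    (alphaIso (tri p q) r).inv ≫ Functor.whiskerLeft r.functor (alphaIso p q).inv ≫
      Functor.whiskerRight (alphaIso q r).hom p.functor ≫ (alphaIso p (tri q r)).hom := by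
  rw [Iso.eq_inv_comp]
  ext A
  change _ = alpha p q (r.functor.obj A) ≫ p.functor.map (alphaInv q r A) ≫ alphaInv p (tri q r) A
  rw [← natApp_assocHom, ← Category.assoc (alpha p q _), alpha_alphaInv, Category.id_comp]
  rfl

/-- The functor to endofunctors preserves the operations. -/
noncomputable def inducingData : Monoidal.InducingFunctorData (toEndofunctorMop E) where
  μIso p q := (alphaIso p q).mop
  εIso := (betaIso (E := E)).mop
  whiskerLeft_eq p _ _ g := Quiver.Hom.unmop_inj (map_tensorLeft p g)
  whiskerRight_eq f q := Quiver.Hom.unmop_inj (map_tensorRight f q)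
  tensorHom_eq {p p' q q'} f g := Quiver.Hom.unmop_inj (by
    refine ((toEndofunctor E).map_comp (tensorRight f q) (tensorLeft p' g)).trans ?_
    refine (congrArg₂ (· ≫ ·) (map_tensorRight f q) (map_tensorLeft p' g)).trans ?_
    ext A
    change (alpha p q A ≫ natApp f (q.functor.obj A) ≫ alphaInv p' q A) ≫ alpha p' q A ≫
      p'.functor.map (natApp g A) ≫ alphaInv p' q' A = alpha p q A ≫
        (natApp f (q.functor.obj A) ≫ p'.functor.map (natApp g A)) ≫ alphaInv p' q' A
    have := alphaInv_alpha p' q A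
    simp only [Category.assoc]
    rw [reassoc_of% this])
  associator_eq p q r := Quiver.Hom.unmop_inj (by
    refine (map_assocHom p q r).trans ?_
    ext A
    change alpha (tri p q) r A ≫ alpha p q (r.functor.obj A) ≫
      p.functor.map (alphaInv q r A) ≫ alphaInv p (tri q r) A =
      (alpha (tri p q) r A ≫ (alpha p q (r.functor.obj A) ≫
        p.functor.map (q.functor.map (𝟙 (r.functor.obj A))))) ≫ 𝟙 _ ≫
        ((𝟙 _ ≫ p.functor.map (alphaInv q r A)) ≫ alphaInv p (tri q r) A)
    simp)
  leftUnitor_eq p := Quiver.Hom.unmop_inj (by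
    refine (map_leftHom p).trans ?_
    ext A
    change alpha (y E) p A ≫ beta (p.functor.obj A) =
      (alpha (y E) p A ≫ (beta (p.functor.obj A) ≫ 𝟙 (p.functor.obj A))) ≫ 𝟙 _
    simp)
  rightUnitor_eq p := Quiver.Hom.unmop_inj (by
    refine (map_rightHom p).trans ?_
    ext A
    change alpha p (y E) A ≫ p.functor.map (beta A) =
      (alpha p (y E) A ≫ (𝟙 _ ≫ p.functor.map (beta A))) ≫ 𝟙 _
    simp)

noncomputable instance : MonoidalCategory (Poly E) :=
  Monoidal.induced (toEndofunctorMop E) inducingData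

end Monoidal

section

variable (c : Poly E) [ComonObj c]

/-- The counit, as a morphism `c ⟶ y`. -/
abbrev counit : c ⟶ y E := ComonObj.counit

/-- The comultiplication, as a morphism `c ⟶ c ◁ c`. -/
abbrev comul : c ⟶ tri c c := ComonObj.comul

theorem counit_comul : comul c ≫ tensorRight (counit c) c = leftInv c := ComonObj.counit_comul c

theorem comul_counit : comul c ≫ tensorLeft c (counit c) = rightInv c := ComonObj.comul_counit c

theorem comul_assoc : comul c ≫ tensorLeft c (comul c) =
    comul c ≫ tensorRight (comul c) c ≫ assocHom c c c := ComonObj.comul_assoc c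

theorem natApp_comp {p q r : Poly E} (φ : p ⟶ q) (ψ : q ⟶ r) (A : E) :
    natApp (φ ≫ ψ) A = natApp φ A ≫ natApp ψ A :=
  congrArg (fun f => NatTrans.app f A) ((toEndofunctor E).map_comp φ ψ)

theorem natApp_id (p : Poly E) (A : E) : natApp (𝟙 p) A = 𝟙 _ :=
  congrArg (fun f => NatTrans.app f A) ((toEndofunctor E).map_id p)

/-- The comonad on `E` induced by a comonoid in polynomials: the functor `P(c)`, with counit
`P(c) ⟶ P(y) ≅ id` and comultiplication `P(c) ⟶ P(c ◁ c) ≅ P(c) ∘ P(c)`. -/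
noncomputable def comonad : Comonad E where
  toFunctor := c.functor
  ε := natTrans (counit c) ≫ (betaIso (E := E)).inv
  δ := natTrans (comul c) ≫ (alphaIso c c).inv
  left_counit A := by
    have h : (comul c ≫ tensorRight (counit c) c) ≫ leftHom c = 𝟙 c := by
      rw [counit_comul]; exact (leftIso c).inv_hom_id
    have h' := congrArg (fun φ : c ⟶ c => natApp φ A) h
    have e₁ : natApp (tensorRight (counit c) c) A = _ :=
      congrArg (fun f => NatTrans.app f A) (map_tensorRight (counit c) c)
    have e₂ : natApp (leftHom c) A = _ := congrArg (fun f => NatTrans.app f A) (map_leftHom c)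
    change (natApp (comul c) A ≫ alpha c c A) ≫ natApp (counit c) (c.functor.obj A) ≫
      beta (c.functor.obj A) = 𝟙 _
    rw [natApp_comp, natApp_comp, natApp_id, e₁, e₂] at h'
    rw [← h']
    change _ = (natApp (comul c) A ≫ alpha c c A ≫ natApp (counit c) (c.functor.obj A) ≫
      alphaInv (y E) c A) ≫ alpha (y E) c A ≫ beta (c.functor.obj A)
    simp only [Category.assoc]
    rw [reassoc_of% alphaInv_alpha (y E) c A]
  right_counit A := by
    have h : (comul c ≫ tensorLeft c (counit c)) ≫ rightHom c = 𝟙 c := by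
      rw [comul_counit]; exact (rightIso c).inv_hom_id
    have h' := congrArg (fun φ : c ⟶ c => natApp φ A) h
    have e₁ : natApp (tensorLeft c (counit c)) A = _ :=
      congrArg (fun f => NatTrans.app f A) (map_tensorLeft c (counit c))
    have e₂ : natApp (rightHom c) A = _ := congrArg (fun f => NatTrans.app f A) (map_rightHom c)
    change (natApp (comul c) A ≫ alpha c c A) ≫ c.functor.map (natApp (counit c) A ≫ beta A) = 𝟙 _
    rw [natApp_comp, natApp_comp, natApp_id, e₁, e₂] at h'
    rw [← h', c.functor.map_comp]
    change _ = (natApp (comul c) A ≫ alpha c c A ≫ c.functor.map (natApp (counit c) A) ≫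
      alphaInv c (y E) A) ≫ alpha c (y E) A ≫ c.functor.map (beta A)
    simp only [Category.assoc]
    rw [reassoc_of% alphaInv_alpha c (y E) A]
  coassoc A := by
    have h' := congrArg (fun φ : c ⟶ tri c (tri c c) => natApp φ A) (comul_assoc c)
    have e₁ : natApp (tensorLeft c (comul c)) A = _ :=
      congrArg (fun f => NatTrans.app f A) (map_tensorLeft c (comul c))
    have e₂ : natApp (tensorRight (comul c) c) A = _ :=
      congrArg (fun f => NatTrans.app f A) (map_tensorRight (comul c) c)
    have e₃ : natApp (assocHom c c c) A = _ :=
      congrArg (fun f => NatTrans.app f A) (map_assocHom c c c)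
    rw [natApp_comp, natApp_comp, natApp_comp, e₁, e₂, e₃] at h'
    change natApp (comul c) A ≫ alpha c c A ≫ c.functor.map (natApp (comul c) A) ≫
        alphaInv c (tri c c) A =
      natApp (comul c) A ≫ (alpha c c A ≫ natApp (comul c) (c.functor.obj A) ≫
        alphaInv (tri c c) c A) ≫ alpha (tri c c) c A ≫ alpha c c (c.functor.obj A) ≫
        c.functor.map (alphaInv c c A) ≫ alphaInv c (tri c c) A at h'
    change (natApp (comul c) A ≫ alpha c c A) ≫ c.functor.map (natApp (comul c) A ≫ alpha c c A) =
      (natApp (comul c) A ≫ alpha c c A) ≫ natApp (comul c) (c.functor.obj A) ≫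
        alpha c c (c.functor.obj A)
    simp only [Category.assoc] at h'
    rw [reassoc_of% alphaInv_alpha (tri c c) c A] at h'
    have h'' := congrArg (· ≫ alpha c (tri c c) A ≫ c.functor.map (alpha c c A)) h'
    have e₄ : c.functor.map (alphaInv c c A) ≫ c.functor.map (alpha c c A) = 𝟙 _ := by
      rw [← c.functor.map_comp, alphaInv_alpha, c.functor.map_id]
    simp only [Category.assoc, reassoc_of% alphaInv_alpha c (tri c c) A, e₄, Category.comp_id]
      at h''
    simpa only [Category.assoc, c.functor.map_comp] using h''

end

end Poly

variable (E) in
/-- A category internal to `E`. Composition is written in diagrammatic order: it is defined on pairs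
`(f, g)` such that the target of `f` is the source of `g`. -/
structure InternalCategory where
  obj : E
  mor : E
  src : mor ⟶ obj
  tgt : mor ⟶ obj
  ident : obj ⟶ mor
  comp : pullback tgt src ⟶ mor
  ident_src : ident ≫ src = 𝟙 obj
  ident_tgt : ident ≫ tgt = 𝟙 obj
  comp_src : comp ≫ src = pullback.fst tgt src ≫ src
  comp_tgt : comp ≫ tgt = pullback.snd tgt src ≫ tgt
  id_comp : pullback.lift (src ≫ ident) (𝟙 mor)
    (by rw [Category.assoc, ident_tgt, Category.comp_id, Category.id_comp]) ≫ comp = 𝟙 mor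
  comp_id : pullback.lift (𝟙 mor) (tgt ≫ ident)
    (by rw [Category.assoc, ident_src, Category.comp_id, Category.id_comp]) ≫ comp = 𝟙 mor
  assoc {T : E} (f g h : T ⟶ mor) (hfg : f ≫ tgt = g ≫ src) (hgh : g ≫ tgt = h ≫ src) :
    pullback.lift (pullback.lift f g hfg ≫ comp) h
        (by rw [Category.assoc, comp_tgt, pullback.lift_snd_assoc, hgh]) ≫ comp =
      pullback.lift f (pullback.lift g h hgh ≫ comp)
        (by rw [Category.assoc, comp_src, pullback.lift_fst_assoc, hfg]) ≫ comp

namespace InternalCategory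

variable (C : InternalCategory E)

/-- Composition of generalized elements. -/
noncomputable def compElt {T : E} (f g : T ⟶ C.mor) (h : f ≫ C.tgt = g ≫ C.src) : T ⟶ C.mor :=
  pullback.lift f g h ≫ C.comp

@[simp]
theorem compElt_src {T : E} (f g : T ⟶ C.mor) (h : f ≫ C.tgt = g ≫ C.src) :
    C.compElt f g h ≫ C.src = f ≫ C.src := by
  rw [compElt, Category.assoc, C.comp_src, pullback.lift_fst_assoc]

@[simp]
theorem compElt_tgt {T : E} (f g : T ⟶ C.mor) (h : f ≫ C.tgt = g ≫ C.src) :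
    C.compElt f g h ≫ C.tgt = g ≫ C.tgt := by
  rw [compElt, Category.assoc, C.comp_tgt, pullback.lift_snd_assoc]

variable {C} in
theorem compElt_congr {T : E} {f f' g g' : T ⟶ C.mor} (hf : f = f') (hg : g = g')
    (h : f ≫ C.tgt = g ≫ C.src) (h' : f' ≫ C.tgt = g' ≫ C.src) :
    C.compElt f g h = C.compElt f' g' h' := by
  subst hf hg; rfl

end InternalCategory

/-- An internal cofunctor from `D` to `C`: it goes forwards on objects, and it sends an object `x` of
`D` and a morphism `e` of `C` out of the image of `x` to a morphism of `D` out of `x`, compatibly with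
identities, targets and composition. -/
structure Cofunctor (D C : InternalCategory E) extends ArrowLens D.src C.src where
  app_ident {T : E} (x : T ⟶ D.obj) :
    toArrowLens.app x (x ≫ toArrowLens.onPos ≫ C.ident)
      (by simp only [Category.assoc, C.ident_src, Category.comp_id]) = x ≫ D.ident
  onPos_tgt {T : E} (x : T ⟶ D.obj) (e : T ⟶ C.mor) (h : x ≫ toArrowLens.onPos = e ≫ C.src) :
    toArrowLens.app x e h ≫ D.tgt ≫ toArrowLens.onPos = e ≫ C.tgt
  app_compElt {T : E} (x : T ⟶ D.obj) (e e' : T ⟶ C.mor) (h : x ≫ toArrowLens.onPos = e ≫ C.src)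
    (h' : e ≫ C.tgt = e' ≫ C.src) :
    toArrowLens.app x (C.compElt e e' h') (by rw [C.compElt_src, h]) =
      D.compElt (toArrowLens.app x e h)
        (toArrowLens.app (toArrowLens.app x e h ≫ D.tgt) e'
          (by rw [Category.assoc, onPos_tgt x e h, h']))
        (by rw [ArrowLens.app_comp])

namespace Cofunctor

variable {B C D : InternalCategory E}

theorem ext {F G : Cofunctor D C} (h : F.toArrowLens = G.toArrowLens) : F = G := by
  obtain ⟨F, _⟩ := F
  obtain ⟨G, _⟩ := G
  obtain rfl : F = G := h
  rfl

/-- The identity cofunctor. -/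
noncomputable def id (C : InternalCategory E) : Cofunctor C C where
  toArrowLens := ArrowLens.id C.src
  app_ident x := by rw [ArrowLens.id_app, ArrowLens.id_onPos, Category.id_comp]
  onPos_tgt x e h := by rw [ArrowLens.id_app, ArrowLens.id_onPos, Category.comp_id]
  app_compElt x e e' h h' := by
    rw [ArrowLens.id_app]
    exact InternalCategory.compElt_congr (ArrowLens.id_app _ _ _).symm
      (ArrowLens.id_app _ _ _).symm _ _

/-- Composition of cofunctors. -/
noncomputable def comp (F : Cofunctor B C) (G : Cofunctor C D) : Cofunctor B D where
  toArrowLens := F.toArrowLens.comp G.toArrowLens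
  app_ident x := by
    rw [ArrowLens.comp_app', ← F.app_ident x]
    refine ArrowLens.app_congr rfl rfl ?_ _ _
    refine Eq.trans ?_ ((G.app_ident (x ≫ F.onPos)).trans (Category.assoc _ _ _))
    exact ArrowLens.app_congr rfl rfl (by simp) _ _
  onPos_tgt x e h := by
    have h₁ : (x ≫ F.onPos) ≫ G.onPos = e ≫ D.src := by rw [Category.assoc]; exact h
    have h₂ : x ≫ F.onPos = G.app (x ≫ F.onPos) e h₁ ≫ C.src := by rw [ArrowLens.app_comp]
    have e₁ := congrArg (· ≫ G.onPos) (F.onPos_tgt x _ h₂)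
    have e₂ := G.onPos_tgt _ _ h₁
    refine (congrArg (· ≫ B.tgt ≫ F.onPos ≫ G.onPos) (ArrowLens.comp_app' _ _ _ _ _)).trans ?_
    simp only [Category.assoc] at e₁ e₂ ⊢
    exact e₁.trans e₂
  app_compElt x e e' h h' := by
    have h₁ : (x ≫ F.onPos) ≫ G.onPos = e ≫ D.src := by rw [Category.assoc]; exact h
    have h₂ : x ≫ F.onPos = G.app (x ≫ F.onPos) e h₁ ≫ C.src := by rw [ArrowLens.app_comp]
    have h₃ : G.app (x ≫ F.onPos) e h₁ ≫ C.tgt =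
        G.app (G.app (x ≫ F.onPos) e h₁ ≫ C.tgt) e'
          (by rw [Category.assoc, G.onPos_tgt _ _ h₁, h']) ≫ C.src := by rw [ArrowLens.app_comp]
    rw [ArrowLens.comp_app']
    refine (ArrowLens.app_congr rfl rfl (G.app_compElt (x ≫ F.onPos) e e' h₁ h') _
      (by rw [C.compElt_src, ArrowLens.app_comp])).trans ?_
    rw [F.app_compElt x _ _ h₂ h₃]
    refine InternalCategory.compElt_congr (ArrowLens.comp_app' _ _ _ _ _).symm ?_ _ _
    rw [ArrowLens.comp_app']
    have e₁ : F.app x (G.app (x ≫ F.onPos) e h₁) h₂ ≫ B.tgt =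
      (F.toArrowLens.comp G.toArrowLens).app x e h ≫ B.tgt := by rw [ArrowLens.comp_app']
    refine ArrowLens.app_congr rfl e₁ (ArrowLens.app_congr rfl ?_ rfl _ _) _ _
    rw [← e₁, Category.assoc, F.onPos_tgt x _ h₂]

end Cofunctor

/-- An internal copresheaf (or internal discrete opfibration) on `C` is a cofunctor into `C` from
some internal category, whose underlying morphism of arrows is cartesian. -/
structure InternalCopresheaf (C : InternalCategory E) where
  total : InternalCategory E
  proj : Cofunctor total C
  isCartesian : proj.IsCartesian

namespace InternalCopresheaf

variable {C : InternalCategory E}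

/-- A morphism of internal copresheaves is a cofunctor commuting over `C`. -/
structure Hom (X Y : InternalCopresheaf C) where
  cofunctor : Cofunctor X.total Y.total
  w : cofunctor.comp Y.proj = X.proj

theorem Hom.ext {X Y : InternalCopresheaf C} {F G : Hom X Y}
    (h : F.cofunctor.toArrowLens = G.cofunctor.toArrowLens) : F = G := by
  obtain ⟨F, _⟩ := F
  obtain ⟨G, _⟩ := G
  obtain rfl : F = G := Cofunctor.ext h
  rfl

noncomputable instance : Category (InternalCopresheaf C) where
  Hom X Y := Hom X Y
  id X := ⟨Cofunctor.id X.total, Cofunctor.ext (ArrowLens.id_comp _)⟩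
  comp {_ _ Z} F G := ⟨F.cofunctor.comp G.cofunctor, Cofunctor.ext
    ((ArrowLens.assoc _ _ Z.proj.toArrowLens).trans
      (congrArg Cofunctor.toArrowLens ((congrArg F.cofunctor.comp G.w).trans F.w)))⟩
  id_comp _ := Hom.ext (ArrowLens.id_comp _)
  comp_id _ := Hom.ext (ArrowLens.comp_id _)
  assoc _ _ _ := Hom.ext (ArrowLens.assoc _ _ _)

end InternalCopresheaf

namespace Poly

section

variable (c : Poly E) [ComonObj c]

/-- The comultiplication on positions, `C ⟶ P(c)(C)`. -/
noncomputable abbrev comulPos : c.pos ⟶ c.functor.obj c.pos := ArrowLens.onPos (comul c)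

theorem comulPos_proj : comulPos c ≫ c.proj c.pos = 𝟙 c.pos := by
  have h : comulPos c ≫ c.functor.map (ArrowLens.onPos (counit c)) =
      c.curry (𝟙 _) (terminal.from _) := congrArg ArrowLens.onPos (comul_counit c)
  have := congrArg (· ≫ c.proj (⊤_ E)) h
  simpa only [Category.assoc, curry_proj, map_proj] using this

/-- The target map of a comonoid: a direction `e` at `x` is sent to the value of `δ x` at `e`. -/
noncomputable def target : c.dir ⟶ c.pos :=
  c.eval (c.map ≫ comulPos c) (𝟙 _)
    (by rw [Category.assoc, comulPos_proj, Category.comp_id, Category.id_comp])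

/-- The identities of a comonoid: `x` is sent to the direction `ε♯ x`. -/
noncomputable def identity : c.pos ⟶ c.dir :=
  onDirApp (counit c) (𝟙 _) (terminal.from _) (Subsingleton.elim _ _)

theorem identity_map : identity c ≫ c.map = 𝟙 c.pos := ArrowLens.app_comp _ _ _ _

variable {c}

theorem eval_comulPos {T : E} (x : T ⟶ c.pos) (f : T ⟶ c.dir)
    (h : (x ≫ comulPos c) ≫ c.proj c.pos = f ≫ c.map) :
    c.eval (x ≫ comulPos c) f h = f ≫ target c := by
  have hx : x = f ≫ c.map := by
    rw [← h, Category.assoc, comulPos_proj, Category.comp_id]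
  refine Eq.trans ?_ (c.comp_eval _ _ _ _).symm
  exact c.eval_congr (by rw [hx, Category.assoc]) (Category.comp_id f).symm _ _

theorem comulPos_cond {T : E} (x : T ⟶ c.pos) (f : T ⟶ c.dir) (h : x = f ≫ c.map) :
    (x ≫ comulPos c) ≫ c.proj c.pos = f ≫ c.map := by
  rw [Category.assoc, comulPos_proj, Category.comp_id, h]

/-- The direction `(f, g)` of `c ◁ c` at `δ x` given by a direction `f` at `x` and a direction `g` at
the target of `f`. -/
noncomputable def comulMk {T : E} (f g : T ⟶ c.dir) (h : f ≫ target c = g ≫ c.map) :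
    T ⟶ triDir c c :=
  triMk c c ((f ≫ c.map) ≫ comulPos c) f g (comulPos_cond _ _ rfl) ((eval_comulPos _ _ _).trans h)

/-- The composition of a comonoid: directions `f` at `x` and `g` at the target of `f` are sent to the
direction `δ♯ (x, (f, g))` at `x`. -/
noncomputable def composite {T : E} (f g : T ⟶ c.dir) (h : f ≫ target c = g ≫ c.map) :
    T ⟶ c.dir :=
  onDirApp (comul c) (f ≫ c.map) (comulMk f g h) (triMk_map c c _ _ _ _ _).symm

theorem composite_map {T : E} (f g : T ⟶ c.dir) (h : f ≫ target c = g ≫ c.map) :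
    composite f g h ≫ c.map = f ≫ c.map := ArrowLens.app_comp _ _ _ _

theorem composite_congr {T : E} {f f' g g' : T ⟶ c.dir} (hf : f = f') (hg : g = g')
    (h : f ≫ target c = g ≫ c.map) (h' : f' ≫ target c = g' ≫ c.map) :
    composite f g h = composite f' g' h' := by
  subst hf hg; rfl

theorem comp_composite {S T : E} (s : S ⟶ T) (f g : T ⟶ c.dir)
    (h : f ≫ target c = g ≫ c.map) :
    s ≫ composite f g h = composite (s ≫ f) (s ≫ g)
      (by rw [Category.assoc, h, Category.assoc]) := by
  refine (ArrowLens.comp_app _ _ _ _ _).trans ?_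
  refine ArrowLens.app_congr rfl (Category.assoc _ _ _).symm ?_ _ _
  refine (comp_triMk c c _ _ _ _ _ _).trans ?_
  exact triMk_congr (p := c) (q := c) _ _ (by simp only [Category.assoc]) rfl rfl _ _

theorem app_comul_triMk {T : E} {x : T ⟶ c.pos} {u : T ⟶ (tri c c).pos} {f g : T ⟶ c.dir}
    (hx : x = f ≫ c.map) (h : u ≫ c.proj c.pos = f ≫ c.map) (h' : c.eval u f h = g ≫ c.map)
    (h'' : x ≫ comulPos c = triMk c c u f g h h' ≫ triMap c c)
    (k : f ≫ target c = g ≫ c.map) :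
    onDirApp (comul c) x (triMk c c u f g h h') h'' = composite f g k := by
  have hu : u = (f ≫ c.map) ≫ comulPos c := by rw [← hx, h'', triMk_map]
  exact ArrowLens.app_congr rfl hx (triMk_congr (p := c) (q := c) _ _ hu rfl rfl _ _) _ _

theorem identity_target : identity c ≫ target c = 𝟙 c.pos := by
  have h : comulPos c ≫ natApp (counit c) c.pos = betaInv c.pos :=
    congrArg ArrowLens.onPos (counit_comul c)
  have k : (comulPos c ≫ natApp (counit c) c.pos) ≫ (y E).proj c.pos =
    terminal.from c.pos ≫ (y E).map := Subsingleton.elim _ _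
  have h₁ := (y E).eval_congr (h.trans (Category.id_comp _).symm) rfl k (Subsingleton.elim _ _)
  rw [eval_natApp, eval_betaInv] at h₁
  rw [← h₁, ← eval_comulPos (𝟙 _) (identity c) (by
    rw [Category.id_comp, comulPos_proj, identity_map])]
  refine c.eval_congr (Category.id_comp _) ?_ _ _
  exact ArrowLens.app_congr rfl (comulPos_proj c).symm rfl _ _

theorem composite_target {T : E} (f g : T ⟶ c.dir) (h : f ≫ target c = g ≫ c.map) :
    composite f g h ≫ target c = g ≫ target c := by
  have hc : comulPos c ≫ c.functor.map (comulPos c) =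
      comulPos c ≫ natApp (comul c) c.pos ≫ alpha c c c.pos :=
    congrArg ArrowLens.onPos (comul_assoc c)
  let v := (f ≫ c.map) ≫ comulPos c
  let u := v ≫ natApp (comul c) c.pos
  have hv : v ≫ c.proj c.pos = f ≫ c.map := comulPos_cond _ _ rfl
  have huv : v ≫ c.functor.map (comulPos c) = u ≫ alpha c c c.pos := by
    simp only [v, u, Category.assoc, hc]
  have k : (v ≫ c.functor.map (comulPos c)) ≫ c.proj _ = f ≫ c.map := by
    rw [Category.assoc, map_proj, hv]
  have k' : (u ≫ alpha c c c.pos) ≫ c.proj _ = f ≫ c.map := by rw [← huv, k]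
  have e₁ : c.eval (u ≫ alpha c c c.pos) f k' = (f ≫ target c) ≫ comulPos c := by
    refine (c.eval_congr huv.symm rfl _ k).trans ?_
    rw [eval_map]
    exact congrArg (· ≫ comulPos c) (eval_comulPos _ _ _)
  have k'' : (𝟙 _ ≫ c.eval (u ≫ alpha c c c.pos) f k') ≫ c.proj c.pos = g ≫ c.map := by
    rw [Category.id_comp, e₁]
    exact comulPos_cond _ _ h
  have e₂ := eval_eval_alpha c c (𝟙 _) u f g k' k''
  have e₃ : c.eval (𝟙 _ ≫ c.eval (u ≫ alpha c c c.pos) f k') g k'' = g ≫ target c := by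
    refine (c.eval_congr ((Category.id_comp _).trans e₁) rfl _ (comulPos_cond _ _ h)).trans ?_
    exact eval_comulPos _ _ _
  rw [← e₃, e₂]
  have hu : u ≫ (tri c c).proj c.pos = v := by
    simp only [u, Category.assoc, natApp_proj]
    rw [← Category.assoc, hv]
  have m : (v ≫ natApp (comul c) c.pos) ≫ (tri c c).proj c.pos =
      comulMk f g h ≫ (tri c c).map := hu.trans (triMk_map c c _ _ _ _ _).symm
  symm
  refine ((tri c c).eval_congr (Category.id_comp u) ?_ _ m).trans ?_
  · exact triMk_congr (p := c) (q := c) _ _ ((Category.id_comp _).trans hu) (Category.id_comp _)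
      rfl _ _
  rw [eval_natApp]
  refine Eq.trans ?_ (eval_comulPos (f ≫ c.map) (composite f g h)
    (comulPos_cond _ _ (composite_map f g h).symm))
  exact c.eval_congr rfl (ArrowLens.app_congr rfl hv rfl _ _) _ _

theorem identity_composite {T : E} (x : T ⟶ c.pos) (g : T ⟶ c.dir)
    (h : (x ≫ identity c) ≫ target c = g ≫ c.map) : composite (x ≫ identity c) g h = g := by
  have hx : x = g ≫ c.map := by
    rw [← h, Category.assoc, identity_target, Category.comp_id]
  let d : T ⟶ triDir (y E) c := triMk (y E) c (x ≫ betaInv c.pos) (terminal.from T) g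
    (Subsingleton.elim _ _) ((eval_betaInv _ _ _).trans hx)
  have hd : x ≫ ArrowLens.onPos (leftInv c) = d ≫ (tri (y E) c).map :=
    (triMk_map (y E) c _ _ _ _ _).symm
  have hd' : x ≫ ArrowLens.onPos (comul c ≫ tensorRight (counit c) c) = d ≫ (tri (y E) c).map := by
    rw [counit_comul, hd]
  have e₁ := (ArrowLens.app_congr (counit_comul c) rfl rfl hd' hd).trans
    ((leftInv_app c x d hd).trans (triMk_snd (y E) c _ _ _ _ _))
  refine Eq.trans ?_ e₁
  refine Eq.trans ?_ (ArrowLens.comp_app' (comul c) (tensorRight (counit c) c) x d hd').symm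
  have ef : onDirApp (counit c) ((x ≫ comulPos c) ≫ c.proj c.pos) (d ≫ triFst (y E) c)
      (Subsingleton.elim _ _) = x ≫ identity c := by
    refine Eq.trans ?_ (ArrowLens.comp_app _ _ _ _ _).symm
    exact ArrowLens.app_congr rfl (by rw [Category.assoc, comulPos_proj])
      (Subsingleton.elim _ _) _ _
  have eg : d ≫ triSnd (y E) c = g := triMk_snd (y E) c _ _ _ _ _
  have k := comulPos_cond x (x ≫ identity c) (by
    rw [Category.assoc, identity_map, Category.comp_id])
  have k₂ : c.eval (x ≫ comulPos c) (onDirApp (counit c) ((x ≫ comulPos c) ≫ c.proj c.pos)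
      (d ≫ triFst (y E) c) (Subsingleton.elim _ _)) (by rw [ArrowLens.app_comp]) =
        (d ≫ triSnd (y E) c) ≫ c.map := by
    refine (c.eval_congr rfl ef _ k).trans ?_
    rw [eval_comulPos, h, eg]
  have e₂ := tensorRight_app (counit c) c (x ≫ comulPos c) d
    ((Category.assoc _ _ _).trans hd') (Subsingleton.elim _ _) k₂
  refine Eq.symm ((ArrowLens.app_congr rfl rfl e₂ _ (triMk_map c c _ _ _ _ _).symm).trans ?_)
  refine (app_comul_triMk (c := c) ?_ _ _ _ ?_).trans (composite_congr ef eg _ _)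
  · rw [ef, Category.assoc, identity_map, Category.comp_id]
  · rw [ef, eg, h]

theorem composite_identity {T : E} (f : T ⟶ c.dir) (x : T ⟶ c.pos)
    (h : f ≫ target c = (x ≫ identity c) ≫ c.map) : composite f (x ≫ identity c) h = f := by
  have hx : f ≫ target c = x := by
    rw [h, Category.assoc, identity_map, Category.comp_id]
  let z : T ⟶ c.pos := f ≫ c.map
  have hz : (z ≫ ArrowLens.onPos (rightInv c)) ≫ c.proj _ = f ≫ c.map := by
    refine (Category.assoc _ _ _).trans ((z ≫= c.curry_proj _ _).trans ?_)
    rw [Category.comp_id]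
  let d : T ⟶ triDir c (y E) := triMk c (y E) (z ≫ ArrowLens.onPos (rightInv c)) f
    (terminal.from T) hz (Subsingleton.elim _ _)
  have hd : z ≫ ArrowLens.onPos (rightInv c) = d ≫ (tri c (y E)).map :=
    (triMk_map c (y E) _ _ _ _ _).symm
  have hd' : z ≫ ArrowLens.onPos (comul c ≫ tensorLeft c (counit c)) = d ≫ (tri c (y E)).map := by
    rw [comul_counit, hd]
  have ef : d ≫ triFst c (y E) = f := triMk_fst c (y E) _ _ _ _ _
  have e₁ := (ArrowLens.app_congr (comul_counit c) rfl rfl hd' hd).trans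
    ((rightInv_app c z d hd).trans ef)
  refine Eq.trans ?_ e₁
  refine Eq.trans ?_ (ArrowLens.comp_app' (comul c) (tensorLeft c (counit c)) z d hd').symm
  have k : (z ≫ comulPos c) ≫ c.proj c.pos = (d ≫ triFst c (y E)) ≫ c.map := by
    rw [ef]; exact comulPos_cond _ _ rfl
  have e₂ := tensorLeft_app c (counit c) (z ≫ comulPos c) d
    ((Category.assoc _ _ _).trans hd') k (Subsingleton.elim _ _)
  have ev : c.eval (z ≫ comulPos c) (d ≫ triFst c (y E)) k = x := by
    rw [eval_comulPos, ef, hx]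
  have eg : onDirApp (counit c) (c.eval (z ≫ comulPos c) (d ≫ triFst c (y E)) k)
      (d ≫ triSnd c (y E)) (Subsingleton.elim _ _) = x ≫ identity c := by
    refine Eq.trans ?_ (ArrowLens.comp_app _ _ _ _ _).symm
    exact ArrowLens.app_congr rfl (ev.trans (Category.comp_id _).symm)
      (Subsingleton.elim _ _) _ _
  refine Eq.symm ((ArrowLens.app_congr rfl rfl e₂ _ (triMk_map c c _ _ _ _ _).symm).trans ?_)
  refine (app_comul_triMk (c := c) ?_ _ _ _ ?_).trans (composite_congr ef eg _ _)
  · rw [ef]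
  · rw [eg, ef, h]

theorem composite_assoc {T : E} (f g e : T ⟶ c.dir) (h : f ≫ target c = g ≫ c.map)
    (h' : g ≫ target c = e ≫ c.map) :
    composite (composite f g h) e (by rw [composite_target, h']) =
      composite f (composite g e h') (by rw [composite_map, h]) := by
  let z : T ⟶ c.pos := f ≫ c.map
  let w := (z ≫ comulPos c) ≫ c.functor.map (comulPos c)
  have kw₀ := comulPos_cond z f rfl
  have kw : w ≫ c.proj _ = f ≫ c.map := by
    rw [Category.assoc, map_proj, kw₀]
  have ew : c.eval w f kw = (g ≫ c.map) ≫ comulPos c := by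
    rw [eval_map, eval_comulPos, h]
  let d : T ⟶ triDir c (tri c c) := triMk c (tri c c) w f (comulMk g e h') kw
    (ew.trans (triMk_map c c _ _ _ _ _).symm)
  have df : d ≫ triFst c (tri c c) = f := triMk_fst c (tri c c) _ _ _ _ _
  have ds : d ≫ triSnd c (tri c c) = comulMk g e h' := triMk_snd c (tri c c) _ _ _ _ _
  have dsf : d ≫ triSnd c (tri c c) ≫ triFst c c = g := by
    rw [← Category.assoc, ds]; exact triMk_fst c c _ _ _ _ _
  have dss : d ≫ triSnd c (tri c c) ≫ triSnd c c = e := by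
    rw [← Category.assoc, ds]; exact triMk_snd c c _ _ _ _ _
  have hd : z ≫ ArrowLens.onPos (comul c ≫ tensorLeft c (comul c)) =
      d ≫ (tri c (tri c c)).map :=
    (Category.assoc _ _ _).symm.trans (triMk_map c (tri c c) _ _ _ _ _).symm
  have hd' : z ≫ ArrowLens.onPos (comul c ≫ tensorRight (comul c) c ≫ assocHom c c c) =
      d ≫ (tri c (tri c c)).map := by rw [← comul_assoc, hd]
  have main := ArrowLens.app_congr (comul_assoc c) rfl rfl hd hd'
  have lhs : ArrowLens.app (comul c ≫ tensorLeft c (comul c)) z d hd =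
      composite f (composite g e h') (by rw [composite_map, h]) := by
    refine (ArrowLens.comp_app' (comul c) (tensorLeft c (comul c)) z d hd).trans ?_
    have k : (z ≫ comulPos c) ≫ c.proj c.pos = (d ≫ triFst c (tri c c)) ≫ c.map := by
      rw [df, kw₀]
    have ev : c.eval (z ≫ comulPos c) (d ≫ triFst c (tri c c)) k = g ≫ c.map := by
      rw [eval_comulPos, df, h]
    have k₂ : c.eval (z ≫ comulPos c) (d ≫ triFst c (tri c c)) k ≫ comulPos c =
        (d ≫ triSnd c (tri c c)) ≫ (tri c c).map := by
      rw [ev, ds]; exact (triMk_map c c _ _ _ _ _).symm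
    have e₂ := tensorLeft_app c (comul c) (z ≫ comulPos c) d
      ((Category.assoc _ _ _).trans hd) k k₂
    have eg : onDirApp (comul c) (c.eval (z ≫ comulPos c) (d ≫ triFst c (tri c c)) k)
        (d ≫ triSnd c (tri c c)) k₂ = composite g e h' := ArrowLens.app_congr rfl ev ds _ _
    refine (ArrowLens.app_congr rfl rfl e₂ _ (triMk_map c c _ _ _ _ _).symm).trans ?_
    refine (app_comul_triMk (c := c) ?_ _ _ _ ?_).trans (composite_congr df eg _ _)
    · rw [df]
    · rw [eg, df, composite_map, h]
  have rhs : ArrowLens.app (comul c ≫ tensorRight (comul c) c ≫ assocHom c c c) z d hd' =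
      composite (composite f g h) e (by rw [composite_target, h']) := by
    refine (ArrowLens.comp_app' (comul c) (tensorRight (comul c) c ≫ assocHom c c c) z d
      hd').trans ?_
    have hd₁ : (z ≫ comulPos c) ≫ ArrowLens.onPos (tensorRight (comul c) c ≫ assocHom c c c) =
        d ≫ (tri c (tri c c)).map := (Category.assoc _ _ _).trans hd'
    have e₀ := ArrowLens.comp_app' (tensorRight (comul c) c) (assocHom c c c) (z ≫ comulPos c) d hd₁
    let U := (z ≫ comulPos c) ≫ ArrowLens.onPos (tensorRight (comul c) c)
    obtain ⟨h₁, h₂, h₃, h₄, ea⟩ := assocHom_app c c c U d ((Category.assoc _ _ _).trans hd₁)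
    have hM := (triMk_map (tri c c) c U _ _ h₃ h₄).symm
    have Mf := triMk_fst (tri c c) c U _ _ h₃ h₄
    have Ms := (triMk_snd (tri c c) c U _ _ h₃ h₄).trans dss
    set M := triMk (tri c c) c U _ _ h₃ h₄
    have hz : (z ≫ comulPos c) ≫ c.proj c.pos = z := by
      rw [Category.assoc, comulPos_proj, Category.comp_id]
    have kM := (eval_of_eq (tri c c) c hM).fst
    have q₁ : ((z ≫ comulPos c) ≫ c.proj c.pos) ≫ comulPos c =
        (M ≫ triFst (tri c c) c) ≫ (tri c c).map := by
      rw [← kM]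
      exact (Category.assoc _ _ _).trans (((z ≫ comulPos c) ≫= (natApp_proj (comul c) c.pos).symm).trans
        (Category.assoc _ _ _).symm)
    have q₁' : z ≫ comulPos c = (M ≫ triFst (tri c c) c) ≫ (tri c c).map := by rw [← q₁, hz]
    have eF : onDirApp (comul c) ((z ≫ comulPos c) ≫ c.proj c.pos) (M ≫ triFst (tri c c) c) q₁ =
        composite f g h := by
      refine (ArrowLens.app_congr rfl hz Mf _ (q₁'.trans (congrArg (· ≫ (tri c c).map) Mf))).trans ?_
      refine (app_comul_triMk (c := c) (by rw [df]) _ _ _ (by rw [df, dsf, h])).trans ?_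
      exact composite_congr df dsf _ _
    have q₂ : c.eval (z ≫ comulPos c) (onDirApp (comul c) ((z ≫ comulPos c) ≫ c.proj c.pos)
        (M ≫ triFst (tri c c) c) q₁) (by rw [ArrowLens.app_comp]) =
          (M ≫ triSnd (tri c c) c) ≫ c.map := by
      rw [eval_comulPos, eF, Ms, composite_target, h']
    have e₁ := tensorRight_app (comul c) c (z ≫ comulPos c) M hM q₁ q₂
    have e₂ := (e₀.trans (ArrowLens.app_congr rfl rfl ea _ hM)).trans e₁
    refine (ArrowLens.app_congr rfl rfl e₂ _ (triMk_map c c _ _ _ _ _).symm).trans ?_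
    refine (app_comul_triMk (c := c) ?_ _ _ _ ?_).trans (composite_congr eF Ms _ _)
    · rw [eF, composite_map]
    · rw [eF, Ms, composite_target, h']
  rw [← rhs, ← main, lhs]

variable (c)

/-- The internal category of a comonoid `c` in polynomials. Its source map is `c` itself. -/
noncomputable def internalCategory : InternalCategory E where
  obj := c.pos
  mor := c.dir
  src := c.map
  tgt := target c
  ident := identity c
  comp := composite (pullback.fst (target c) c.map) (pullback.snd (target c) c.map)
    pullback.condition
  ident_src := identity_map c
  ident_tgt := identity_target
  comp_src := composite_map _ _ _
  comp_tgt := composite_target _ _ _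
  id_comp := by
    rw [comp_composite]
    refine (composite_congr (pullback.lift_fst _ _ _) (pullback.lift_snd _ _ _) _ ?_).trans
      (identity_composite _ _ _)
    simp [identity_target]
  comp_id := by
    rw [comp_composite]
    refine (composite_congr (pullback.lift_fst _ _ _) (pullback.lift_snd _ _ _) _ ?_).trans
      (composite_identity _ _ _)
    simp [identity_map]
  assoc f g h hfg hgh := by
    have e : ∀ {T : E} (f g : T ⟶ c.dir) (h : f ≫ target c = g ≫ c.map), pullback.lift f g h ≫
        composite (pullback.fst (target c) c.map) (pullback.snd (target c) c.map)
          pullback.condition = composite f g h := fun f g h => by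
      rw [comp_composite]
      exact composite_congr (pullback.lift_fst _ _ _) (pullback.lift_snd _ _ _) _ _
    refine (e _ _ _).trans (Eq.trans ?_ (e _ _ _).symm)
    refine (composite_congr (e _ _ _) rfl _ (by rw [composite_target, hgh])).trans
      ((composite_assoc f g h hfg hgh).trans ?_)
    exact composite_congr rfl (e _ _ _).symm _ _

end

end Poly

end Polynomials

end InternalPoly

namespace InternalPoly

attribute [local simp] pullback.lift_fst pullback.lift_snd pullback.lift_fst_assoc
  pullback.lift_snd_assoc

variable {E : Type u} [Category.{v} E] [HasFiniteLimits E]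

/-! Both categories are compared with a third one, the actions of the internal category C of c:
objects S with an anchor S → C₀ and a map S ×_{C₀} C₁ → S, written (s, f) ↦ s·f, which satisfy
a(s·f) = t(f), s·id = s and s·(g∘f) = (s·f)·g, where a is the anchor.

Copresheaves are actions. Let φ : D → C be a cofunctor with φ♯ invertible. Then D₁ ≅ D₀ ×_{C₀} C₁,
so a morphism of D is the same thing as its source together with its label, a morphism of C. The
cofunctor axioms prescribe identities and composites of D in these terms; only the target map D₀
×_{C₀} C₁ → D₀ is free, and the axioms say precisely that it is an action. The category of elements
recovers D from that action. A cofunctor over C has no freedom on morphisms either: it must send (x,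
d) to the lift at x of the label of d (`Hom.app_eq`), so it amounts to an equivariant map on objects
(`homOfEquivariant`). This half holds for every internal category C and uses only finite limits.

Actions are coalgebras. By the adjunction defining P(c), a map κ : S → P(c)(S) is a map S → C₀
together with a map S ×_{C₀} C₁ → S, that is, an anchor and an action without laws. The counit of
the comonad evaluates at the identity, so the counit equation is s·id = s (`counit_iff`). The
comultiplication sends (x, g) to f ↦ (t(f), h ↦ g(h∘f)). Comparing this with P(c)(κ)∘κ, the
positions give a(s·f) = t(f) and the values give s·(h∘f) = (s·f)·h (`coassoc_iff`). In the same way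
homomorphisms are equivariant maps (`map_coact_iff`).

All equations are checked on generalized elements. Two elements of P(c)(A) are equal when they have
the same position and the same value at every direction over every later stage (`Poly.hom_ext`);
this is why changes of stage occur throughout. -/

namespace InternalCategory

/-! ### Internal categories: laws on generalized elements -/

theorem comp_compElt (C : InternalCategory E) {S T : E} (s : S ⟶ T) (f g : T ⟶ C.mor)
    (h : f ≫ C.tgt = g ≫ C.src) :
    s ≫ C.compElt f g h = C.compElt (s ≫ f) (s ≫ g) (by simp only [Category.assoc, h]) := by
  rw [compElt, compElt, ← Category.assoc]
  congr 1
  apply pullback.hom_ext <;> simp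

/-- The unit law of an internal category is stated for the universal morphism; precomposing it with
`g` gives every stage. Composability already forces `x` to be the source of `g`. The lemmas
`compElt_ident` and `smul_ident` rest on the same argument. -/
theorem ident_compElt (C : InternalCategory E) {T : E} (x : T ⟶ C.obj) (g : T ⟶ C.mor)
    (h : (x ≫ C.ident) ≫ C.tgt = g ≫ C.src) : C.compElt (x ≫ C.ident) g h = g := by
  have hx : x = g ≫ C.src := by rw [← h, Category.assoc, C.ident_tgt, Category.comp_id]
  have e := g ≫= C.id_comp
  refine Eq.trans (congrArg (· ≫ C.comp) ?_)
    ((Category.assoc _ _ _).trans (e.trans (Category.comp_id _)))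
  apply pullback.hom_ext <;> simp [hx]

theorem compElt_ident (C : InternalCategory E) {T : E} (f : T ⟶ C.mor) (x : T ⟶ C.obj)
    (h : f ≫ C.tgt = (x ≫ C.ident) ≫ C.src) : C.compElt f (x ≫ C.ident) h = f := by
  have hx : x = f ≫ C.tgt := by rw [h, Category.assoc, C.ident_src, Category.comp_id]
  have e := f ≫= C.comp_id
  refine Eq.trans (congrArg (· ≫ C.comp) ?_)
    ((Category.assoc _ _ _).trans (e.trans (Category.comp_id _)))
  apply pullback.hom_ext <;> simp [hx]

theorem compElt_assoc (C : InternalCategory E) {T : E} (f g h : T ⟶ C.mor)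
    (hfg : f ≫ C.tgt = g ≫ C.src) (hgh : g ≫ C.tgt = h ≫ C.src) :
    C.compElt (C.compElt f g hfg) h (by rw [compElt_tgt, hgh]) =
      C.compElt f (C.compElt g h hgh) (by rw [compElt_src, hfg]) :=
  C.assoc f g h hfg hgh

/-! ### Actions of an internal category -/

/-- An action of an internal category `C` on an object `carrier` over the objects of `C`: a
morphism of `C` out of the image of an element of `carrier` moves it to another such element. -/
structure Action (C : InternalCategory E) where
  carrier : E
  anchor : carrier ⟶ C.obj
  act : pullback anchor C.src ⟶ carrier
  act_anchor : act ≫ anchor = pullback.snd anchor C.src ≫ C.tgt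
  act_ident : pullback.lift (𝟙 carrier) (anchor ≫ C.ident)
    (by rw [Category.assoc, C.ident_src, Category.comp_id, Category.id_comp]) ≫ act = 𝟙 carrier
  -- Requiring the law at all stages is equivalent to requiring it for the universal triple of an
  -- element and two composable morphisms, and it avoids iterated pullbacks.
  act_compElt {T : E} (s : T ⟶ carrier) (f g : T ⟶ C.mor) (h : s ≫ anchor = f ≫ C.src)
    (h' : f ≫ C.tgt = g ≫ C.src) :
    pullback.lift s (C.compElt f g h') (by rw [compElt_src, h]) ≫ act =
      pullback.lift (pullback.lift s f h ≫ act) g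
        (by rw [Category.assoc, act_anchor, pullback.lift_snd_assoc, h']) ≫ act

namespace Action

variable {C : InternalCategory E}

/-- The action on generalized elements. -/
noncomputable def smul (X : Action C) {T : E} (s : T ⟶ X.carrier) (f : T ⟶ C.mor)
    (h : s ≫ X.anchor = f ≫ C.src) : T ⟶ X.carrier :=
  pullback.lift s f h ≫ X.act

theorem smul_anchor (X : Action C) {T : E} (s : T ⟶ X.carrier) (f : T ⟶ C.mor)
    (h : s ≫ X.anchor = f ≫ C.src) : X.smul s f h ≫ X.anchor = f ≫ C.tgt := by
  rw [smul, Category.assoc, X.act_anchor, pullback.lift_snd_assoc]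

theorem smul_congr (X : Action C) {T : E} {s s' : T ⟶ X.carrier} {f f' : T ⟶ C.mor}
    (hs : s = s') (hf : f = f') (h : s ≫ X.anchor = f ≫ C.src)
    (h' : s' ≫ X.anchor = f' ≫ C.src) : X.smul s f h = X.smul s' f' h' := by
  subst hs hf; rfl

theorem smul_ident (X : Action C) {T : E} (s : T ⟶ X.carrier) (x : T ⟶ C.obj)
    (h : s ≫ X.anchor = (x ≫ C.ident) ≫ C.src) : X.smul s (x ≫ C.ident) h = s := by
  have hx : x = s ≫ X.anchor := by rw [h, Category.assoc, C.ident_src, Category.comp_id]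
  have e := s ≫= X.act_ident
  refine Eq.trans (congrArg (· ≫ X.act) ?_)
    ((Category.assoc _ _ _).trans (e.trans (Category.comp_id _)))
  apply pullback.hom_ext <;> simp [hx]

theorem smul_compElt (X : Action C) {T : E} (s : T ⟶ X.carrier) (f g : T ⟶ C.mor)
    (h : s ≫ X.anchor = f ≫ C.src) (h' : f ≫ C.tgt = g ≫ C.src) :
    X.smul s (C.compElt f g h') (by rw [compElt_src, h]) =
      X.smul (X.smul s f h) g (by rw [smul_anchor, h']) :=
  X.act_compElt s f g h h'

/-- An equivariant morphism of actions. -/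
structure Hom (X Y : Action C) where
  hom : X.carrier ⟶ Y.carrier
  hom_anchor : hom ≫ Y.anchor = X.anchor
  smul_hom {T : E} (s : T ⟶ X.carrier) (f : T ⟶ C.mor) (h : s ≫ X.anchor = f ≫ C.src) :
    X.smul s f h ≫ hom = Y.smul (s ≫ hom) f (by rw [Category.assoc, hom_anchor, h])

theorem Hom.ext {X Y : Action C} {F G : Hom X Y} (h : F.hom = G.hom) : F = G := by
  obtain ⟨F, _⟩ := F
  obtain ⟨G, _⟩ := G
  obtain rfl : F = G := h
  rfl

noncomputable instance : Category (Action C) where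
  Hom X Y := Hom X Y
  id X := ⟨𝟙 _, Category.id_comp _, fun s f h =>
    (Category.comp_id _).trans (X.smul_congr (Category.comp_id s).symm rfl _ _)⟩
  comp {X Y Z} F G := ⟨F.hom ≫ G.hom, by rw [Category.assoc, G.hom_anchor, F.hom_anchor],
    fun s f h => by
      rw [← Category.assoc, F.smul_hom, G.smul_hom]
      exact Z.smul_congr (Category.assoc _ _ _) rfl _ _⟩
  id_comp _ := Hom.ext (Category.id_comp _)
  comp_id _ := Hom.ext (Category.comp_id _)
  assoc _ _ _ := Hom.ext (Category.assoc _ _ _)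

/-- An isomorphism on carriers that is equivariant is an isomorphism of actions. -/
noncomputable def isoMk {X Y : Action C} (F : X ⟶ Y) (g : Y.carrier ⟶ X.carrier)
    (h : F.hom ≫ g = 𝟙 _) (h' : g ≫ F.hom = 𝟙 _) : X ≅ Y where
  hom := F
  inv := ⟨g, by rw [← F.hom_anchor, reassoc_of% h'], fun s f k => by
    have k₁ : (s ≫ g) ≫ X.anchor = f ≫ C.src := by
      rw [← F.hom_anchor, Category.assoc, reassoc_of% h', k]
    -- Equivariance of `F` at `s ≫ g`, followed by `g`, is equivariance of the inverse at `s`.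
    have e := F.smul_hom (s ≫ g) f k₁
    rw [Y.smul_congr (s' := s) (by rw [Category.assoc, h', Category.comp_id]) rfl _ k] at e
    rw [← e, Category.assoc, h, Category.comp_id]⟩
  hom_inv_id := Hom.ext h
  inv_hom_id := Hom.ext h'

/-! ### The category of elements of an action -/

theorem smul_fst_snd (X : Action C) {T : E} (d : T ⟶ pullback X.anchor C.src) :
    X.smul (d ≫ pullback.fst _ _) (d ≫ pullback.snd _ _)
      (by rw [Category.assoc, pullback.condition, Category.assoc]) = d ≫ X.act := by
  refine congrArg (· ≫ X.act) ?_
  apply pullback.hom_ext <;> simp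

/-- Composition in the category of elements, `((s, f), (s f, g)) ↦ (s, g ∘ f)`. -/
noncomputable def elementsComp (X : Action C) :
    pullback X.act (pullback.fst X.anchor C.src) ⟶ pullback X.anchor C.src :=
  pullback.lift (pullback.fst _ _ ≫ pullback.fst _ _)
    (C.compElt (pullback.fst _ _ ≫ pullback.snd _ _) (pullback.snd _ _ ≫ pullback.snd _ _)
      (by rw [Category.assoc, ← X.act_anchor, pullback.condition_assoc, pullback.condition,
        Category.assoc]))
    (by rw [compElt_src, Category.assoc, pullback.condition, Category.assoc])

/-- The anchor of s·f is the target of f, so when (s, f) ends where (s', g) starts, that is s·f =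
s', the morphisms f and g are composable in `C`. -/
theorem elementsComp_cond (X : Action C) {T : E} {d d' : T ⟶ pullback X.anchor C.src}
    (h : d ≫ X.act = d' ≫ pullback.fst _ _) :
    (d ≫ pullback.snd _ _) ≫ C.tgt = (d' ≫ pullback.snd _ _) ≫ C.src := by
  rw [Category.assoc, ← X.act_anchor, reassoc_of% h, pullback.condition, Category.assoc]

/-- With `lift_elementsComp_snd`, this splits the unit and associativity laws of the category of
elements into two components: the starting element, where nothing happens, and the morphism of `C`,
where the law is that of `C`. -/
theorem lift_elementsComp_fst (X : Action C) {T : E} (d d' : T ⟶ pullback X.anchor C.src)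
    (h : d ≫ X.act = d' ≫ pullback.fst _ _) :
    (pullback.lift d d' h ≫ X.elementsComp) ≫ pullback.fst _ _ = d ≫ pullback.fst _ _ := by
  simp [elementsComp]

theorem lift_elementsComp_snd (X : Action C) {T : E} (d d' : T ⟶ pullback X.anchor C.src)
    (h : d ≫ X.act = d' ≫ pullback.fst _ _) :
    (pullback.lift d d' h ≫ X.elementsComp) ≫ pullback.snd _ _ =
      C.compElt (d ≫ pullback.snd _ _) (d' ≫ pullback.snd _ _) (X.elementsComp_cond h) := by
  rw [Category.assoc, elementsComp, pullback.lift_snd, comp_compElt]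
  exact compElt_congr (by simp) (by simp) _ _

/-- The category of elements of an action: its morphisms are pairs of an element and a morphism
out of the image of this element. -/
noncomputable def elements (X : Action C) : InternalCategory E where
  obj := X.carrier
  mor := pullback X.anchor C.src
  src := pullback.fst _ _
  tgt := X.act
  ident := pullback.lift (𝟙 _) (X.anchor ≫ C.ident)
    (by rw [Category.assoc, C.ident_src, Category.comp_id, Category.id_comp])
  comp := X.elementsComp
  ident_src := pullback.lift_fst _ _ _
  ident_tgt := X.act_ident
  comp_src := pullback.lift_fst _ _ _
  comp_tgt := by
    have h : pullback.fst X.act (pullback.fst X.anchor C.src) ≫ X.act =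
      pullback.snd _ _ ≫ pullback.fst _ _ := pullback.condition
    -- The target of a composite is s·(g∘f) = (s·f)·g. The composability condition `h` identifies
    -- s·f with the starting element of the second pair, so this is the target of that pair.
    refine (X.smul_compElt (pullback.fst _ _ ≫ pullback.fst _ _) _ _
      (by rw [Category.assoc, pullback.condition, Category.assoc])
      (X.elementsComp_cond h)).trans ?_
    rw [← X.smul_fst_snd]
    exact X.smul_congr ((X.smul_fst_snd _).trans h) rfl _ _
  id_comp := by
    apply pullback.hom_ext
    · rw [lift_elementsComp_fst]
      simp
    · rw [lift_elementsComp_snd]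
      -- The label of the identity is reassociated into the shape `x ≫ C.ident`, with `x` the anchor
      -- of the starting element, to which the unit law of `C` applies.
      refine (compElt_congr (f' := (pullback.fst X.anchor C.src ≫ X.anchor) ≫ C.ident)
        (by simp) rfl _ ?_).trans (ident_compElt _ _ _ ?_)
      all_goals simp [C.ident_tgt, pullback.condition]
  comp_id := by
    apply pullback.hom_ext
    · rw [lift_elementsComp_fst]
    · rw [lift_elementsComp_snd]
      refine (compElt_congr (g' := (X.act ≫ X.anchor) ≫ C.ident) rfl (by simp) _ ?_).trans
        (compElt_ident _ _ _ ?_)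
      all_goals simp [C.ident_src, X.act_anchor]
  assoc f g h hfg hgh := by
    apply pullback.hom_ext
    · simp only [lift_elementsComp_fst]
    · simp only [lift_elementsComp_snd]
      exact compElt_assoc _ _ _ _ _ _

/-- The projection from the category of elements. -/
noncomputable def elementsProj (X : Action C) : Cofunctor X.elements C where
  onPos := X.anchor
  -- The morphisms of the category of elements are by construction the pullback on which φ♯ is
  -- defined, so φ♯ can be the identity. This makes the projection cartesian; the lift of `e` at `x`
  -- is then the pair (x, e) up to composition with an identity.
  onDir := 𝟙 _
  onDir_comp := Category.id_comp _
  app_ident x := by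
    refine (Category.comp_id _).trans ?_
    apply pullback.hom_ext
    · exact (pullback.lift_fst _ _ _).trans ((Category.assoc _ _ _).trans
        ((x ≫= pullback.lift_fst _ _ _).trans (Category.comp_id _))).symm
    · exact (pullback.lift_snd _ _ _).trans ((Category.assoc _ _ _).trans
        (x ≫= pullback.lift_snd _ _ _)).symm
  onPos_tgt x e h := (Category.assoc _ _ _).symm.trans
    ((congrArg (fun d => (d ≫ X.act) ≫ X.anchor) (Category.comp_id _)).trans
      (X.smul_anchor x e h))
  app_compElt x e e' h h' := by
    apply pullback.hom_ext
    · exact (congrArg (· ≫ pullback.fst _ _) (Category.comp_id _)).trans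
        ((pullback.lift_fst _ _ _).trans (Eq.symm ((X.lift_elementsComp_fst _ _ _).trans
          ((congrArg (· ≫ pullback.fst _ _) (Category.comp_id _)).trans
            (pullback.lift_fst _ _ _)))))
    · refine (congrArg (· ≫ pullback.snd _ _) (Category.comp_id _)).trans
        ((pullback.lift_snd _ _ _).trans (Eq.trans ?_ (X.lift_elementsComp_snd _ _ _).symm))
      refine compElt_congr ?_ ?_ _ _
      all_goals exact ((congrArg (· ≫ pullback.snd _ _) (Category.comp_id _)).trans
        (pullback.lift_snd _ _ _)).symm

end Action

end InternalCategory

/-! ### Copresheaves: unique lifts and labels -/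

namespace InternalCopresheaf

variable {C : InternalCategory E}

instance (X : InternalCopresheaf C) : IsIso X.proj.onDir := X.isCartesian

/-- The inverse of φ♯ sends a morphism of the total category to the pair of its source and its
label. The source appears here because φ♯ lies over the objects of the total category. -/
theorem inv_onDir_fst (X : InternalCopresheaf C) :
    inv X.proj.onDir ≫ pullback.fst _ _ = X.total.src :=
  (IsIso.inv_comp_eq _).2 X.proj.onDir_comp.symm

/-- The morphism of the base over which a morphism of the total category lies. -/
noncomputable def label (X : InternalCopresheaf C) : X.total.mor ⟶ C.mor :=
  inv X.proj.onDir ≫ pullback.snd _ _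

theorem app_label (X : InternalCopresheaf C) {T : E} (x : T ⟶ X.total.obj) (e : T ⟶ C.mor)
    (h : x ≫ X.proj.onPos = e ≫ C.src) : X.proj.app x e h ≫ X.label = e := by
  simp [label, ArrowLens.app]

theorem label_src (X : InternalCopresheaf C) :
    X.label ≫ C.src = X.total.src ≫ X.proj.onPos := by
  rw [label, Category.assoc, ← pullback.condition, ← Category.assoc]
  exact congrArg (· ≫ X.proj.onPos) X.inv_onDir_fst

/-- Uniqueness of lifts: a morphism is recovered from its source and its label, since this pair is
its image under the inverse of φ♯. The existence half is `app_label`. -/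
theorem app_of_label (X : InternalCopresheaf C) {T : E} (x : T ⟶ X.total.obj)
    (d : T ⟶ X.total.mor) (hx : x = d ≫ X.total.src)
    (h : x ≫ X.proj.onPos = (d ≫ X.label) ≫ C.src) : X.proj.app x (d ≫ X.label) h = d := by
  have e : pullback.lift x (d ≫ X.label) h = d ≫ inv X.proj.onDir := by
    apply pullback.hom_ext
    · rw [pullback.lift_fst, Category.assoc, inv_onDir_fst, hx]
    · rw [pullback.lift_snd, label, Category.assoc]
  rw [ArrowLens.app, e, Category.assoc, IsIso.inv_hom_id, Category.comp_id]

/-- Together with `label_src`, `ident_label` and `compElt_label`, this says that the label and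
`proj.onPos` form an internal functor from the total category to `C`. Apart from the source, each
compatibility is a cofunctor axiom for `proj`, read through the correspondence between morphisms and
their labels. -/
theorem label_tgt (X : InternalCopresheaf C) :
    X.total.tgt ≫ X.proj.onPos = X.label ≫ C.tgt := by
  -- The universal morphism of the total category is written as an identity so that it can be
  -- treated as the lift of its own label.
  have k : X.total.src ≫ X.proj.onPos = (𝟙 _ ≫ X.label) ≫ C.src := by
    rw [Category.id_comp, label_src]
  have e := X.proj.onPos_tgt X.total.src (𝟙 _ ≫ X.label) k
  rwa [X.app_of_label _ _ (Category.id_comp _).symm, Category.id_comp, Category.id_comp] at e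

theorem ident_label (X : InternalCopresheaf C) {T : E} (x : T ⟶ X.total.obj) :
    (x ≫ X.total.ident) ≫ X.label = x ≫ X.proj.onPos ≫ C.ident := by
  rw [← X.proj.app_ident x, app_label]

theorem compElt_label (X : InternalCopresheaf C) {T : E} (d d' : T ⟶ X.total.mor)
    (h : d ≫ X.total.tgt = d' ≫ X.total.src) :
    X.total.compElt d d' h ≫ X.label = C.compElt (d ≫ X.label) (d' ≫ X.label)
      (by rw [Category.assoc, ← label_tgt, reassoc_of% h, Category.assoc, label_src]) := by
  have k : (d ≫ X.total.src) ≫ X.proj.onPos = (d ≫ X.label) ≫ C.src := by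
    rw [Category.assoc, Category.assoc, label_src]
  have k' : (d ≫ X.label) ≫ C.tgt = (d' ≫ X.label) ≫ C.src := by
    rw [Category.assoc, ← label_tgt, reassoc_of% h, Category.assoc, label_src]
  -- The composition axiom is applied to the labels of `d` and `d'`. By uniqueness of lifts, the two
  -- lifts occurring in it are `d` and, since `d'` starts where `d` ends, `d'`.
  have e := congrArg (· ≫ X.label) (X.proj.app_compElt _ _ _ k k')
  rw [app_label] at e
  refine Eq.trans (congrArg (· ≫ X.label) ?_) e.symm
  have e₁ := X.app_of_label _ d rfl k
  refine InternalCategory.compElt_congr e₁.symm ?_ _ _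
  refine (X.app_of_label _ d' ?_ _).symm
  rw [e₁, h]

/-! ### From copresheaves to actions -/

/-- The action of the base on the objects of the total category of a copresheaf. -/
noncomputable def toAction (X : InternalCopresheaf C) : C.Action where
  carrier := X.total.obj
  anchor := X.proj.onPos
  act := X.proj.onDir ≫ X.total.tgt
  act_anchor := by
    have e := X.proj.onPos_tgt _ _ (pullback.condition (f := X.proj.onPos) (g := C.src))
    rw [ArrowLens.app_fst_snd] at e
    rw [← e, Category.assoc]
  act_ident := by
    -- The lift of an identity is an identity, whose target is the object it started from.
    have e := (X.proj.app_ident (𝟙 _)).trans (Category.id_comp _)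
    refine Eq.trans ?_ X.total.ident_tgt
    refine (Category.assoc _ _ _).symm.trans (congrArg (· ≫ X.total.tgt) (Eq.trans ?_ e))
    exact ArrowLens.app_congr rfl rfl (Category.id_comp _).symm _ _
  act_compElt s f g h h' := by
    -- On targets the composition axiom becomes the action law: the target of a composite is that of
    -- its second factor, and this factor is a lift at the target of the first.
    have e := congrArg (· ≫ X.total.tgt) (X.proj.app_compElt s f g h h')
    simp only [InternalCategory.compElt_tgt] at e
    rw [← Category.assoc]
    refine e.trans (Eq.trans ?_ (Category.assoc _ _ _))
    exact congrArg (· ≫ X.total.tgt) (ArrowLens.app_congr rfl (Category.assoc _ _ _) rfl _ _)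

theorem toAction_smul (X : InternalCopresheaf C) {T : E} (s : T ⟶ X.total.obj) (f : T ⟶ C.mor)
    (h : s ≫ X.proj.onPos = f ≫ C.src) :
    X.toAction.smul s f h = X.proj.app s f h ≫ X.total.tgt :=
  (Category.assoc _ _ _).symm

/-! ### Morphisms of copresheaves as equivariant maps -/

variable {X Y : InternalCopresheaf C}

theorem Hom.onPos_comp (F : Hom X Y) : F.cofunctor.onPos ≫ Y.proj.onPos = X.proj.onPos :=
  congrArg (fun G => G.onPos) F.w

/-- The commuting triangle over `C` read on directions, with the composite cofunctor unfolded;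
`Hom.onPos_comp` is its half on objects. -/
theorem Hom.app_app (F : Hom X Y) {T : E} (x : T ⟶ X.total.obj) (e : T ⟶ C.mor)
    (h : x ≫ X.proj.onPos = e ≫ C.src) :
    F.cofunctor.app x (Y.proj.app (x ≫ F.cofunctor.onPos) e
        (by rw [Category.assoc, F.onPos_comp, h])) (by rw [ArrowLens.app_comp]) =
      X.proj.app x e h := by
  have k : x ≫ (F.cofunctor.comp Y.proj).onPos = e ≫ C.src := by rw [F.w, h]
  refine (ArrowLens.comp_app' F.cofunctor.toArrowLens Y.proj.toArrowLens x e k).symm.trans ?_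
  exact ArrowLens.app_congr (congrArg Cofunctor.toArrowLens F.w) rfl rfl _ _

/-- Since `d` is the lift of its own label, the triangle over `C` leaves no choice for the value of
`F` on it. A morphism of copresheaves is thus determined by its map on objects, which gives
faithfulness below, and the formula dictates the construction used for fullness. -/
theorem Hom.app_eq (F : Hom X Y) {T : E} (x : T ⟶ X.total.obj) (d : T ⟶ Y.total.mor)
    (h : x ≫ F.cofunctor.onPos = d ≫ Y.total.src) :
    F.cofunctor.app x d h = X.proj.app x (d ≫ Y.label)
      (by rw [← F.onPos_comp, reassoc_of% h, Category.assoc, label_src]) := by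
  rw [← F.app_app]
  exact ArrowLens.app_congr rfl rfl (Y.app_of_label _ d h _).symm _ _

theorem homOfEquivariant_cond {f : X.total.obj ⟶ Y.total.obj}
    (hf : f ≫ Y.proj.onPos = X.proj.onPos) {T : E} (x : T ⟶ X.total.obj) (d : T ⟶ Y.total.mor)
    (h : x ≫ f = d ≫ Y.total.src) : x ≫ X.proj.onPos = (d ≫ Y.label) ≫ C.src := by
  rw [← hf, reassoc_of% h, Category.assoc, label_src]

/-- The morphism of arrows underlying the morphism of copresheaves determined by an equivariant
morphism `f`: a morphism of `Y` is lifted to the morphism of `X` with the same image in `C`. -/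
noncomputable def lensOfEquivariant (f : X.total.obj ⟶ Y.total.obj)
    (hf : f ≫ Y.proj.onPos = X.proj.onPos) : ArrowLens X.total.src Y.total.src :=
  ArrowLens.ofElements f
    (fun x d h => X.proj.app x (d ≫ Y.label) (homOfEquivariant_cond hf x d h))
    (fun _ _ _ => ArrowLens.app_comp _ _ _ _)

/-- The construction by `ofElements` uses the rule only on the universal pair. The rule is recovered
at every stage because lifting commutes with change of stage. -/
theorem lensOfEquivariant_app (f : X.total.obj ⟶ Y.total.obj)
    (hf : f ≫ Y.proj.onPos = X.proj.onPos) {T : E} (x : T ⟶ X.total.obj) (d : T ⟶ Y.total.mor)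
    (h : x ≫ f = d ≫ Y.total.src) : (lensOfEquivariant f hf).app x d h =
      X.proj.app x (d ≫ Y.label) (homOfEquivariant_cond hf x d h) :=
  ArrowLens.ofElements_app f _ (fun _ _ _ => ArrowLens.app_comp _ _ _ _) (fun _ _ _ _ => (ArrowLens.comp_app _ _ _ _ _).trans
    (ArrowLens.app_congr rfl rfl (Category.assoc _ _ _).symm _ _)) x d h

/-- The morphism of copresheaves determined by an equivariant morphism on objects. -/
noncomputable def homOfEquivariant (f : X.total.obj ⟶ Y.total.obj)
    (hf : f ≫ Y.proj.onPos = X.proj.onPos)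
    (hf' : ∀ {T : E} (x : T ⟶ X.total.obj) (e : T ⟶ C.mor) (h : x ≫ X.proj.onPos = e ≫ C.src),
      X.proj.app x e h ≫ X.total.tgt ≫ f =
        Y.proj.app (x ≫ f) e (by rw [Category.assoc, hf, h]) ≫ Y.total.tgt) : Hom X Y where
  cofunctor :=
    { toArrowLens := lensOfEquivariant f hf
      app_ident := fun x => by
        have e : (x ≫ f ≫ Y.total.ident) ≫ Y.label = x ≫ X.proj.onPos ≫ C.ident := by
          rw [← Category.assoc x f, ident_label, ← hf]
          simp only [Category.assoc]
        refine (lensOfEquivariant_app f hf x (x ≫ f ≫ Y.total.ident)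
          (by simp only [Category.assoc, Y.total.ident_src, Category.comp_id])).trans ?_
        rw [← X.proj.app_ident x]
        exact ArrowLens.app_congr rfl rfl e _ _
      onPos_tgt := fun x d h => by
        rw [lensOfEquivariant_app f hf x d h]
        -- Equivariance at the label of `d`; on the side of `Y` the lift of that label is `d`
        -- itself.
        refine (hf' x (d ≫ Y.label) (homOfEquivariant_cond hf x d h)).trans ?_
        exact congrArg (· ≫ Y.total.tgt) (Y.app_of_label _ d h _)
      app_compElt := fun x d d' h h' => by
        have k := homOfEquivariant_cond hf x d h
        have k' : (d ≫ Y.label) ≫ C.tgt = (d' ≫ Y.label) ≫ C.src := by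
          rw [Category.assoc, ← label_tgt, reassoc_of% h', Category.assoc, label_src]
        refine (lensOfEquivariant_app f hf x _ _).trans ?_
        -- Labels turn composites in `Y` into composites in `C`, so the composition axiom is
        -- inherited from the projection of `X`.
        refine (ArrowLens.app_congr rfl rfl (Y.compElt_label d d' h') _
          (by rw [InternalCategory.compElt_src, k])).trans ?_
        refine (X.proj.app_compElt x _ _ k k').trans ?_
        refine InternalCategory.compElt_congr (lensOfEquivariant_app f hf x d h).symm ?_ _ _
        refine Eq.trans ?_ (lensOfEquivariant_app f hf _ d' _).symm
        exact ArrowLens.app_congr rfl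
          (congrArg (· ≫ X.total.tgt) (lensOfEquivariant_app f hf x d h).symm) rfl _ _ }
  w := by
    refine Cofunctor.ext (ArrowLens.ext hf fun x e h h' => ?_)
    refine (ArrowLens.comp_app' (lensOfEquivariant f hf) Y.proj.toArrowLens x e h).trans ?_
    refine (lensOfEquivariant_app f hf x _ _).trans ?_
    exact ArrowLens.app_congr rfl rfl (Y.app_label _ _ _) _ _

/-! ### Equivalence of copresheaves and actions -/

/-- The functor sending a copresheaf to the action of the base on its objects. -/
noncomputable def toActionFunctor (C : InternalCategory E) : InternalCopresheaf C ⥤ C.Action where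
  obj X := X.toAction
  map {X Y} F :=
    { hom := F.cofunctor.onPos
      hom_anchor := Hom.onPos_comp F
      smul_hom := fun s f h => by
        have k : (s ≫ F.cofunctor.onPos) ≫ Y.proj.onPos = f ≫ C.src := by
          exact (Category.assoc _ _ _).trans ((s ≫= Hom.onPos_comp F).trans h)
        refine Eq.trans ?_ (Y.toAction_smul _ _ k).symm
        refine (congrArg (· ≫ F.cofunctor.onPos) (X.toAction_smul s f h)).trans ?_
        -- The lift in `X` is rewritten as the image under the cofunctor of the lift in `Y`; the
        -- target axiom of the cofunctor then gives equivariance.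
        refine (congrArg (fun d => (d ≫ X.total.tgt) ≫ F.cofunctor.onPos)
          (Hom.app_app F s f h).symm).trans ?_
        refine (Category.assoc _ _ _).trans ?_
        exact F.cofunctor.onPos_tgt s (Y.proj.app _ f k) (ArrowLens.app_comp _ _ _ _).symm }
  map_id _ := rfl
  map_comp _ _ := rfl

instance (C : InternalCategory E) : (toActionFunctor C).Faithful where
  map_injective {X Y} F G h := by
    have h' : F.cofunctor.onPos = G.cofunctor.onPos :=
      congrArg InternalCategory.Action.Hom.hom h
    exact Hom.ext (ArrowLens.ext h' fun x d k k' =>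
      (Hom.app_eq F x d k).trans (Hom.app_eq G x d k').symm)

instance (C : InternalCategory E) : (toActionFunctor C).Full where
  map_surjective {X Y} f :=
    ⟨homOfEquivariant f.hom f.hom_anchor fun x e h => by
      refine (Category.assoc _ _ _).symm.trans ?_
      refine (congrArg (· ≫ f.hom) (X.toAction_smul x e h).symm).trans ?_
      exact (f.smul_hom x e h).trans (Y.toAction_smul _ _ _), rfl⟩

/-- The copresheaf of elements of an action. -/
noncomputable def ofAction {C : InternalCategory E} (A : C.Action) : InternalCopresheaf C where
  total := A.elements
  proj := A.elementsProj
  isCartesian := inferInstanceAs (IsIso (𝟙 _))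

/-- The objects and targets of the category of elements give back the carrier and the action, the
latter preceded by the identity φ♯. The isomorphism is therefore the identity of the carrier. -/
instance (C : InternalCategory E) : (toActionFunctor C).EssSurj where
  mem_essImage A := ⟨ofAction A, ⟨InternalCategory.Action.isoMk (X := (ofAction A).toAction)
    ⟨𝟙 A.carrier, Category.id_comp _, fun s f h => by
      refine (Category.comp_id _).trans ?_
      refine (congrArg (pullback.lift s f h ≫ ·) (Category.id_comp A.act)).trans ?_
      exact A.smul_congr (Category.comp_id s).symm rfl h _⟩
    (𝟙 A.carrier) (Category.comp_id _) (Category.comp_id _)⟩⟩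

instance (C : InternalCategory E) : (toActionFunctor C).IsEquivalence where

end InternalCopresheaf

/-! ### Counit and comultiplication of the comonad on elements -/

namespace Poly

variable {c : Poly E} [ComonObj c]

/-- The counit evaluates an element of `P(c)(A)` at the identity. -/
theorem comp_ε_app {A T : E} (w : T ⟶ c.functor.obj A)
    (h : w ≫ c.proj A = (w ≫ c.proj A ≫ identity c) ≫ c.map) :
    w ≫ natApp (counit c) A ≫ beta A = c.eval w (w ≫ c.proj A ≫ identity c) h := by
  rw [← Category.assoc, comp_beta _ (terminal.from T) (Subsingleton.elim _ _), eval_natApp]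
  -- It remains to see that ε♯ at the position of `w` is the identity there: identities are ε♯ at
  -- the universal position, and ε♯ commutes with change of stage.
  refine c.eval_congr rfl ?_ _ _
  refine Eq.trans ?_ (Category.assoc _ _ _)
  refine Eq.trans ?_ (ArrowLens.comp_app _ _ _ _ _).symm
  exact ArrowLens.app_congr rfl (Category.comp_id _).symm (Subsingleton.elim _ _) _ _

theorem natApp_comul_proj (A : E) : natApp (comul c) A ≫ (tri c c).proj A =
    c.proj A ≫ comulPos c := natApp_proj (comul c) A

/-- The position of the image is the position in `c` underlying δ₁(x), where x is the position of
`w`. This is x itself by `comulPos_proj`, a consequence of a counit law of the comonoid. -/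
theorem comp_δ_app_proj {A T : E} (w : T ⟶ c.functor.obj A) :
    (w ≫ natApp (comul c) A ≫ alpha c c A) ≫ c.proj _ = w ≫ c.proj A := by
  rw [Category.assoc, Category.assoc, alpha_proj, ← Category.assoc (natApp (comul c) A),
    natApp_comul_proj, Category.assoc, comulPos_proj, Category.comp_id]

/-- The comultiplication sends `(x, g)` to `f ↦ (target f, h ↦ g (h ∘ f))`: positions. -/
theorem eval_δ_app_proj {A T : E} (w : T ⟶ c.functor.obj A) (f : T ⟶ c.dir)
    (h : (w ≫ natApp (comul c) A ≫ alpha c c A) ≫ c.proj _ = f ≫ c.map) :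
    c.eval (w ≫ natApp (comul c) A ≫ alpha c c A) f h ≫ c.proj A = f ≫ target c := by
  have hw : w ≫ c.proj A = f ≫ c.map := by rw [← h, comp_δ_app_proj]
  have h' : ((w ≫ natApp (comul c) A) ≫ alpha c c A) ≫ c.proj _ = f ≫ c.map := by
    rw [Category.assoc w]; exact h
  rw [c.eval_congr (Category.assoc _ _ _).symm rfl h h', eval_alpha_proj]
  -- P(δ) moves the position x of `w` to δ₁(x), and the value of δ₁(x) at `f` is the target of `f`.
  have k : (w ≫ c.proj A) ≫ comulPos c = (w ≫ natApp (comul c) A) ≫ (tri c c).proj A := by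
    rw [Category.assoc, Category.assoc, natApp_comul_proj]
  refine (c.eval_congr k.symm rfl _ (comulPos_cond _ _ hw)).trans ?_
  exact eval_comulPos _ _ _

/-- The comultiplication sends `(x, g)` to `f ↦ (target f, h ↦ g (h ∘ f))`: values. -/
theorem eval_eval_δ_app {A T S : E} (s : S ⟶ T) (w : T ⟶ c.functor.obj A) (f : T ⟶ c.dir)
    (g : S ⟶ c.dir) (h : (w ≫ natApp (comul c) A ≫ alpha c c A) ≫ c.proj _ = f ≫ c.map)
    (k : (s ≫ f) ≫ target c = g ≫ c.map)
    (h' : (s ≫ c.eval (w ≫ natApp (comul c) A ≫ alpha c c A) f h) ≫ c.proj A = g ≫ c.map)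
    (h'' : (s ≫ w) ≫ c.proj A = composite (s ≫ f) g k ≫ c.map) :
    c.eval (s ≫ c.eval (w ≫ natApp (comul c) A ≫ alpha c c A) f h) g h' =
      c.eval (s ≫ w) (composite (s ≫ f) g k) h'' := by
  have hw : w ≫ c.proj A = f ≫ c.map := by rw [← h, comp_δ_app_proj]
  have h₁ : ((w ≫ natApp (comul c) A) ≫ alpha c c A) ≫ c.proj _ = f ≫ c.map := by
    rw [Category.assoc w]; exact h
  have e₁ := c.eval_congr (Category.assoc _ _ _).symm rfl h h₁
  have h₂ := h'
  rw [e₁] at h₂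
  refine (c.eval_congr (s ≫= e₁) rfl h' h₂).trans ?_
  refine (eval_eval_alpha c c s (w ≫ natApp (comul c) A) f g h₁ h₂).trans ?_
  have hx : s ≫ w ≫ c.proj A = (s ≫ f) ≫ c.map := by rw [hw, Category.assoc]
  have hu : s ≫ (w ≫ natApp (comul c) A) ≫ (tri c c).proj A = ((s ≫ f) ≫ c.map) ≫ comulPos c := by
    rw [← hx]; simp only [Category.assoc, natApp_comul_proj]
  -- By `hu`, the direction (f, g) of c ◁ c supplied by the comparison `alpha` is `comulMk`; there
  -- δ♯ is by definition the composite of f and g.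
  have m : ((s ≫ w) ≫ natApp (comul c) A) ≫ (tri c c).proj A =
      comulMk (s ≫ f) g k ≫ (tri c c).map := by
    refine Eq.trans ?_ (hu.trans (triMk_map c c _ _ _ _ _).symm)
    simp only [Category.assoc]
  refine ((tri c c).eval_congr (Category.assoc _ _ _).symm ?_ _ m).trans ?_
  · exact triMk_congr (p := c) (q := c) _ _ hu rfl rfl _ _
  rw [eval_natApp]
  exact c.eval_congr rfl (ArrowLens.app_congr rfl ((Category.assoc _ _ _).trans hx) rfl _ _) _ _

/-- The composition of `internalCategory` is `composite` on the universal composable pair;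
naturality in the stage gives the general case. -/
theorem internalCategory_compElt {T : E} (f g : T ⟶ c.dir) (h : f ≫ target c = g ≫ c.map) :
    c.internalCategory.compElt f g h = composite f g h :=
  (comp_composite _ _ _ _).trans
    (composite_congr (pullback.lift_fst _ _ _) (pullback.lift_snd _ _ _) _ _)

/-! ### The coalgebra laws on generalized elements -/

variable (c) in
/-- Coassociativity of a coalgebra structure, on generalized elements. -/
theorem coassoc_iff {S : E} (κ : S ⟶ c.functor.obj S) :
    κ ≫ natApp (comul c) S ≫ alpha c c S = κ ≫ c.functor.map κ ↔
      (∀ {T : E} (s : T ⟶ S) (f : T ⟶ c.dir) (h : (s ≫ κ) ≫ c.proj S = f ≫ c.map),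
        ∃ h' : c.eval (s ≫ κ) f h ≫ κ ≫ c.proj S = f ≫ target c,
        ∀ (g : T ⟶ c.dir) (k : f ≫ target c = g ≫ c.map),
          c.eval (s ≫ κ) (composite f g k) (by rw [h, composite_map]) =
            c.eval (c.eval (s ≫ κ) f h ≫ κ) g (by rw [Category.assoc, h', k])) := by
  -- With s·f for the value of κ(s) at f, the right-hand side P(c)(κ)∘κ takes the value κ(s·f) at f.
  have ev : ∀ {T : E} (s : T ⟶ S) (f : T ⟶ c.dir)
      (h : (s ≫ κ ≫ c.functor.map κ) ≫ c.proj _ = f ≫ c.map),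
      c.eval (s ≫ κ ≫ c.functor.map κ) f h = c.eval (s ≫ κ) f (by simpa using h) ≫ κ := by
    intro T s f h
    refine (c.eval_congr (Category.assoc _ _ _).symm rfl _ (by simpa using h)).trans ?_
    rw [eval_map]
  have assoc' : ∀ {T : E} (s : T ⟶ S), s ≫ κ ≫ natApp (comul c) S ≫ alpha c c S =
      (s ≫ κ) ≫ natApp (comul c) S ≫ alpha c c S := fun s => (Category.assoc _ _ _).symm
  constructor
  · intro H T s f h
    have hk : ((s ≫ κ) ≫ natApp (comul c) S ≫ alpha c c S) ≫ c.proj _ = f ≫ c.map := by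
      rw [comp_δ_app_proj, h]
    -- Both sides are evaluated at `f`, giving two elements of P(c)(S). Their positions yield `h'`,
    -- and their values at `g` yield the action law.
    have e : c.eval ((s ≫ κ) ≫ natApp (comul c) S ≫ alpha c c S) f hk =
        c.eval (s ≫ κ) f h ≫ κ := by
      rw [← ev s f (by simpa using h)]
      exact c.eval_congr ((assoc' s).symm.trans (s ≫= H)) rfl _ _
    have h' : c.eval (s ≫ κ) f h ≫ κ ≫ c.proj S = f ≫ target c := by
      rw [← Category.assoc, ← e, eval_δ_app_proj]
    refine ⟨h', fun g k => ?_⟩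
    -- Here `g` lives at the same stage as `f`, so the change of stage is the identity.
    have k' : (𝟙 T ≫ f) ≫ target c = g ≫ c.map := by rw [Category.id_comp, k]
    have k₂ : (𝟙 T ≫ c.eval ((s ≫ κ) ≫ natApp (comul c) S ≫ alpha c c S) f hk) ≫ c.proj S =
        g ≫ c.map := by rw [Category.id_comp, eval_δ_app_proj, k]
    have e₂ := eval_eval_δ_app (𝟙 T) (s ≫ κ) f g hk k' k₂
      (by rw [composite_map, Category.id_comp, Category.id_comp, h])
    refine Eq.trans (Eq.trans ?_ e₂.symm) ?_
    · exact c.eval_congr (Category.id_comp _).symm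
        (composite_congr (Category.id_comp _).symm rfl _ _) _ _
    · exact c.eval_congr ((Category.id_comp _).trans e) rfl _ _
  · intro H
    refine c.hom_ext ?_ fun s f hu hv => ?_
    · rw [comp_δ_app_proj, Category.assoc, map_proj]
    have h : (s ≫ κ) ≫ c.proj S = f ≫ c.map := by simpa using hv
    have hk : ((s ≫ κ) ≫ natApp (comul c) S ≫ alpha c c S) ≫ c.proj _ = f ≫ c.map := by
      rw [comp_δ_app_proj, h]
    refine Eq.trans ?_ (ev s f hv).symm
    refine (c.eval_congr (assoc' s) rfl _ hk).trans ?_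
    obtain ⟨h', -⟩ := H s f h
    -- The values at `f` again lie in P(c)(S), so they are compared a second time, by position and
    -- at every direction `g` over a later stage `t`.
    refine c.hom_ext ?_ fun t g hu hv => ?_
    · rw [eval_δ_app_proj, Category.assoc, h']
    have k : (t ≫ f) ≫ target c = g ≫ c.map := by
      rw [← hu, Category.assoc, Category.assoc, eval_δ_app_proj]
    have ht : ((t ≫ s) ≫ κ) ≫ c.proj S = (t ≫ f) ≫ c.map := by
      rw [Category.assoc t f, ← h]; simp only [Category.assoc]
    refine (eval_eval_δ_app t (s ≫ κ) f g hk k hu (by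
      rw [composite_map, Category.assoc, h, Category.assoc])).trans ?_
    -- As `g` exists only over `t`, the hypothesis is used for the restrictions of `s` and `f` along
    -- `t`.
    obtain ⟨h₂, H₂⟩ := H (t ≫ s) (t ≫ f) ht
    refine (c.eval_congr (Category.assoc _ _ _).symm rfl _ (by rw [ht, composite_map])).trans ?_
    refine (H₂ g k).trans ?_
    refine c.eval_congr ?_ rfl _ _
    rw [← Category.assoc, comp_eval]
    exact congrArg (· ≫ κ) (c.eval_congr (Category.assoc _ _ _) rfl _ _)

/-- The counit evaluates κ(s) at the identity of its position, so the counit equation is the unit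
law s·id = s. -/
theorem counit_iff {S : E} (κ : S ⟶ c.functor.obj S) :
    κ ≫ natApp (counit c) S ≫ beta S = 𝟙 S ↔
      c.eval κ (κ ≫ c.proj S ≫ identity c)
        (by simp only [Category.assoc, identity_map, Category.comp_id]) = 𝟙 S := by
  rw [comp_ε_app]

/-! ### From actions to coalgebras -/

/-- The position of an element of an action of the internal category of `c`. -/
noncomputable def actionPos (A : c.internalCategory.Action) : A.carrier ⟶ c.pos := A.anchor

/-- A direction of `c` acting on an element of an action of the internal category of `c`. -/
noncomputable def actionApp (A : c.internalCategory.Action) {T : E} (s : T ⟶ A.carrier)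
    (f : T ⟶ c.dir) (h : s ≫ actionPos A = f ≫ c.map) : T ⟶ A.carrier :=
  A.smul s f h

theorem actionApp_pos (A : c.internalCategory.Action) {T : E} (s : T ⟶ A.carrier)
    (f : T ⟶ c.dir) (h : s ≫ actionPos A = f ≫ c.map) :
    actionApp A s f h ≫ actionPos A = f ≫ target c :=
  A.smul_anchor s f h

theorem actionApp_congr (A : c.internalCategory.Action) {T : E} {s s' : T ⟶ A.carrier}
    {f f' : T ⟶ c.dir} (hs : s = s') (hf : f = f') (h : s ≫ actionPos A = f ≫ c.map)
    (h' : s' ≫ actionPos A = f' ≫ c.map) : actionApp A s f h = actionApp A s' f' h' := by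
  subst hs hf; rfl

theorem actionApp_identity (A : c.internalCategory.Action) {T : E} (s : T ⟶ A.carrier)
    (x : T ⟶ c.pos) (h : s ≫ actionPos A = (x ≫ identity c) ≫ c.map) :
    actionApp A s (x ≫ identity c) h = s :=
  A.smul_ident s x h

/-- The action law in terms of the comonoid: composition in `internalCategory` is replaced by
`composite`, the form in which δ♯ enters the coalgebra equation. -/
theorem actionApp_composite (A : c.internalCategory.Action) {T : E} (s : T ⟶ A.carrier)
    (f g : T ⟶ c.dir) (h : s ≫ actionPos A = f ≫ c.map) (h' : f ≫ target c = g ≫ c.map) :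
    actionApp A s (composite f g h') (by rw [composite_map, h]) =
      actionApp A (actionApp A s f h) g (by rw [actionApp_pos, h']) :=
  (A.smul_congr rfl (internalCategory_compElt f g h').symm _
    (h.trans (c.internalCategory.compElt_src f g h').symm)).trans (A.smul_compElt s f g h h')

/-- The structure morphism corresponding to an action. -/
noncomputable def coact (A : c.internalCategory.Action) :
    A.carrier ⟶ c.functor.obj A.carrier :=
  c.curry (actionPos A) A.act

theorem coact_proj (A : c.internalCategory.Action) : coact A ≫ c.proj _ = actionPos A :=
  c.curry_proj (actionPos A) A.act

/-- The computation rule of `curry`: evaluating the curried action returns the action. It translates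
the coalgebra equations into action laws. -/
theorem eval_coact (A : c.internalCategory.Action) {T : E} (s : T ⟶ A.carrier) (f : T ⟶ c.dir)
    (h : (s ≫ coact A) ≫ c.proj _ = f ≫ c.map) :
    c.eval (s ≫ coact A) f h =
      actionApp A s f (by rw [← h, Category.assoc, coact_proj]) :=
  c.eval_comp_curry s (actionPos A) A.act f h

/-- The coalgebra corresponding to an action. -/
noncomputable def coalgebraOfAction (A : c.internalCategory.Action) : c.comonad.Coalgebra where
  A := A.carrier
  a := coact A
  counit := by
    refine (counit_iff (coact A)).2 ?_
    -- The structure map is taken at the universal element of the carrier, the identity, where the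
    -- equation reads s·id = s.
    refine (c.eval_congr (Category.id_comp _).symm
      ((Category.assoc _ _ _).symm.trans (congrArg (· ≫ identity c) (coact_proj A))) _ ?_).trans
        ((eval_coact A (𝟙 _) (actionPos A ≫ identity c) ?_).trans (actionApp_identity A _ _ _))
    all_goals simp only [Category.assoc, identity_map, Category.comp_id, Category.id_comp,
      coact_proj]
  coassoc := by
    refine (coassoc_iff c (coact A)).2 fun s f h => ?_
    have h' : c.eval (s ≫ coact A) f h ≫ coact A ≫ c.proj _ = f ≫ target c := by
      rw [eval_coact]
      exact (_ ≫= coact_proj A).trans (actionApp_pos A s f _)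
    refine ⟨h', fun g k => ?_⟩
    rw [eval_coact, eval_coact, actionApp_composite A s f g (by
      rw [← h, Category.assoc, coact_proj]) k]
    exact actionApp_congr A (eval_coact A s f h).symm rfl _ _

/-- Both sides are maps into P(c)(B), hence are compared by position and by value at each direction.
The positions give compatibility with the anchors, the values give equivariance. -/
theorem map_coact_iff {A B : c.internalCategory.Action} (f : A.carrier ⟶ B.carrier) :
    coact A ≫ c.functor.map f = f ≫ coact B ↔
      ∃ hf : f ≫ actionPos B = actionPos A, ∀ {T : E} (s : T ⟶ A.carrier) (e : T ⟶ c.dir)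
        (h : s ≫ actionPos A = e ≫ c.map),
        actionApp A s e h ≫ f = actionApp B (s ≫ f) e (by rw [Category.assoc, hf, h]) := by
  constructor
  · intro H
    have hf : f ≫ actionPos B = actionPos A := by
      rw [← coact_proj, ← Category.assoc, ← H, Category.assoc, map_proj, coact_proj]
    refine ⟨hf, fun s e h => ?_⟩
    have k : (s ≫ coact A) ≫ c.proj _ = e ≫ c.map := by rw [Category.assoc, coact_proj, h]
    have k' : ((s ≫ coact A) ≫ c.functor.map f) ≫ c.proj _ = e ≫ c.map := by
      rw [Category.assoc, map_proj, k]
    have k₂ : ((s ≫ f) ≫ coact B) ≫ c.proj _ = e ≫ c.map := by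
      rw [Category.assoc, coact_proj, Category.assoc, hf, h]
    rw [← eval_coact A s e k, ← c.eval_map f _ _ k', ← eval_coact B (s ≫ f) e k₂]
    exact c.eval_congr (by rw [Category.assoc, H, Category.assoc]) rfl _ _
  · rintro ⟨hf, H⟩
    refine c.hom_ext ?_ fun s e hu hv => ?_
    · rw [Category.assoc, map_proj, coact_proj, Category.assoc, coact_proj, hf]
    have h : s ≫ actionPos A = e ≫ c.map := by
      rw [← hv, Category.assoc, Category.assoc, coact_proj, hf]
    have k' : ((s ≫ coact A) ≫ c.functor.map f) ≫ c.proj _ = e ≫ c.map := by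
      rw [Category.assoc, map_proj, Category.assoc, coact_proj, h]
    have k₂ : ((s ≫ f) ≫ coact B) ≫ c.proj _ = e ≫ c.map := by
      rw [Category.assoc, coact_proj, Category.assoc, hf, h]
    refine (c.eval_congr (Category.assoc _ _ _).symm rfl _ k').trans ?_
    refine Eq.trans ?_ (c.eval_congr (Category.assoc _ _ _).symm rfl _ k₂).symm
    rw [eval_map, eval_coact, eval_coact, H s e h]

variable (c) in
/-- The functor from actions of the internal category of `c` to `c`-coalgebras. -/
noncomputable def actionToCoalgebra : c.internalCategory.Action ⥤ c.comonad.Coalgebra where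
  obj := coalgebraOfAction
  map F := ⟨F.hom, (map_coact_iff F.hom).2 ⟨F.hom_anchor, F.smul_hom⟩⟩
  map_id _ := rfl
  map_comp _ _ := rfl

instance : (actionToCoalgebra c).Faithful where
  map_injective h := InternalCategory.Action.Hom.ext (congrArg Comonad.Coalgebra.Hom.f h)

/-- The homomorphism equation carries all of equivariance, including the anchors, by the forward
direction of `map_coact_iff`. -/
instance : (actionToCoalgebra c).Full where
  map_surjective f :=
    ⟨⟨f.f, ((map_coact_iff f.f).1 f.h).fst, ((map_coact_iff f.f).1 f.h).snd⟩, rfl⟩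

/-! ### From coalgebras to actions -/

/-- The action corresponding to a coalgebra. -/
noncomputable def actionOfCoalgebra {S : E} (κ : S ⟶ c.functor.obj S)
    (hκ : κ ≫ natApp (counit c) S ≫ beta S = 𝟙 S)
    (hκ' : κ ≫ natApp (comul c) S ≫ alpha c c S = κ ≫ c.functor.map κ) :
    c.internalCategory.Action :=
  -- The action is evaluation of κ(s) at f, taken on the universal pair (s, f); `lift_act` extends
  -- this description to every stage.
  let act : pullback (κ ≫ c.proj S) c.map ⟶ S :=
    c.eval (pullback.fst (κ ≫ c.proj S) c.map ≫ κ) (pullback.snd _ _)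
      (by rw [Category.assoc, pullback.condition])
  have lift_act : ∀ {T : E} (s : T ⟶ S) (f : T ⟶ c.dir) (h : s ≫ κ ≫ c.proj S = f ≫ c.map),
      pullback.lift s f h ≫ act = c.eval (s ≫ κ) f (by rw [Category.assoc, h]) := by
    intro T s f h
    rw [comp_eval]
    exact c.eval_congr (by simp) (by simp) _ _
  { carrier := S
    anchor := κ ≫ c.proj S
    act := act
    -- The position half of coassociativity at the universal pair. The value half gives
    -- `act_compElt`.
    act_anchor := ((coassoc_iff c κ).1 hκ' _ _ _).fst
    act_ident := by
      refine (lift_act (𝟙 S) ((κ ≫ c.proj S) ≫ identity c) _).trans ?_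
      exact (c.eval_congr (Category.id_comp κ) (Category.assoc _ _ _) _ _).trans
        ((counit_iff κ).1 hκ)
    act_compElt := fun s f g h h' => by
      obtain ⟨k, H⟩ := (coassoc_iff c κ).1 hκ' s f ((Category.assoc _ _ _).trans h)
      refine (lift_act s _ _).trans (Eq.trans ?_ (lift_act _ g _).symm)
      refine (c.eval_congr rfl (internalCategory_compElt f g h') _
        (((Category.assoc _ _ _).trans h).trans (composite_map _ _ _).symm)).trans ?_
      refine (H g h').trans ?_
      exact c.eval_congr (congrArg (· ≫ κ) (lift_act s f h).symm) rfl _ _ }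

/-- The uniqueness half of the universal property of P(c)(S): currying the evaluation of κ returns
κ, because the two maps have the same position and the same values. -/
theorem coact_actionOfCoalgebra {S : E} (κ : S ⟶ c.functor.obj S)
    (hκ : κ ≫ natApp (counit c) S ≫ beta S = 𝟙 S)
    (hκ' : κ ≫ natApp (comul c) S ≫ alpha c c S = κ ≫ c.functor.map κ) :
    coact (actionOfCoalgebra κ hκ hκ') = κ := by
  refine c.hom_ext (coact_proj _) fun s e hu hv => ?_
  refine (eval_coact (actionOfCoalgebra κ hκ hκ') s e hu).trans ?_
  refine (c.comp_eval _ _ _ _).trans ?_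
  exact c.eval_congr ((Category.assoc _ _ _).symm.trans
    (congrArg (· ≫ κ) (pullback.lift_fst _ _ _))) (pullback.lift_snd _ _ _) _ _

/-- The action built from a coalgebra has the same carrier and returns the same structure map, so
the identity is an isomorphism of coalgebras. -/
instance : (actionToCoalgebra c).EssSurj where
  mem_essImage X := ⟨actionOfCoalgebra X.a X.counit X.coassoc,
    ⟨Comonad.Coalgebra.isoMk (Iso.refl X.A) (by
      refine (congrArg (_ ≫ ·) (c.functor.map_id X.A)).trans ((Category.comp_id _).trans ?_)
      exact (coact_actionOfCoalgebra X.a X.counit X.coassoc).trans (Category.id_comp _).symm)⟩⟩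

instance : (actionToCoalgebra c).IsEquivalence where

end Poly

end InternalPoly

theorem mainTheorem4 {E : Type u} [Category.{v} E] [HasFiniteLimits E]
    (c : InternalPoly.Poly E) [ComonObj c] :
    Nonempty (c.comonad.Coalgebra ≌ InternalPoly.InternalCopresheaf c.internalCategory) :=
  -- Copresheaves are equivalent to actions, and actions to coalgebras; the composite is read
  -- backwards.
  ⟨((InternalPoly.InternalCopresheaf.toActionFunctor c.internalCategory).asEquivalence.trans
    (InternalPoly.Poly.actionToCoalgebra c).asEquivalence).symm⟩
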